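/- Let $d\ge 1$ and $\lambda,\eta\in\mathbb R$. For $s\ge 0$ let $\Sigma^{s}=\{\phi\in H^{s}(\mathbb R^d;\mathbb C): (1+|x|^2)^{s/2}\phi\in L^2\}$ with norm $\|(1+|x|^2)^{s/2}\phi\|_{L^2}+\|(1-\Delta)^{s/2}\phi\|_{L^2}$, let $\Sigma=\Sigma^1$, and let $\Sigma^{-s}$ be the dual of $\Sigma^s$. Consider the Cauchy problem $$2i v_t=-\Delta v+\lambda|x|^2v+\eta\, v\int_{\mathbb R^d}\bigl(|x-y|^2-|y|^2\bigr)|v(t,y)|^2\,dy,\qquad (t,x)\in\mathbb R^{1+d},\qquad v(0)=v_0\in\Sigma^{1/2}. \tag{H$'$}$$ For $u\in\Sigma^{1/2}$ put $M[u]=\|u\|_{L^2}^2$, $X[u]=\int x|u|^2dx\in\mathbb R^d$ and $P[u]=\int \xi|\hat u(\xi)|^2d\xi\in\mathbb R^d$ (equal to $\operatorname{Im}\int\bar u\nabla u\,dx$), where $\hat u(\xi)=(2\pi)^{-d/2}\int e^{-ix\cdot\xi}u(x)\,dx$, and let $$E[u]=\tfrac12\|\nabla u\|_{L^2}^2+\tfrac\lambda2\|xu\|_{L^2}^2+\tfrac\eta4\iint|x-y|^2|u(x)|^2|u(y)|^2\,dx\,dy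 .$$ For $\kappa\in\mathbb R$ and $a,b\in\mathbb R^d$ let $g_\kappa(t)=g_\kappa(t,a,b)$ be the solution of $g''=-\kappa g$, $g'(0)=a$, $g(0)=b$, let $$(\mathcal G_\kappa(t,a,b)\phi)(x)=e^{-\frac i2 g_\kappa(t)\cdot g_\kappa'(t)}e^{ix\cdot g_\kappa'(t)}\phi(x-g_\kappa(t)),$$ and let $\mathcal U_\kappa(t)=e^{\frac{it}{2}(\Delta-\kappa|x|^2)}$ be the unitary group on $L^2$ generated by $\frac i2(\Delta-\kappa|x|^2)$, that is, the unique strongly continuous unitary group whose generator extends this operator on the Schwartz functions (it exists for every $\kappa\in\mathbb R$). **Theorem.** Problem (H$'$) is globally well-posed in $\Sigma^{1/2}$: for every $v_0\in\Sigma^{1/2}$ there is a solution $v\in C(\mathbb R;\Sigma^{1/2})\cap C^1(\mathbb R;\Sigma^{-3/2})$, satisfying the equation in $\Sigma^{-3/2}$, and the map $v_0\mapsto v$ is continuous from $\Sigma^{1/2}$ to $L^\infty_{\rm loc}(\mathbb R;\Sigma^{1/2})$. Uniqueness holds unconditionally: $v$ is the only element of $C(\mathbb R;\Sigma^{1/2})$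 with $v(0)=v_0$ that solves the equation in the sense of distributions. The mass is conserved: $M[v(t)]=M[v_0]$ for all $t$. If $v_0\in\Sigma$, then the energy $E[v(t)]$ is finite and equal to $E[v_0]$ for all $t$. Moreover, with $M=M[v_0]$, $a=P[v_0]/M$, $b=X[v_0]/M$ ($a=b=0$ if $v_0=0$) and $\kappa=\lambda+\eta M$, for all $t\in\mathbb R$, $$v(t)=e^{-i\Phi(t)}\mathcal G_\lambda(t,a,b)\,\mathcal U_\kappa(t)\,\mathcal G_\kappa(0,a,b)^{-1}v_0 =e^{-i\Phi(t)}\mathcal G_\lambda(t,a,b)\,\mathcal G_\kappa(t,a,b)^{-1}\,\mathcal U_\kappa(t)v_0,$$ where $\Phi(t)=-\frac{\eta M}{2}\int_0^t|g_\lambda(s,a,b)|^2\,ds$. -/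

import Mathlib

open MeasureTheory Filter Topology
open scoped ENNReal SchwartzMap FourierTransform Laplacian

namespace NonlocalSchrodinger

noncomputable section

/-- The space `ℝ^d` with the Euclidean norm. -/
abbrev Space (d : ℕ) : Type := EuclideanSpace ℝ (Fin d)

/-- The complex Hilbert space `L²(ℝ^d)`. -/
abbrev L2 (d : ℕ) : Type := Lp (α := Space d) ℂ 2 volume

variable {d : ℕ}

section FunctionSpaces

/-- The norm of `Σ^s` (`s ≥ 0`) on `L²`, with value `∞` outside `Σ^s`:
`‖⟨x⟩^s u‖_{L²} + ‖⟨D⟩^s u‖_{L²}`, where `⟨x⟩ = (1 + |x|²)^{1/2}`. Mathlib's Fourier transform has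
the kernel `exp(-2πi x·ξ)`, so `⟨D⟩ = (1 - Δ)^{1/2}` has the symbol `(1 + |2πξ|²)^{1/2}`. -/
def sigmaNorm (s : ℝ) (u : L2 d) : ℝ≥0∞ :=
  eLpNorm (fun x : Space d => (((1 + ‖x‖ ^ 2) ^ (s / 2) : ℝ) : ℂ) * u x) 2 volume +
  eLpNorm (fun ξ : Space d =>
    (((1 + (2 * Real.pi * ‖ξ‖) ^ 2) ^ (s / 2) : ℝ) : ℂ) * (𝓕 u : L2 d) ξ) 2 volume

/-- `u ∈ Σ^s`, that is `u ∈ H^s` and `⟨x⟩^s u ∈ L²` (`s ≥ 0`); `Σ = Σ^1`. -/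
def MemSigma (s : ℝ) (u : L2 d) : Prop := sigmaNorm s u < ∞

/-- The norm of `Σ^{-s}`, the dual of `Σ^s`, of a functional given by its values on Schwartz
functions (which are dense in `Σ^s`). -/
def sigmaDualNorm (s : ℝ) (T : 𝓢(Space d, ℂ) → ℂ) : ℝ≥0∞ :=
  ⨆ (φ : 𝓢(Space d, ℂ)) (_ : sigmaNorm s (φ.toLp 2 volume) ≤ 1), ‖T φ‖ₑ

end FunctionSpaces

section Functionals

/-- The mass `M[u] = ‖u‖²_{L²}`. -/
def mass (u : L2 d) : ℝ := ‖u‖ ^ 2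

/-- `X[u] = ∫ x |u(x)|² dx`. -/
def meanPosition (u : L2 d) : Space d := ∫ x : Space d, ‖u x‖ ^ 2 • x

/-- `P[u] = Im ∫ ū ∇u dx = ∫ ξ |û(ξ)|² dξ` with the unitary Fourier transform of kernel
`(2π)^{-d/2} exp(-i x·ξ)`; in terms of Mathlib's Fourier transform, `∫ (2πξ) |𝓕u(ξ)|² dξ`. -/
def meanMomentum (u : L2 d) : Space d :=
  ∫ ξ : Space d, ‖(𝓕 u : L2 d) ξ‖ ^ 2 • ((2 * Real.pi) • ξ)

/-- `‖∇u‖²_{L²}`, computed by Plancherel's theorem; `∞` if `u ∉ H¹`. -/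
def gradSq (u : L2 d) : ℝ≥0∞ :=
  ∫⁻ ξ : Space d, ENNReal.ofReal ((2 * Real.pi * ‖ξ‖) ^ 2 * ‖(𝓕 u : L2 d) ξ‖ ^ 2)

/-- `‖x u‖²_{L²}`. -/
def momentSq (u : L2 d) : ℝ≥0∞ :=
  ∫⁻ x : Space d, ENNReal.ofReal (‖x‖ ^ 2 * ‖u x‖ ^ 2)

/-- `∬ |x - y|² |u(x)|² |u(y)|² dx dy`. -/
def interaction (u : L2 d) : ℝ≥0∞ :=
  ∫⁻ x : Space d, ∫⁻ y : Space d, ENNReal.ofReal (‖x - y‖ ^ 2 * ‖u x‖ ^ 2 * ‖u y‖ ^ 2)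

/-- All the integrals in the energy are finite. -/
def HasFiniteEnergy (u : L2 d) : Prop :=
  gradSq u < ∞ ∧ momentSq u < ∞ ∧ interaction u < ∞

/-- The energy
`E[u] = ½ ‖∇u‖² + (λ/2) ‖x u‖² + (η/4) ∬ |x - y|² |u(x)|² |u(y)|² dx dy`
(meaningful if `HasFiniteEnergy u`). -/
def energy (lam eta : ℝ) (u : L2 d) : ℝ :=
  1 / 2 * (gradSq u).toReal + lam / 2 * (momentSq u).toReal + eta / 4 * (interaction u).toReal

end Functionals

section Equation

/-- The nonlocal potential `x ↦ ∫ (|x - y|² - |y|²) |u(y)|² dy`. -/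
def nonlocalPotential (u : L2 d) (x : Space d) : ℝ :=
  ∫ y : Space d, (‖x - y‖ ^ 2 - ‖y‖ ^ 2) * ‖u y‖ ^ 2

/-- The distributional pairing `⟨u, φ⟩ = ∫ u φ dx`. -/
def pairing (u : L2 d) (φ : 𝓢(Space d, ℂ)) : ℂ := ∫ x : Space d, u x * φ x

/-- The right hand side `-Δu + λ|x|²u + η u ∫ (|x - y|² - |y|²) |u(y)|² dy` of the equation, as a
tempered distribution: it is paired with a Schwartz function, and the Laplacian is moved to it. -/
def rhs (lam eta : ℝ) (u : L2 d) (φ : 𝓢(Space d, ℂ)) : ℂ :=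
  ∫ x : Space d, u x * (-(Δ φ) x + ((lam * ‖x‖ ^ 2 : ℝ) : ℂ) * φ x
    + ((eta * nonlocalPotential u x : ℝ) : ℂ) * φ x)

/-- `v ∈ C(ℝ; Σ^{1/2})`. -/
def ContinuousSigmaHalf (v : ℝ → L2 d) : Prop :=
  (∀ t, MemSigma (1 / 2) (v t)) ∧
  ∀ t, Tendsto (fun s => sigmaNorm (1 / 2) (v s - v t)) (𝓝 t) (𝓝 0)

/-- `v ∈ C(ℝ; Σ^{1/2})` solves
`2i v_t = -Δv + λ|x|²v + η v ∫ (|x - y|² - |y|²) |v(y)|² dy` in the sense of distributions; nothing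
is required of `v_t` as an element of a normed space. -/
structure IsWeakSolution (lam eta : ℝ) (v : ℝ → L2 d) : Prop where
  continuous : ContinuousSigmaHalf v
  equation : ∀ (φ : 𝓢(Space d, ℂ)) (t : ℝ),
    HasDerivAt (fun s => pairing (v s) φ) (rhs lam eta (v t) φ / (2 * Complex.I)) t

/-- `v ∈ C(ℝ; Σ^{1/2}) ∩ C¹(ℝ; Σ^{-3/2})` solves
`2i v_t = -Δv + λ|x|²v + η v ∫ (|x - y|² - |y|²) |v(y)|² dy` in `Σ^{-3/2}`: the difference quotients
converge in `Σ^{-3/2}` and the derivative is continuous with values in `Σ^{-3/2}`. -/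
structure IsSolution (lam eta : ℝ) (v : ℝ → L2 d) : Prop where
  continuous : ContinuousSigmaHalf v
  equation : ∀ t : ℝ, Tendsto (fun h : ℝ => sigmaDualNorm (3 / 2) (fun φ =>
    2 * Complex.I * ((pairing (v (t + h)) φ - pairing (v t) φ) / (h : ℂ)) - rhs lam eta (v t) φ))
    (𝓝[≠] 0) (𝓝 0)
  continuous_deriv : (∀ t : ℝ, sigmaDualNorm (3 / 2) (rhs lam eta (v t)) < ∞) ∧
    ∀ t : ℝ, Tendsto (fun s : ℝ => sigmaDualNorm (3 / 2) (fun φ =>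
      rhs lam eta (v s) φ - rhs lam eta (v t) φ)) (𝓝 t) (𝓝 0)

end Equation

section LinearPropagator

/-- `U` is the strongly continuous one-parameter unitary group on `L²` generated by
`(i/2)(Δ - κ|x|²)`, an operator which is essentially skew-adjoint on the Schwartz functions. -/
structure IsSchrodingerGroup (κ : ℝ) (U : ℝ → (L2 d ≃ₗᵢ[ℂ] L2 d)) : Prop where
  zero : ∀ f, U 0 f = f
  add : ∀ s t f, U (s + t) f = U s (U t f)
  continuous : ∀ f, Continuous fun t => U t f
  generator : ∀ φ : 𝓢(Space d, ℂ), ∃ f' : L2 d,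
    (f' =ᵐ[volume] fun x => Complex.I / 2 * ((Δ φ) x - ((κ * ‖x‖ ^ 2 : ℝ) : ℂ) * φ x)) ∧
    HasDerivAt (fun t : ℝ => U t (φ.toLp 2 volume)) f' 0

/-- The unitary group `U_κ(t) = exp((it/2)(Δ - κ|x|²))` on `L²`, selected by the property that
determines it. -/
def propagator (κ : ℝ) : ℝ → (L2 d ≃ₗᵢ[ℂ] L2 d) :=
  @Classical.epsilon _ ⟨fun _ => LinearIsometryEquiv.refl ℂ (L2 d)⟩ (IsSchrodingerGroup κ)

end LinearPropagator

section Galilean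

/-- `g_κ(t, a, b)`: the solution of `g'' = -κ g`, `g'(0) = a`, `g(0) = b`. -/
def gSol (κ t : ℝ) (a b : Space d) : Space d :=
  if 0 < κ then Real.cos (√κ * t) • b + (Real.sin (√κ * t) / √κ) • a
  else if κ < 0 then Real.cosh (√(-κ) * t) • b + (Real.sinh (√(-κ) * t) / √(-κ)) • a
  else b + t • a

/-- The time derivative `g_κ'(t, a, b)`. -/
def gSol' (κ t : ℝ) (a b : Space d) : Space d :=
  if 0 < κ then Real.cos (√κ * t) • a - (√κ * Real.sin (√κ * t)) • b
  else if κ < 0 then Real.cosh (√(-κ) * t) • a + (√(-κ) * Real.sinh (√(-κ) * t)) • b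
  else a

theorem gSol_zero (κ : ℝ) (a b : Space d) : gSol κ 0 a b = b := by
  unfold gSol; split_ifs <;> simp

theorem gSol'_zero (κ : ℝ) (a b : Space d) : gSol' κ 0 a b = a := by
  unfold gSol'; split_ifs <;> simp

theorem hasDerivAt_gSol (κ t : ℝ) (a b : Space d) :
    HasDerivAt (fun s => gSol κ s a b) (gSol' κ t a b) t := by
  unfold gSol gSol'
  split_ifs with h1 h2
  · have hk : √κ ≠ 0 := (Real.sqrt_pos.2 h1).ne'
    have hl : HasDerivAt (fun s : ℝ => √κ * s) √κ t := by
      simpa using (hasDerivAt_id t).const_mul √κ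
    have := (hl.cos.smul_const b).add ((hl.sin.div_const √κ).smul_const a)
    refine this.congr_deriv ?_
    rw [mul_div_assoc, div_self hk, mul_one]
    module
  · have hk : √(-κ) ≠ 0 := (Real.sqrt_pos.2 (by linarith)).ne'
    have hl : HasDerivAt (fun s : ℝ => √(-κ) * s) √(-κ) t := by
      simpa using (hasDerivAt_id t).const_mul √(-κ)
    have := (hl.cosh.smul_const b).add ((hl.sinh.div_const √(-κ)).smul_const a)
    refine this.congr_deriv ?_
    rw [mul_div_assoc, div_self hk, mul_one]
    module
  · simpa using ((hasDerivAt_id t).smul_const a).const_add b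

theorem hasDerivAt_gSol' (κ t : ℝ) (a b : Space d) :
    HasDerivAt (fun s => gSol' κ s a b) (-κ • gSol κ t a b) t := by
  unfold gSol gSol'
  split_ifs with h1 h2
  · have hk : √κ ≠ 0 := (Real.sqrt_pos.2 h1).ne'
    have hs : √κ * √κ = κ := Real.mul_self_sqrt h1.le
    have hl : HasDerivAt (fun s : ℝ => √κ * s) √κ t := by
      simpa using (hasDerivAt_id t).const_mul √κ
    have := (hl.cos.smul_const a).sub ((hl.sin.const_mul √κ).smul_const b)
    refine this.congr_deriv ?_
    have e : -κ * (Real.sin (√κ * t) / √κ) = -Real.sin (√κ * t) * √κ := by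
      field_simp
      linear_combination Real.sin (√κ * t) * hs
    rw [smul_add, smul_smul, smul_smul, e]
    have e2 : √κ * (Real.cos (√κ * t) * √κ) = κ * Real.cos (√κ * t) := by
      linear_combination Real.cos (√κ * t) * hs
    rw [e2]
    module
  · have hk : √(-κ) ≠ 0 := (Real.sqrt_pos.2 (by linarith)).ne'
    have hs : √(-κ) * √(-κ) = -κ := Real.mul_self_sqrt (by linarith)
    have hl : HasDerivAt (fun s : ℝ => √(-κ) * s) √(-κ) t := by
      simpa using (hasDerivAt_id t).const_mul √(-κ)
    have := (hl.cosh.smul_const a).add ((hl.sinh.const_mul √(-κ)).smul_const b)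
    refine this.congr_deriv ?_
    have e : -κ * (Real.sinh (√(-κ) * t) / √(-κ)) = Real.sinh (√(-κ) * t) * √(-κ) := by
      field_simp
      linear_combination -Real.sinh (√(-κ) * t) * hs
    rw [smul_add, smul_smul, smul_smul, e]
    have e2 : √(-κ) * (Real.cosh (√(-κ) * t) * √(-κ)) = -κ * Real.cosh (√(-κ) * t) := by
      linear_combination Real.cosh (√(-κ) * t) * hs
    rw [e2]
    module
  · have : κ = 0 := le_antisymm (not_lt.1 h1) (not_lt.1 h2)
    simpa [this] using hasDerivAt_const t a

theorem memLp_phase (θ : Space d → ℝ) (hθ : Continuous θ) (u : L2 d) :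
    MemLp (fun x => Complex.exp ((θ x : ℂ) * Complex.I) * u x) 2 volume := by
  refine (Lp.memLp u).of_le ?_ ?_
  · exact (Continuous.aestronglyMeasurable (by fun_prop)).mul (Lp.aestronglyMeasurable u)
  · exact Eventually.of_forall fun x => by simp

/-- Multiplication by `exp(iθ(x))`, as a map on `L²`. -/
def phaseFun (θ : Space d → ℝ) (hθ : Continuous θ) (u : L2 d) : L2 d :=
  (memLp_phase θ hθ u).toLp _

theorem phaseFun_coe (θ : Space d → ℝ) (hθ : Continuous θ) (u : L2 d) :
    phaseFun θ hθ u =ᵐ[volume] fun x => Complex.exp ((θ x : ℂ) * Complex.I) * u x :=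
  (memLp_phase θ hθ u).coeFn_toLp

theorem phaseFun_neg (θ θ' : Space d → ℝ) (hθ : Continuous θ) (hθ' : Continuous θ')
    (h : ∀ x, θ x + θ' x = 0) (u : L2 d) : phaseFun θ hθ (phaseFun θ' hθ' u) = u := by
  apply Lp.ext
  filter_upwards [phaseFun_coe θ hθ (phaseFun θ' hθ' u), phaseFun_coe θ' hθ' u] with x h1 h2
  rw [h1, h2, ← mul_assoc, ← Complex.exp_add, ← add_mul, ← Complex.ofReal_add, h x]
  simp

/-- Multiplication by `exp(iθ(x))`, as a unitary operator on `L²`. -/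
def phase (θ : Space d → ℝ) (hθ : Continuous θ) : L2 d ≃ₗᵢ[ℂ] L2 d where
  toFun := phaseFun θ hθ
  invFun := phaseFun (fun x => -θ x) hθ.neg
  map_add' u v := by
    apply Lp.ext
    filter_upwards [phaseFun_coe θ hθ (u + v), phaseFun_coe θ hθ u, phaseFun_coe θ hθ v,
      Lp.coeFn_add u v, Lp.coeFn_add (phaseFun θ hθ u) (phaseFun θ hθ v)] with x h1 h2 h3 h4 h5
    rw [h1, h5, Pi.add_apply, h2, h3, h4, Pi.add_apply, mul_add]
  map_smul' c u := by
    apply Lp.ext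
    filter_upwards [phaseFun_coe θ hθ (c • u), phaseFun_coe θ hθ u, Lp.coeFn_smul c u,
      Lp.coeFn_smul c (phaseFun θ hθ u)] with x h1 h2 h3 h4
    simp only [RingHom.id_apply]
    rw [h1, h4, Pi.smul_apply, h2, h3, Pi.smul_apply, smul_eq_mul, smul_eq_mul]
    ring
  left_inv u := phaseFun_neg _ _ _ _ (fun x => by simp) u
  right_inv u := phaseFun_neg _ _ _ _ (fun x => by simp) u
  norm_map' u := by
    change ‖phaseFun θ hθ u‖ = ‖u‖
    rw [Lp.norm_def, Lp.norm_def, eLpNorm_congr_ae (phaseFun_coe θ hθ u)]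
    congr 1
    refine eLpNorm_congr_norm_ae (Eventually.of_forall fun x => ?_)
    simp

theorem phase_coe (θ : Space d → ℝ) (hθ : Continuous θ) (u : L2 d) :
    phase θ hθ u =ᵐ[volume] fun x => Complex.exp ((θ x : ℂ) * Complex.I) * u x :=
  phaseFun_coe θ hθ u

/-- Translation `u ↦ u(· - h)`, as a map on `L²`. -/
def translateFun (h : Space d) : L2 d →ₗᵢ[ℂ] L2 d :=
  Lp.compMeasurePreservingₗᵢ ℂ (fun x : Space d => x - h) (measurePreserving_sub_right volume h)

theorem translateFun_coe (h : Space d) (u : L2 d) :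
    translateFun h u =ᵐ[volume] fun x => u (x - h) :=
  Lp.coeFn_compMeasurePreserving u (measurePreserving_sub_right volume h)

theorem translateFun_neg (h h' : Space d) (hh : h + h' = 0) (u : L2 d) :
    translateFun h (translateFun h' u) = u := by
  apply Lp.ext
  filter_upwards [translateFun_coe h (translateFun h' u),
    (measurePreserving_sub_right volume h).quasiMeasurePreserving.ae (translateFun_coe h' u)]
    with x h1 h2
  rw [h1, h2, sub_sub, hh, sub_zero]

/-- Translation `u ↦ u(· - h)`, as a unitary operator on `L²`. -/
def translate (h : Space d) : L2 d ≃ₗᵢ[ℂ] L2 d where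
  toLinearEquiv := LinearEquiv.ofLinearMap (translateFun h).toLinearMap
    (translateFun (-h)).toLinearMap
    (LinearMap.ext fun u => translateFun_neg h (-h) (by simp) u)
    (LinearMap.ext fun u => translateFun_neg (-h) h (by simp) u)
  norm_map' u := (translateFun h).norm_map u

theorem translate_coe (h : Space d) (u : L2 d) :
    translate h u =ᵐ[volume] fun x => u (x - h) :=
  translateFun_coe h u

/-- The Galilean transform
`(G_κ(t,a,b) u)(x) = exp(-(i/2) g·g') exp(i x·g') u(x - g)` with `g = g_κ(t,a,b)`,
`g' = g_κ'(t,a,b)`, as a unitary operator on `L²`. -/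
def galilean (κ t : ℝ) (a b : Space d) : L2 d ≃ₗᵢ[ℂ] L2 d :=
  (translate (gSol κ t a b)).trans
    (phase (fun x => -(1 / 2) * inner ℝ (gSol κ t a b) (gSol' κ t a b)
      + inner ℝ x (gSol' κ t a b)) (by fun_prop))

theorem galilean_coe (κ t : ℝ) (a b : Space d) (u : L2 d) :
    galilean κ t a b u =ᵐ[volume] fun x =>
      Complex.exp (-(Complex.I / 2) * (inner ℝ (gSol κ t a b) (gSol' κ t a b) : ℝ)) *
      Complex.exp (Complex.I * (inner ℝ x (gSol' κ t a b) : ℝ)) * u (x - gSol κ t a b) := by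
  filter_upwards [phase_coe (fun x => -(1 / 2) * inner ℝ (gSol κ t a b) (gSol' κ t a b)
      + inner ℝ x (gSol' κ t a b)) (by fun_prop) (translate (gSol κ t a b) u),
    translate_coe (gSol κ t a b) u] with x h1 h2
  rw [galilean, LinearIsometryEquiv.trans_apply, h1, h2, ← Complex.exp_add]
  congr 2
  push_cast
  ring

/-- The phase `Φ(t) = -(ηM/2) ∫₀ᵗ |g_λ(s,a,b)|² ds`. -/
def gaugePhase (lam eta M : ℝ) (a b : Space d) (t : ℝ) : ℝ :=
  -(eta * M / 2) * ∫ s in (0 : ℝ)..t, ‖gSol lam s a b‖ ^ 2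

end Galilean

end

end NonlocalSchrodinger

open NonlocalSchrodinger

/-!
The interaction potential of a state `u` of mass `M` and first moment `X` is the polynomial
`M|x|² - 2 x·X` (`nonlocalPotential_eq`), so a solution of the equation solves a linear Schrödinger
equation whose Hamiltonian is quadratic, with the frequency `λ + ηM` and the force `ηX` determined
by the solution itself. Everything follows from the covariance of such equations under the Weyl
operators `W(q, p)`, which translate states in phase space and which include the Galilean
transforms of the statement.

*Linear theory.* For short times the propagator of an oscillator with a time dependent frequency is
a product of chirps `exp(iα|x|²/2)` and free propagators (`exists_local_flow`). It preserves the
Schwartz functions, hence weak solutions are unique by duality (`IsFlowOn.eq_of_isWeakFlowOn`), and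
for constant frequency the local propagators generate the group `U_κ`
(`existsUnique_isSchrodingerGroup`). Translating a solution along a trajectory of the classical
oscillator gives a solution of the equation with a force (`IsFlowOn.weyl`); for free trajectories
this is the relation `W(g(t), g'(t)) U_κ(t) = U_κ(t) W(b, a)` (`weyl_propagator`).

*The space `Σ^{1/2}`.* Since `∫₀^∞ |exp(iεr) - 1|² ε⁻² dε` is a multiple of `|r|`, the norm of
`Σ^{1/2}` is equivalent to one which measures the phase space translates `W(εq, εp)u - u` in `L²`.
Covariance therefore bounds the propagator in a moving frame on `Σ^{1/2}`, and dominated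
convergence in `ε` yields its joint continuity in all parameters and in the datum
(`tendsto_framed`).

*Moments.* The first moments of `u ∈ Σ^{1/2}` are the derivatives at the origin of
`(q, p) ↦ ⟨u, W(q, p)u⟩` (`hasDerivAt_inner_weyl`). With covariance this gives Ehrenfest's theorem
(`moments_framed`) without any integration by parts, and shows that the explicit formula solves the
equation (`isWeakSolution_solutionMap`). It lies in `C¹(ℝ; Σ^{-3/2})` because the right-hand side of
the equation is continuous with values in that space.

*Uniqueness.* An arbitrary weak solution in `C(ℝ; Σ^{1/2})` is a weak solution of the linear
equation with its own, continuous, frequency and force. Near each time it is thus transported by a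
unitary propagator, so its mass is conserved and the frequency is constant. The same local representation
shows that its moments satisfy `X' = P`, `P' = -λX`, the terms in `η` cancelling; so the force is
known in advance, and linear uniqueness identifies the solution (`IsWeakSolution.eq_solutionMap`).

*Continuous dependence.* The two Galilean transforms in the representation formula combine into a
translation by `(g_λ - g_κ, g_λ' - g_κ')`. Where `M ≠ 0` all parameters are continuous in the datum.
Near the zero datum `P/M` and `X/M` are not controlled, but the displacement is, since `κ - λ = ηM`
(`exists_bound_displacement`). Compactness of the time interval makes the continuity uniform.

*Energy.* For `u ∈ Σ` the vectors `x_j u` and `-i∂_j u` are derivatives of Weyl orbits, and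
covariance moves them along the classical flow. The energy of the solution at time `t` becomes an
explicit expression in which `t` enters only through conserved energies of classical oscillators
(`energy_solutionMap`).
-/

namespace NonlocalSchrodinger

noncomputable section

open scoped LineDeriv InnerProductSpace

variable {d : ℕ}

/-! ### Operators on Schwartz functions -/

/-- The embedding of Schwartz functions into `L²`. -/
def toL2 : 𝓢(Space d, ℂ) →L[ℂ] L2 d := SchwartzMap.toLpCLM ℂ ℂ 2 volume

theorem toL2_apply (ψ : 𝓢(Space d, ℂ)) : toL2 ψ = ψ.toLp 2 volume := rfl

theorem toL2_coe (ψ : 𝓢(Space d, ℂ)) : toL2 ψ =ᵐ[volume] ψ := ψ.coeFn_toLp 2 volume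

theorem toL2_injective : Function.Injective (toL2 (d := d)) :=
  SchwartzMap.injective_toLp 2 volume

theorem denseRange_toL2 : DenseRange (toL2 (d := d)) :=
  SchwartzMap.denseRange_toLpCLM (F := ℂ) ENNReal.ofNat_ne_top

theorem inner_toL2 (φ ψ : 𝓢(Space d, ℂ)) :
    inner ℂ (toL2 φ) (toL2 ψ) = ∫ x, inner ℂ (φ x) (ψ x) :=
  SchwartzMap.inner_toL2_toL2_eq φ ψ

/-- Multiplication by the linear function `x ↦ x · v`. -/
def posS (v : Space d) : 𝓢(Space d, ℂ) →L[ℂ] 𝓢(Space d, ℂ) :=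
  SchwartzMap.smulLeftCLM ℂ (fun x : Space d => ((inner ℝ x v : ℝ) : ℂ))

/-- The momentum operator `-i ∂_v`. -/
def momS (v : Space d) : 𝓢(Space d, ℂ) →L[ℂ] 𝓢(Space d, ℂ) :=
  (-Complex.I) • LineDeriv.lineDerivOpCLM ℂ 𝓢(Space d, ℂ) v

/-- Multiplication by `exp(iθ(x))`, for `θ` of temperate growth. -/
def phaseS (θ : Space d → ℝ) : 𝓢(Space d, ℂ) →L[ℂ] 𝓢(Space d, ℂ) :=
  SchwartzMap.smulLeftCLM ℂ (fun x : Space d => Complex.exp ((θ x : ℂ) * Complex.I))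

theorem hasTemperateGrowth_inner_ofReal (v : Space d) :
    (fun x : Space d => ((inner ℝ x v : ℝ) : ℂ)).HasTemperateGrowth := by
  fun_prop

theorem posS_apply (v : Space d) (ψ : 𝓢(Space d, ℂ)) (x : Space d) :
    posS v ψ x = ((inner ℝ x v : ℝ) : ℂ) * ψ x := by
  rw [posS, SchwartzMap.smulLeftCLM_apply_apply (hasTemperateGrowth_inner_ofReal v), smul_eq_mul]

theorem momS_eq (v : Space d) (ψ : 𝓢(Space d, ℂ)) : momS v ψ = (-Complex.I) • ∂_{v} ψ := rfl

theorem momS_apply (v : Space d) (ψ : 𝓢(Space d, ℂ)) (x : Space d) :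
    momS v ψ x = -Complex.I * fderiv ℝ ψ x v := rfl

theorem iteratedDeriv_expI (n : ℕ) :
    iteratedDeriv n (fun t : ℝ => Complex.exp ((t : ℂ) * Complex.I)) =
      fun t : ℝ => Complex.I ^ n * Complex.exp ((t : ℂ) * Complex.I) := by
  induction n with
  | zero => simp
  | succ n ih =>
    rw [iteratedDeriv_succ, ih]
    funext t
    have h : HasDerivAt (fun t : ℝ => (t : ℂ) * Complex.I) Complex.I t := by
      simpa using (Complex.ofRealCLM.hasDerivAt (x := t)).mul_const Complex.I
    rw [(h.cexp.const_mul (Complex.I ^ n)).deriv]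
    ring

theorem hasTemperateGrowth_expI :
    (fun t : ℝ => Complex.exp ((t : ℂ) * Complex.I)).HasTemperateGrowth := by
  refine ⟨(Complex.ofRealCLM.contDiff.mul contDiff_const).cexp, fun n => ⟨0, 1, fun x => ?_⟩⟩
  rw [norm_iteratedFDeriv_eq_norm_iteratedDeriv, iteratedDeriv_expI]
  simp

theorem phaseS_apply {θ : Space d → ℝ} (hθ : θ.HasTemperateGrowth) (ψ : 𝓢(Space d, ℂ))
    (x : Space d) : phaseS θ ψ x = Complex.exp ((θ x : ℂ) * Complex.I) * ψ x := by
  rw [phaseS, SchwartzMap.smulLeftCLM_apply_apply, smul_eq_mul]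
  exact hasTemperateGrowth_expI.comp hθ

theorem phase_toL2 {θ : Space d → ℝ} (hc : Continuous θ) (hθ : θ.HasTemperateGrowth)
    (ψ : 𝓢(Space d, ℂ)) : phase θ hc (toL2 ψ) = toL2 (phaseS θ ψ) := by
  apply Lp.ext
  filter_upwards [phase_coe θ hc (toL2 ψ), toL2_coe ψ, toL2_coe (phaseS θ ψ)] with x h1 h2 h3
  rw [h1, h2, h3, phaseS_apply hθ]

/-- Translation `ψ ↦ ψ(· - h)` of Schwartz functions. -/
def shiftS (h : Space d) : 𝓢(Space d, ℂ) →L[ℂ] 𝓢(Space d, ℂ) :=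
  SchwartzMap.compSubConstCLM ℂ h

theorem shiftS_apply (h : Space d) (ψ : 𝓢(Space d, ℂ)) (x : Space d) :
    shiftS h ψ x = ψ (x - h) := rfl

theorem translate_toL2 (h : Space d) (ψ : 𝓢(Space d, ℂ)) :
    translate h (toL2 ψ) = toL2 (shiftS h ψ) := by
  apply Lp.ext
  filter_upwards [translate_coe h (toL2 ψ),
    (measurePreserving_sub_right volume h).quasiMeasurePreserving.ae (toL2_coe ψ),
    toL2_coe (shiftS h ψ)] with x h1 h2 h3
  rw [h1, h2, h3, shiftS_apply]

/-! Symmetry of the operators. -/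

theorem inner_posS_left (v : Space d) (φ ψ : 𝓢(Space d, ℂ)) :
    inner ℂ (toL2 (posS v φ)) (toL2 ψ) = inner ℂ (toL2 φ) (toL2 (posS v ψ)) := by
  rw [inner_toL2, inner_toL2]
  congr 1
  funext x
  simp only [posS_apply, RCLike.inner_apply, map_mul, Complex.conj_ofReal]
  ring

theorem inner_momS_left (v : Space d) (φ ψ : 𝓢(Space d, ℂ)) :
    inner ℂ (toL2 (momS v φ)) (toL2 ψ) = inner ℂ (toL2 φ) (toL2 (momS v ψ)) := by
  have h := SchwartzMap.integral_bilinear_lineDerivOp_right_eq_neg_left (μ := volume) φ ψ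
    (innerSL ℝ (E := ℂ)) v
  have h2 := SchwartzMap.integral_bilinear_lineDerivOp_right_eq_neg_left (μ := volume) φ ψ
    ((ContinuousLinearMap.mul ℝ ℂ).comp (Complex.conjCLE : ℂ →L[ℝ] ℂ)) v
  simp only [ContinuousLinearMap.comp_apply, ContinuousLinearMap.mul_apply',
    ContinuousLinearEquiv.coe_coe, Complex.conjCLE_apply] at h2
  rw [inner_toL2, inner_toL2]
  simp only [momS_eq, smul_apply, RCLike.inner_apply, map_mul, smul_eq_mul, map_neg,
    Complex.conj_I, neg_neg]
  calc ∫ x, ψ x * (Complex.I * (starRingEnd ℂ) (∂_{v} φ x))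
      = Complex.I * ∫ x, (starRingEnd ℂ) (∂_{v} φ x) * ψ x := by
        rw [← integral_const_mul]; congr 1; funext x; ring
    _ = -Complex.I * ∫ x, (starRingEnd ℂ) (φ x) * ∂_{v} ψ x := by rw [h2]; ring
    _ = _ := by rw [← integral_const_mul]; congr 1; funext x; ring

/-! Commutation with phases, translations and the Fourier transform. -/

theorem momS_phaseS {θ : Space d → ℝ} (hθ : θ.HasTemperateGrowth) (v : Space d)
    (ψ : 𝓢(Space d, ℂ)) (x : Space d) :
    momS v (phaseS θ ψ) x =
      phaseS θ (momS v ψ) x + ((fderiv ℝ θ x v : ℝ) : ℂ) * phaseS θ ψ x := by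
  have h1 : HasFDerivAt θ (fderiv ℝ θ x) x := (hθ.1.differentiable (by simp) x).hasFDerivAt
  have h2 : HasFDerivAt (fun y => Complex.exp ((θ y : ℂ) * Complex.I)) _ x :=
    ((Complex.ofRealCLM.hasFDerivAt.comp x h1).mul_const Complex.I).cexp
  have h3 := h2.mul (ψ.hasFDerivAt x)
  have h4 : (phaseS θ ψ : Space d → ℂ) = fun y => Complex.exp ((θ y : ℂ) * Complex.I) * ψ y :=
    funext fun y => phaseS_apply hθ ψ y
  rw [momS_apply, phaseS_apply hθ, phaseS_apply hθ, momS_apply, h4]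
  rw [show fderiv ℝ (fun y => Complex.exp ((θ y : ℂ) * Complex.I) * ψ y) x = _ from h3.fderiv]
  simp
  ring_nf
  simp

theorem posS_phaseS {θ : Space d → ℝ} (hθ : θ.HasTemperateGrowth) (v : Space d)
    (ψ : 𝓢(Space d, ℂ)) : posS v (phaseS θ ψ) = phaseS θ (posS v ψ) := by
  ext x
  rw [posS_apply, phaseS_apply hθ, phaseS_apply hθ, posS_apply]
  ring

theorem posS_shiftS (h v : Space d) (ψ : 𝓢(Space d, ℂ)) :
    posS v (shiftS h ψ) = shiftS h (posS v ψ) + (((inner ℝ h v : ℝ) : ℂ)) • shiftS h ψ := by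
  ext x
  simp only [posS_apply, shiftS_apply, add_apply, smul_apply, smul_eq_mul,
    inner_sub_left]
  push_cast
  ring

theorem momS_shiftS (h v : Space d) (ψ : 𝓢(Space d, ℂ)) :
    momS v (shiftS h ψ) = shiftS h (momS v ψ) := by
  ext x
  rw [momS_apply, shiftS_apply, momS_apply]
  congr 2
  exact fderiv_comp_sub (f := ψ) (x := x) h

theorem posS_eq_smulLeftCLM_real (v : Space d) (ψ : 𝓢(Space d, ℂ)) :
    SchwartzMap.smulLeftCLM ℂ (fun x : Space d => (inner ℝ x v : ℝ)) ψ = posS v ψ := by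
  ext x
  rw [SchwartzMap.smulLeftCLM_apply_apply (by fun_prop), posS_apply]
  simp

theorem fourier_momS (v : Space d) (ψ : 𝓢(Space d, ℂ)) :
    𝓕 (momS v ψ) = ((2 * Real.pi : ℝ) : ℂ) • posS v (𝓕 ψ) := by
  rw [momS_eq, FourierTransform.fourier_smul, SchwartzMap.fourier_lineDerivOp_eq,
    posS_eq_smulLeftCLM_real, smul_smul]
  congr 1
  push_cast
  linear_combination (-2 * Real.pi : ℂ) * Complex.I_mul_I

theorem momS_fourier (v : Space d) (ψ : 𝓢(Space d, ℂ)) :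
    momS v (𝓕 ψ) = -((2 * Real.pi : ℝ) : ℂ) • 𝓕 (posS v ψ) := by
  rw [momS_eq, SchwartzMap.lineDerivOp_fourier_eq, posS_eq_smulLeftCLM_real,
    FourierTransform.fourier_smul, smul_smul]
  congr 1
  push_cast
  linear_combination (2 * Real.pi : ℂ) * Complex.I_mul_I

theorem fourierInv_momS (v : Space d) (ψ : 𝓢(Space d, ℂ)) :
    𝓕⁻ (momS v ψ) = -((2 * Real.pi : ℝ) : ℂ) • posS v (𝓕⁻ ψ) := by
  rw [momS_eq, FourierTransform.fourierInv_smul, SchwartzMap.fourierInv_lineDerivOp_eq,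
    posS_eq_smulLeftCLM_real, smul_smul]
  congr 1
  push_cast
  linear_combination (2 * Real.pi : ℂ) * Complex.I_mul_I

theorem momS_fourierInv (v : Space d) (ψ : 𝓢(Space d, ℂ)) :
    momS v (𝓕⁻ ψ) = ((2 * Real.pi : ℝ) : ℂ) • 𝓕⁻ (posS v ψ) := by
  rw [momS_eq, SchwartzMap.lineDerivOp_fourierInv_eq, posS_eq_smulLeftCLM_real,
    FourierTransform.fourierInv_smul, smul_smul]
  congr 1
  push_cast
  linear_combination (-2 * Real.pi : ℂ) * Complex.I_mul_I

/-- The standard basis vectors of `ℝ^d`. -/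
def basisVec (j : Fin d) : Space d := EuclideanSpace.basisFun (Fin d) ℝ j

theorem laplacian_eq_sum_momS (ψ : 𝓢(Space d, ℂ)) :
    Δ ψ = -∑ j, momS (basisVec j) (momS (basisVec j) ψ) := by
  rw [SchwartzMap.laplacian_eq_sum (EuclideanSpace.basisFun (Fin d) ℝ) ψ, ← Finset.sum_neg_distrib]
  refine Finset.sum_congr rfl fun j _ => ?_
  rw [momS_eq, momS_eq, LineDeriv.lineDerivOp_smul, smul_smul]
  simp [basisVec]

theorem inner_basisVec (x : Space d) (j : Fin d) : inner ℝ x (basisVec j) = x j := by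
  simp [basisVec, EuclideanSpace.inner_single_right]

theorem norm_basisVec (j : Fin d) : ‖basisVec j‖ = 1 := by simp [basisVec]

theorem sum_posS_sq_apply (ψ : 𝓢(Space d, ℂ)) (x : Space d) :
    (∑ j, posS (basisVec j) (posS (basisVec j) ψ)) x = ((‖x‖ ^ 2 : ℝ) : ℂ) * ψ x := by
  rw [sum_apply, EuclideanSpace.norm_sq_eq]
  push_cast
  rw [Finset.sum_mul]
  refine Finset.sum_congr rfl fun j _ => ?_
  rw [posS_apply, posS_apply, inner_basisVec, Real.norm_eq_abs, ← Complex.ofReal_pow, sq_abs]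
  push_cast
  ring

/-! ### Dominated convergence in `L²` and strong derivatives of phases -/

theorem real_smul_L2 (r : ℝ) (u : L2 d) : r • u = (r : ℂ) • u :=
  (algebraMap_smul ℂ r u).symm

theorem norm_sq_eq_lintegral (f : L2 d) :
    ENNReal.ofReal (‖f‖ ^ 2) = ∫⁻ x : Space d, ENNReal.ofReal (‖f x‖ ^ 2) := by
  have h : ‖f‖ ^ 2 = ∫ x : Space d, ‖f x‖ ^ 2 := by
    have := L2.inner_def (𝕜 := ℂ) f f
    rw [inner_self_eq_norm_sq_to_K] at this
    have h2 : ∫ x : Space d, inner ℂ (f x) (f x) = ∫ x : Space d, ((‖f x‖ ^ 2 : ℝ) : ℂ) := by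
      congr 1
      funext x
      rw [inner_self_eq_norm_sq_to_K]
      push_cast
      rfl
    rw [h2, integral_complex_ofReal] at this
    refine Complex.ofReal_injective ?_
    rw [← this]
    push_cast
    rfl
  rw [h, ofReal_integral_eq_lintegral_ofReal]
  · exact (Lp.memLp f).integrable_norm_pow (by norm_num)
  · exact Eventually.of_forall fun x => by positivity

/-- Dominated convergence in `L²`. -/
theorem tendsto_L2_of_dominated {ι : Type*} {l : Filter ι} [l.IsCountablyGenerated]
    {f : ι → L2 d} {g : L2 d} (F : ι → Space d → ℂ) (G : Space d → ℝ)
    (hF : ∀ᶠ n in l, f n =ᵐ[volume] F n) (hG : MemLp G 2 volume)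
    (hb : ∀ᶠ n in l, ∀ᵐ x, ‖F n x‖ ≤ G x)
    (hlim : ∀ᵐ x, Tendsto (fun n => F n x) l (𝓝 (g x))) :
    Tendsto f l (𝓝 g) := by
  rcases l.eq_or_neBot with rfl | hne
  · exact tendsto_bot
  have hgG : ∀ᵐ x, ‖g x‖ ≤ G x := by
    obtain ⟨u, hu⟩ := l.exists_seq_tendsto
    have hb' : ∀ᶠ n in atTop, ∀ᵐ x, ‖F (u n) x‖ ≤ G x := hu.eventually hb
    obtain ⟨N, hN⟩ := eventually_atTop.1 hb'
    have : ∀ᵐ x, ∀ n, ‖F (u (n + N)) x‖ ≤ G x :=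
      ae_all_iff.2 fun n => hN (n + N) (Nat.le_add_left _ _)
    filter_upwards [this, hlim] with x h1 h2
    have h3 := (h2.comp hu).norm
    exact le_of_tendsto (h3.comp (tendsto_add_atTop_nat N)) (Eventually.of_forall h1)
  rw [tendsto_iff_norm_sub_tendsto_zero]
  have key : Tendsto (fun n => ∫⁻ x : Space d, ENNReal.ofReal (‖(f n - g) x‖ ^ 2)) l
      (𝓝 (∫⁻ _ : Space d, 0)) := by
    have e : ∀ᶠ n in l, ∫⁻ x : Space d, ENNReal.ofReal (‖(f n - g) x‖ ^ 2) =
        ∫⁻ x : Space d, ENNReal.ofReal (‖f n x - g x‖ ^ 2) := by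
      refine Eventually.of_forall fun n => lintegral_congr_ae ?_
      filter_upwards [Lp.coeFn_sub (f n) g] with x h
      rw [h, Pi.sub_apply]
    rw [tendsto_congr' e]
    have e2 : ∀ᶠ n in l, ∫⁻ x : Space d, ENNReal.ofReal (‖f n x - g x‖ ^ 2) =
        ∫⁻ x : Space d, ENNReal.ofReal (‖F n x - g x‖ ^ 2) := by
      filter_upwards [hF] with n hn
      refine lintegral_congr_ae ?_
      filter_upwards [hn] with x h
      rw [h]
    rw [tendsto_congr' e2]
    refine tendsto_of_seq_tendsto fun v hv => ?_
    obtain ⟨N, hN⟩ := eventually_atTop.1 (hv.eventually (hF.and hb))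
    rw [← tendsto_add_atTop_iff_nat N]
    refine tendsto_lintegral_of_dominated_convergence'
      (fun x => ENNReal.ofReal ((2 * G x) ^ 2)) ?_ ?_ ?_ ?_
    · intro n
      have : AEStronglyMeasurable (F (v (n + N))) volume :=
        (Lp.aestronglyMeasurable _).congr (hN (n + N) (Nat.le_add_left _ _)).1
      exact ((this.sub (Lp.aestronglyMeasurable g)).norm.pow 2).aemeasurable.ennreal_ofReal
    · intro n
      filter_upwards [(hN (n + N) (Nat.le_add_left _ _)).2, hgG] with x h1 h2
      refine ENNReal.ofReal_le_ofReal ?_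
      have := norm_sub_le (F (v (n + N)) x) (g x)
      gcongr
      linarith
    · have h1 : Integrable (fun x => (2 * G x) ^ 2) volume := by
        have := (hG.const_mul 2).integrable_sq
        exact this
      exact (h1.lintegral_lt_top).ne
    · filter_upwards [hlim] with x h
      have h1 : Tendsto (fun n => ‖F n x - g x‖ ^ 2) l (𝓝 (‖g x - g x‖ ^ 2)) :=
        ((h.sub_const _).norm.pow 2)
      rw [sub_self, norm_zero, zero_pow two_ne_zero] at h1
      have h2 := (ENNReal.continuous_ofReal.tendsto _).comp h1
      rw [ENNReal.ofReal_zero] at h2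
      exact h2.comp (hv.comp (tendsto_add_atTop_nat N))
  simp only [lintegral_zero, ← norm_sq_eq_lintegral] at key
  have h2 : Tendsto (fun n => ‖f n - g‖ ^ 2) l (𝓝 0) := by
    have := (ENNReal.tendsto_toReal ENNReal.zero_ne_top).comp key
    refine (this.congr fun n => ?_)
    simp only [Function.comp]
    rw [ENNReal.toReal_ofReal (by positivity)]
  have h3 := (Real.continuous_sqrt.tendsto _).comp h2
  simpa [Function.comp_def] using h3

/-- Phases depend strongly continuously on the phase function. -/
theorem tendsto_phase {ι : Type*} {l : Filter ι} [l.IsCountablyGenerated]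
    {θ : ι → Space d → ℝ} {θ₀ : Space d → ℝ} (hθ : ∀ n, Continuous (θ n)) (hθ₀ : Continuous θ₀)
    (h : ∀ x, Tendsto (fun n => θ n x) l (𝓝 (θ₀ x))) (u : L2 d) :
    Tendsto (fun n => phase (θ n) (hθ n) u) l (𝓝 (phase θ₀ hθ₀ u)) := by
  refine tendsto_L2_of_dominated (fun n x => Complex.exp ((θ n x : ℂ) * Complex.I) * u x)
    (fun x => ‖u x‖) (Eventually.of_forall fun n => phase_coe _ _ _) (Lp.memLp u).norm ?_ ?_
  · exact Eventually.of_forall fun n => Eventually.of_forall fun x => by simp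
  · filter_upwards [phase_coe θ₀ hθ₀ u] with x hx
    rw [hx]
    refine Tendsto.mul_const _ ((Complex.continuous_exp.tendsto _).comp ?_)
    exact ((Complex.continuous_ofReal.tendsto _).comp (h x)).mul_const _

theorem norm_expI_sub_expI_le (a b : ℝ) :
    ‖Complex.exp ((a : ℂ) * Complex.I) - Complex.exp ((b : ℂ) * Complex.I)‖ ≤ |a - b| := by
  have h : Complex.exp ((a : ℂ) * Complex.I) - Complex.exp ((b : ℂ) * Complex.I) =
      Complex.exp ((b : ℂ) * Complex.I) * (Complex.exp (Complex.I * ((a - b : ℝ) : ℂ)) - 1) := by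
    rw [mul_sub, mul_one, ← Complex.exp_add]
    congr 2
    push_cast
    ring
  rw [h, norm_mul, Complex.norm_exp_ofReal_mul_I, one_mul]
  exact Real.norm_exp_I_mul_ofReal_sub_one_le

/-- Strong differentiability of a curve of phases. -/
theorem hasDerivAt_phase {θ : ℝ → Space d → ℝ} (hθ : ∀ s, Continuous (θ s)) {θ' : Space d → ℝ}
    {t : ℝ} (h : ∀ x, HasDerivAt (fun s => θ s x) (θ' x) t) (m : Space d → ℝ)
    (hm : ∀ᶠ s in 𝓝 t, ∀ x, |θ s x - θ t x| ≤ |s - t| * m x) {u w : L2 d}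
    (hu : MemLp (fun x => m x * ‖u x‖) 2 volume)
    (hw : w =ᵐ[volume] fun x => Complex.I * θ' x * Complex.exp ((θ t x : ℂ) * Complex.I) * u x) :
    HasDerivAt (fun s => phase (θ s) (hθ s) u) w t := by
  rw [hasDerivAt_iff_tendsto_slope]
  refine tendsto_L2_of_dominated (fun s x => ((s - t)⁻¹ : ℂ) *
    ((Complex.exp ((θ s x : ℂ) * Complex.I) - Complex.exp ((θ t x : ℂ) * Complex.I)) * u x))
    (fun x => m x * ‖u x‖) (Eventually.of_forall fun s => ?_) hu ?_ ?_
  · rw [slope_def_module]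
    filter_upwards [Lp.coeFn_smul (s - t)⁻¹ (phase (θ s) (hθ s) u - phase (θ t) (hθ t) u),
      Lp.coeFn_sub (phase (θ s) (hθ s) u) (phase (θ t) (hθ t) u), phase_coe (θ s) (hθ s) u,
      phase_coe (θ t) (hθ t) u] with x h1 h2 h3 h4
    rw [h1, Pi.smul_apply, h2, Pi.sub_apply, h3, h4, Complex.real_smul]
    push_cast
    ring
  · filter_upwards [nhdsWithin_le_nhds hm, self_mem_nhdsWithin] with s hs hne
    refine Eventually.of_forall fun x => ?_
    have hne' : 0 < |s - t| := abs_pos.2 (sub_ne_zero.2 hne)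
    rw [norm_mul, norm_mul, ← mul_assoc]
    refine mul_le_mul_of_nonneg_right ?_ (norm_nonneg _)
    have e : ‖((s : ℂ) - t)⁻¹‖ = |s - t|⁻¹ := by
      rw [norm_inv, ← Complex.ofReal_sub, Complex.norm_real, Real.norm_eq_abs]
    rw [e, inv_mul_le_iff₀ hne']
    exact (norm_expI_sub_expI_le _ _).trans (hs x)
  · filter_upwards [hw] with x hx
    rw [hx]
    have h1 : HasDerivAt (fun s => Complex.exp ((θ s x : ℂ) * Complex.I)) _ t :=
      (((h x).ofReal_comp).mul_const Complex.I).cexp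
    have h2 := (hasDerivAt_iff_tendsto_slope.1 h1).mul_const (u x)
    refine (h2.congr fun s => ?_).trans (le_of_eq (congrArg 𝓝 (by ring)))
    rw [slope_def_module, Complex.real_smul]
    push_cast
    ring

/-- The Fourier transform as a unitary operator. -/
abbrev fourierU : L2 d ≃ₗᵢ[ℂ] L2 d := Lp.fourierTransformₗᵢ (Space d) ℂ

theorem fourierU_toL2 (ψ : 𝓢(Space d, ℂ)) : fourierU (toL2 ψ) = toL2 (𝓕 ψ) :=
  SchwartzMap.toLp_fourier_eq ψ

theorem fourierU_symm_toL2 (ψ : 𝓢(Space d, ℂ)) : fourierU.symm (toL2 ψ) = toL2 (𝓕⁻ ψ) :=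
  SchwartzMap.toLp_fourierInv_eq ψ

theorem toL2_ext {T T' : L2 d ≃ₗᵢ[ℂ] L2 d} (h : ∀ ψ, T (toL2 ψ) = T' (toL2 ψ)) : T = T' := by
  refine LinearIsometryEquiv.ext fun u => ?_
  have := denseRange_toL2.equalizer T.continuous T'.continuous (funext h)
  exact congrFun this u

/-- The phase `ξ ↦ exp(-2πi ξ·h)`, the Fourier symbol of the translation by `h`. -/
def shiftSymbol (h : Space d) (ξ : Space d) : ℝ := -(2 * Real.pi) * inner ℝ ξ h

theorem continuous_shiftSymbol (h : Space d) : Continuous (shiftSymbol h) := by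
  unfold shiftSymbol; fun_prop

theorem hasTemperateGrowth_shiftSymbol (h : Space d) : (shiftSymbol h).HasTemperateGrowth := by
  unfold shiftSymbol; fun_prop

theorem translate_eq_fourier (h : Space d) :
    translate h = (fourierU.trans (phase (shiftSymbol h) (continuous_shiftSymbol h))).trans
      fourierU.symm := by
  refine toL2_ext fun ψ => ?_
  simp only [LinearIsometryEquiv.trans_apply]
  rw [fourierU_toL2, phase_toL2 _ (hasTemperateGrowth_shiftSymbol h),
      LinearIsometryEquiv.eq_symm_apply,
    translate_toL2, fourierU_toL2]
  congr 1
  ext ξ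
  rw [phaseS_apply (hasTemperateGrowth_shiftSymbol h), SchwartzMap.fourier_coe,
    SchwartzMap.fourier_coe, Real.fourier_eq', Real.fourier_eq', ← integral_const_mul]
  conv_rhs => rw [← integral_sub_right_eq_self _ h]
  congr 1
  funext x
  rw [shiftS_apply, smul_eq_mul, smul_eq_mul, ← mul_assoc, ← Complex.exp_add]
  congr 2
  simp only [shiftSymbol, inner_sub_left]
  rw [real_inner_comm ξ h]
  push_cast
  ring

theorem fourierU_translate (h : Space d) (u : L2 d) :
    fourierU (translate h u) = phase (shiftSymbol h) (continuous_shiftSymbol h) (fourierU u) := by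
  rw [translate_eq_fourier]
  simp

theorem tendsto_translate {ι : Type*} {l : Filter ι} [l.IsCountablyGenerated]
    {q : ι → Space d} {q₀ : Space d} (h : Tendsto q l (𝓝 q₀)) (u : L2 d) :
    Tendsto (fun n => translate (q n) u) l (𝓝 (translate q₀ u)) := by
  simp only [translate_eq_fourier, LinearIsometryEquiv.trans_apply]
  refine (fourierU.symm.continuous.tendsto _).comp (tendsto_phase _ _ (fun x => ?_) _)
  exact (tendsto_const_nhds.inner h).const_mul _

/-- The product rule for a curve of isometries applied to a curve. -/
theorem hasDerivAt_isometry_apply {T : ℝ → (L2 d ≃ₗᵢ[ℂ] L2 d)} {u : ℝ → L2 d} {u' w : L2 d}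
    {t : ℝ} (hu : HasDerivAt u u' t) (hT : HasDerivAt (fun s => T s (u t)) w t)
    (hc : Tendsto (fun s => T s u') (𝓝 t) (𝓝 (T t u'))) :
    HasDerivAt (fun s => T s (u s)) (T t u' + w) t := by
  rw [hasDerivAt_iff_tendsto_slope] at hu hT ⊢
  have e : ∀ s, slope (fun s => T s (u s)) t s =
      T s (slope u t s - u') + T s u' + slope (fun s => T s (u t)) t s := by
    intro s
    simp only [slope_def_module]
    rw [map_sub, sub_add_cancel]
    have : T s ((s - t)⁻¹ • (u s - u t)) = (s - t)⁻¹ • (T s (u s) - T s (u t)) := by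
      rw [real_smul_L2, real_smul_L2, map_smul, map_sub]
    rw [this, ← smul_add]
    congr 1
    abel
  have h1 : Tendsto (fun s => T s (slope u t s - u')) (𝓝[≠] t) (𝓝 0) := by
    rw [tendsto_zero_iff_norm_tendsto_zero]
    simp only [LinearIsometryEquiv.norm_map]
    exact tendsto_iff_norm_sub_tendsto_zero.1 hu
  have := (h1.add (hc.mono_left nhdsWithin_le_nhds)).add hT
  rw [zero_add] at this
  exact this.congr fun s => (e s).symm

/-! ### A second order linear equation -/

/-- Local solvability of `g'' = -k(t) g + f(t)` for continuous coefficients. -/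
theorem exists_local_linear_ode {E : Type*} [NormedAddCommGroup E] [NormedSpace ℝ E]
    [CompleteSpace E] {k : ℝ → ℝ} {f : ℝ → E} (hk : Continuous k) (hf : Continuous f) (t₀ : ℝ)
    (x₀ y₀ : E) :
    ∃ (g g' : ℝ → E) (τ : ℝ), 0 < τ ∧ g t₀ = x₀ ∧ g' t₀ = y₀ ∧
      ∀ t ∈ Set.Ioo (t₀ - τ) (t₀ + τ), HasDerivAt g (g' t) t ∧
        HasDerivAt g' (-k t • g t + f t) t := by
  obtain ⟨B₁, hB₁⟩ := isCompact_Icc.exists_bound_of_continuousOn (s := Set.Icc (t₀ - 1) (t₀ + 1))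
    hk.continuousOn
  obtain ⟨B₂, hB₂⟩ := isCompact_Icc.exists_bound_of_continuousOn (s := Set.Icc (t₀ - 1) (t₀ + 1))
    hf.continuousOn
  have ht₀ : t₀ ∈ Set.Icc (t₀ - 1) (t₀ + 1) := ⟨by linarith, by linarith⟩
  have hB₁0 : 0 ≤ B₁ := (norm_nonneg _).trans (hB₁ t₀ ht₀)
  have hB₂0 : 0 ≤ B₂ := (norm_nonneg _).trans (hB₂ t₀ ht₀)
  set R : ℝ := ‖((x₀, y₀) : E × E)‖ + 1 with hR
  have hR0 : 0 < R := by positivity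
  set L : ℝ := R + B₁ * R + B₂ with hL
  have hL0 : 0 ≤ L := by positivity
  set τ : ℝ := 1 / (L + 1) with hτ
  have hτ0 : 0 < τ := by positivity
  have hτ1 : τ ≤ 1 := by rw [hτ, div_le_one (by linarith)]; linarith
  have hsub : Set.Icc (t₀ - τ) (t₀ + τ) ⊆ Set.Icc (t₀ - 1) (t₀ + 1) :=
    Set.Icc_subset_Icc (by linarith) (by linarith)
  let v : ℝ → E × E → E × E := fun t z => (z.2, -k t • z.1 + f t)
  have hpl : IsPicardLindelof v (tmin := t₀ - τ) (tmax := t₀ + τ)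
      ⟨t₀, by constructor <;> linarith⟩ (x₀, y₀) 1 0 ⟨L, hL0⟩ ⟨1 + B₁, by positivity⟩ := by
    refine ⟨fun t ht => ?_, fun x _ => ?_, fun t ht z hz => ?_, ?_⟩
    · refine LipschitzOnWith.of_dist_le_mul fun z _ w _ => ?_
      have h1 : dist (v t z) (v t w) = max ‖z.2 - w.2‖ ‖k t • (z.1 - w.1)‖ := by
        rw [dist_eq_norm, Prod.norm_def]
        congr 1
        simp only [v, Prod.snd_sub]
        rw [← norm_neg]
        congr 1
        rw [smul_sub]
        simp only [neg_smul]
        abel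
      have h2 : ‖z.2 - w.2‖ ≤ dist z w := by
        rw [dist_eq_norm]; exact norm_snd_le (z - w)
      have h3 : ‖z.1 - w.1‖ ≤ dist z w := by
        rw [dist_eq_norm]; exact norm_fst_le (z - w)
      rw [h1, norm_smul]
      change _ ≤ (1 + B₁) * dist z w
      have h4 := hB₁ t (hsub ht)
      have h5 : ‖k t‖ * ‖z.1 - w.1‖ ≤ B₁ * dist z w := by gcongr
      have h6 : 0 ≤ B₁ * dist z w := by positivity
      refine max_le ?_ ?_ <;> nlinarith [@dist_nonneg _ _ z w]
    · exact Continuous.continuousOn (by fun_prop)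
    · change max ‖z.2‖ ‖-k t • z.1 + f t‖ ≤ L
      have hz1 : ‖z‖ ≤ R := by
        have h1 : dist z (x₀, y₀) ≤ 1 := by simpa using hz
        rw [dist_eq_norm] at h1
        have h2 := norm_add_le (z - (x₀, y₀)) ((x₀, y₀) : E × E)
        rw [sub_add_cancel] at h2
        linarith
      have h2 : ‖-k t • z.1 + f t‖ ≤ B₁ * R + B₂ := by
        refine (norm_add_le _ _).trans (add_le_add ?_ (hB₂ t (hsub ht)))
        rw [norm_smul, norm_neg]
        have := hB₁ t (hsub ht)
        have := (norm_fst_le z).trans hz1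
        gcongr
      refine max_le ?_ ?_
      · have := (norm_snd_le z).trans hz1
        have : 0 ≤ B₁ * R := by positivity
        linarith
      · linarith
    · change L * max (t₀ + τ - t₀) (t₀ - (t₀ - τ)) ≤ ((1 : NNReal) : ℝ) - ((0 : NNReal) : ℝ)
      rw [add_sub_cancel_left, sub_sub_cancel, max_self, hτ, mul_one_div, NNReal.coe_one,
        NNReal.coe_zero, sub_zero, div_le_one (by linarith)]
      linarith
  obtain ⟨α, h0, h1⟩ := hpl.exists_eq_forall_mem_Icc_hasDerivWithinAt₀
  refine ⟨fun t => (α t).1, fun t => (α t).2, τ, hτ0, by simp [h0], by simp [h0], fun t ht => ?_⟩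
  have h2 := (h1 t (Set.Ioo_subset_Icc_self ht)).hasDerivAt (Icc_mem_nhds ht.1 ht.2)
  exact ⟨h2.fst, h2.snd⟩

/-! ### Curves of Schwartz functions which are differentiable in `L²` -/

/-- The curve `y` of Schwartz functions has the derivative `y'` at `t` in the norm of `L²`. -/
def HasSDerivAt (y : ℝ → 𝓢(Space d, ℂ)) (y' : 𝓢(Space d, ℂ)) (t : ℝ) : Prop :=
  HasDerivAt (fun s => toL2 (y s)) (toL2 y') t

theorem hasSDerivAt_const (ψ : 𝓢(Space d, ℂ)) (t : ℝ) : HasSDerivAt (fun _ => ψ) 0 t := by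
  unfold HasSDerivAt
  rw [map_zero]
  exact hasDerivAt_const t _

theorem memLp_one_add_sq_mul (K : ℝ) (ψ : 𝓢(Space d, ℂ)) :
    MemLp (fun x : Space d => (K * (1 + ‖x‖ ^ 2)) * ‖toL2 ψ x‖) 2 volume := by
  have h := ((ψ.memLp 2 volume).add
    ((∑ j, posS (basisVec j) (posS (basisVec j) ψ)).memLp 2 volume)).norm.const_mul K
  refine h.ae_eq ?_
  filter_upwards [toL2_coe ψ] with x hx
  rw [Pi.add_apply, sum_posS_sq_apply, hx]
  have : ψ x + ((‖x‖ ^ 2 : ℝ) : ℂ) * ψ x = ((1 + ‖x‖ ^ 2 : ℝ) : ℂ) * ψ x := by push_cast; ring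
  rw [this, norm_mul, Complex.norm_real, Real.norm_of_nonneg (by positivity), mul_assoc]

/-- The derivative of `s ↦ exp(iθ_s) y(s)`; here `χ = θ'_t exp(iθ_t) y(t)`. -/
theorem HasSDerivAt.phase {y : ℝ → 𝓢(Space d, ℂ)} {y' χ : 𝓢(Space d, ℂ)} {t : ℝ}
    (hy : HasSDerivAt y y' t) {θ : ℝ → Space d → ℝ} (hθ : ∀ s, (θ s).HasTemperateGrowth)
    {θ' : Space d → ℝ} (h : ∀ x, HasDerivAt (fun s => θ s x) (θ' x) t) {K : ℝ}
    (hK : ∀ᶠ s in 𝓝 t, ∀ x, |θ s x - θ t x| ≤ |s - t| * (K * (1 + ‖x‖ ^ 2)))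
    (hχ : ∀ x, χ x = (θ' x : ℂ) * phaseS (θ t) (y t) x) :
    HasSDerivAt (fun s => phaseS (θ s) (y s)) (phaseS (θ t) y' + Complex.I • χ) t := by
  have hc : ∀ s, Continuous (θ s) := fun s => (hθ s).1.continuous
  have h1 : HasDerivAt (fun s => NonlocalSchrodinger.phase (θ s) (hc s) (toL2 (y t)))
      (toL2 (Complex.I • χ)) t := by
    refine hasDerivAt_phase hc h (fun x => K * (1 + ‖x‖ ^ 2)) hK (memLp_one_add_sq_mul K _) ?_
    filter_upwards [toL2_coe (Complex.I • χ), toL2_coe (y t)] with x h1 h2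
    rw [h1, h2, smul_apply, hχ, phaseS_apply (hθ t), smul_eq_mul]
    ring
  have h2 := hasDerivAt_isometry_apply (T := fun s => NonlocalSchrodinger.phase (θ s) (hc s)) hy h1
    (tendsto_phase hc (hc t) (fun x => (h x).continuousAt) _)
  simp only [phase_toL2 (hc _) (hθ _)] at h2
  unfold HasSDerivAt
  rw [map_add]
  exact h2

theorem HasSDerivAt.fourier {y : ℝ → 𝓢(Space d, ℂ)} {y' : 𝓢(Space d, ℂ)} {t : ℝ}
    (hy : HasSDerivAt y y' t) : HasSDerivAt (fun s => 𝓕 (y s)) (𝓕 y') t := by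
  have := hasDerivAt_isometry_apply (T := fun _ => fourierU) hy (hasDerivAt_const t _)
    tendsto_const_nhds
  unfold HasSDerivAt
  simpa only [fourierU_toL2, add_zero] using this

theorem HasSDerivAt.fourierInv {y : ℝ → 𝓢(Space d, ℂ)} {y' : 𝓢(Space d, ℂ)} {t : ℝ}
    (hy : HasSDerivAt y y' t) : HasSDerivAt (fun s => 𝓕⁻ (y s)) (𝓕⁻ y') t := by
  have := hasDerivAt_isometry_apply (T := fun _ => fourierU.symm) hy (hasDerivAt_const t _)
    tendsto_const_nhds
  unfold HasSDerivAt
  simpa only [fourierU_symm_toL2, add_zero] using this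

theorem HasSDerivAt.congr_deriv {y : ℝ → 𝓢(Space d, ℂ)} {y' z' : 𝓢(Space d, ℂ)} {t : ℝ}
    (hy : HasSDerivAt y y' t) (h : y' = z') : HasSDerivAt y z' t := h ▸ hy

/-- A difference quotient bound near a point of differentiability. -/
theorem eventually_norm_sub_le {E : Type*} [NormedAddCommGroup E] [NormedSpace ℝ E] {q : ℝ → E}
    {q' : E} {t : ℝ} (hq : HasDerivAt q q' t) :
    ∀ᶠ s in 𝓝 t, ‖q s - q t‖ ≤ |s - t| * (‖q'‖ + 1) := by
  have h := hq.isLittleO.def (c := 1) one_pos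
  filter_upwards [h] with s hs
  have h1 : q s - q t = (q s - q t - (s - t) • q') + (s - t) • q' := by abel
  rw [h1]
  refine (norm_add_le _ _).trans ?_
  rw [norm_smul, Real.norm_eq_abs] at *
  linarith

/-! Chirps and free propagators. -/

/-- The phase function `x ↦ α|x|²/2`. -/
def chirpSymbol (α : ℝ) (x : Space d) : ℝ := α / 2 * ‖x‖ ^ 2

theorem hasTemperateGrowth_chirpSymbol (α : ℝ) :
    (chirpSymbol α : Space d → ℝ).HasTemperateGrowth := by
  unfold chirpSymbol; fun_prop

/-- Multiplication by `exp(iα|x|²/2)` on Schwartz functions. -/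
def chirpS (α : ℝ) : 𝓢(Space d, ℂ) →L[ℂ] 𝓢(Space d, ℂ) := phaseS (chirpSymbol α)

/-- Multiplication by `exp(iα|x|²/2)` as a unitary operator. -/
def chirp (α : ℝ) : L2 d ≃ₗᵢ[ℂ] L2 d :=
  phase (chirpSymbol α) (hasTemperateGrowth_chirpSymbol α).1.continuous

theorem chirp_toL2 (α : ℝ) (ψ : 𝓢(Space d, ℂ)) : chirp α (toL2 ψ) = toL2 (chirpS α ψ) :=
  phase_toL2 _ (hasTemperateGrowth_chirpSymbol α) ψ

/-- `|x|²` as an operator on Schwartz functions. -/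
def sqPosS : 𝓢(Space d, ℂ) →L[ℂ] 𝓢(Space d, ℂ) :=
  ∑ j, (posS (basisVec j)).comp (posS (basisVec j))

/-- `-Δ` as an operator on Schwartz functions. -/
def sqMomS : 𝓢(Space d, ℂ) →L[ℂ] 𝓢(Space d, ℂ) :=
  ∑ j, (momS (basisVec j)).comp (momS (basisVec j))

theorem sqPosS_eq (ψ : 𝓢(Space d, ℂ)) :
    sqPosS ψ = ∑ j, posS (basisVec j) (posS (basisVec j) ψ) := by
  simp [sqPosS]

theorem sqMomS_eq (ψ : 𝓢(Space d, ℂ)) :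
    sqMomS ψ = ∑ j, momS (basisVec j) (momS (basisVec j) ψ) := by
  simp [sqMomS]

theorem sqPosS_apply (ψ : 𝓢(Space d, ℂ)) (x : Space d) :
    sqPosS ψ x = ((‖x‖ ^ 2 : ℝ) : ℂ) * ψ x := by
  rw [sqPosS_eq, sum_posS_sq_apply]

theorem sqMomS_eq_neg_laplacian (ψ : 𝓢(Space d, ℂ)) : sqMomS ψ = -Δ ψ := by
  rw [laplacian_eq_sum_momS, sqMomS_eq, neg_neg]

theorem posS_chirpS (α : ℝ) (v : Space d) (ψ : 𝓢(Space d, ℂ)) :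
    chirpS α (posS v ψ) = posS v (chirpS α ψ) :=
  (posS_phaseS (hasTemperateGrowth_chirpSymbol α) v ψ).symm

theorem fderiv_chirpSymbol (α : ℝ) (x v : Space d) :
    fderiv ℝ (chirpSymbol α) x v = α * inner ℝ x v := by
  have h : HasFDerivAt (chirpSymbol α : Space d → ℝ) ((α / 2) • (2 • innerSL ℝ x)) x :=
    (hasStrictFDerivAt_norm_sq x).hasFDerivAt.const_mul (α / 2)
  rw [h.fderiv]
  simp
  ring

theorem momS_chirpS (α : ℝ) (v : Space d) (ψ : 𝓢(Space d, ℂ)) :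
    chirpS α (momS v ψ) = momS v (chirpS α ψ) - (α : ℂ) • posS v (chirpS α ψ) := by
  ext x
  rw [sub_apply, smul_apply, posS_apply, smul_eq_mul]
  unfold chirpS
  rw [momS_phaseS (hasTemperateGrowth_chirpSymbol α), fderiv_chirpSymbol]
  push_cast
  ring

theorem HasSDerivAt.chirp {y : ℝ → 𝓢(Space d, ℂ)} {y' : 𝓢(Space d, ℂ)} {t : ℝ}
    (hy : HasSDerivAt y y' t) {α : ℝ → ℝ} {α' : ℝ} (hα : HasDerivAt α α' t) :
    HasSDerivAt (fun s => chirpS (α s) (y s))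
      (chirpS (α t) y' + (Complex.I * (α' / 2 : ℝ)) • sqPosS (chirpS (α t) (y t))) t := by
  rw [mul_smul]
  refine hy.phase (θ := fun s => chirpSymbol (α s)) (θ' := fun x => α' / 2 * ‖x‖ ^ 2)
    (K := (‖α'‖ + 1)) (fun s => hasTemperateGrowth_chirpSymbol _) (fun x => ?_) ?_ (fun x => ?_)
  · exact (hα.div_const 2).mul_const _
  · filter_upwards [eventually_norm_sub_le hα] with s hs x
    have e : chirpSymbol (α s) x - chirpSymbol (α t) x = (α s - α t) * (‖x‖ ^ 2 / 2) := by
      simp only [chirpSymbol]; ring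
    rw [e, abs_mul, abs_of_nonneg (by positivity : 0 ≤ ‖x‖ ^ 2 / 2), ← mul_assoc]
    rw [Real.norm_eq_abs] at hs
    have h2 : ‖x‖ ^ 2 / 2 ≤ 1 + ‖x‖ ^ 2 := by nlinarith [sq_nonneg ‖x‖]
    gcongr
  · rw [smul_apply, sqPosS_apply, smul_eq_mul]
    simp only [chirpS]
    push_cast
    ring

/-- The parameter of the chirp which is the Fourier symbol of `exp(iβΔ/2)`. -/
def kinParam (β : ℝ) : ℝ := -(4 * Real.pi ^ 2) * β

/-- The free propagator `exp(iβΔ/2)` on Schwartz functions. -/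
def kinS (β : ℝ) (ψ : 𝓢(Space d, ℂ)) : 𝓢(Space d, ℂ) := 𝓕⁻ (chirpS (kinParam β) (𝓕 ψ))

/-- The free propagator `exp(iβΔ/2)` as a unitary operator. -/
def kin (β : ℝ) : L2 d ≃ₗᵢ[ℂ] L2 d := (fourierU.trans (chirp (kinParam β))).trans fourierU.symm

theorem kin_toL2 (β : ℝ) (ψ : 𝓢(Space d, ℂ)) : kin β (toL2 ψ) = toL2 (kinS β ψ) := by
  simp only [kin, LinearIsometryEquiv.trans_apply, fourierU_toL2, chirp_toL2, fourierU_symm_toL2,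
    kinS]

theorem fourier_posS (v : Space d) (ψ : 𝓢(Space d, ℂ)) :
    𝓕 (posS v ψ) = -((1 / (2 * Real.pi) : ℝ) : ℂ) • momS v (𝓕 ψ) := by
  rw [momS_fourier, smul_smul]
  have : (-((1 / (2 * Real.pi) : ℝ) : ℂ)) * -((2 * Real.pi : ℝ) : ℂ) = 1 := by
    rw [neg_mul_neg, ← Complex.ofReal_mul, one_div_mul_cancel (by positivity), Complex.ofReal_one]
  rw [this, one_smul]

theorem fourierInv_posS (v : Space d) (ψ : 𝓢(Space d, ℂ)) :
    𝓕⁻ (posS v ψ) = ((1 / (2 * Real.pi) : ℝ) : ℂ) • momS v (𝓕⁻ ψ) := by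
  rw [momS_fourierInv, smul_smul, ← Complex.ofReal_mul, one_div_mul_cancel (by positivity),
    Complex.ofReal_one, one_smul]

theorem posS_kinS (β : ℝ) (v : Space d) (ψ : 𝓢(Space d, ℂ)) :
    kinS β (posS v ψ) = posS v (kinS β ψ) - (β : ℂ) • momS v (kinS β ψ) := by
  simp only [kinS]
  rw [fourier_posS, map_smul, momS_chirpS, FourierTransform.fourierInv_smul, sub_eq_add_neg,
    FourierTransform.fourierInv_add, FourierTransform.fourierInv_neg,
    FourierTransform.fourierInv_smul, fourierInv_momS, fourierInv_posS]
  simp only [smul_add, smul_neg, neg_smul, smul_smul, sub_eq_add_neg]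
  have hpi : (Real.pi : ℂ) ≠ 0 := Complex.ofReal_ne_zero.2 Real.pi_ne_zero
  congr 1
  · rw [← neg_smul, neg_mul, neg_neg, ← Complex.ofReal_mul, one_div_mul_cancel (by positivity),
      Complex.ofReal_one, one_smul]
  · rw [← neg_smul, ← neg_smul]
    congr 1
    simp only [kinParam]
    push_cast
    field_simp
    ring

theorem HasSDerivAt.kin {y : ℝ → 𝓢(Space d, ℂ)} {y' : 𝓢(Space d, ℂ)} {t : ℝ}
    (hy : HasSDerivAt y y' t) {β : ℝ → ℝ} {β' : ℝ} (hβ : HasDerivAt β β' t) :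
    HasSDerivAt (fun s => kinS (β s) (y s))
      (kinS (β t) y' - (Complex.I * (β' / 2 : ℝ)) • sqMomS (kinS (β t) (y t))) t := by
  have h := ((hy.fourier.chirp (hβ.const_mul (-(4 * Real.pi ^ 2)))).fourierInv)
  refine h.congr_deriv ?_
  rw [FourierTransform.fourierInv_add, FourierTransform.fourierInv_smul, sub_eq_add_neg, ← neg_smul]
  congr 1
  rw [sqMomS_eq, sqPosS_eq, FourierTransform.fourierInv_sum, Finset.smul_sum, Finset.smul_sum]
  refine Finset.sum_congr rfl fun j _ => ?_
  rw [fourierInv_posS, fourierInv_posS, map_smul, smul_smul, smul_smul]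
  have hpi : (Real.pi : ℂ) ≠ 0 := Complex.ofReal_ne_zero.2 Real.pi_ne_zero
  change _ • momS _ (momS _ (kinS (β t) (y t))) = _
  congr 1
  push_cast
  field_simp
  ring

/-! ### Weyl operators -/

/-- The phase of the Weyl operator. -/
def weylSymbol (q p : Space d) (x : Space d) : ℝ := -(1 / 2) * inner ℝ q p + inner ℝ x p

theorem continuous_weylSymbol (q p : Space d) : Continuous (weylSymbol q p) := by
  unfold weylSymbol; fun_prop

theorem hasTemperateGrowth_weylSymbol (q p : Space d) : (weylSymbol q p).HasTemperateGrowth := by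
  unfold weylSymbol; fun_prop

/-- The Weyl operator `(W(q,p) u)(x) = exp(-i q·p/2) exp(i x·p) u(x - q)`, the phase space
translation by `(q, p)`. The Galilean transform `G_κ(t,a,b)` is `W(g_κ(t), g_κ'(t))`. -/
def weyl (q p : Space d) : L2 d ≃ₗᵢ[ℂ] L2 d :=
  (translate q).trans (phase (weylSymbol q p) (continuous_weylSymbol q p))

theorem galilean_eq_weyl (κ t : ℝ) (a b : Space d) :
    galilean κ t a b = weyl (gSol κ t a b) (gSol' κ t a b) := rfl

theorem weyl_coe (q p : Space d) (u : L2 d) :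
    weyl q p u =ᵐ[volume] fun x => Complex.exp ((weylSymbol q p x : ℂ) * Complex.I) * u (x - q) :=
        by
  filter_upwards [phase_coe (weylSymbol q p) (continuous_weylSymbol q p) (translate q u),
    translate_coe q u] with x h1 h2
  rw [weyl, LinearIsometryEquiv.trans_apply, h1, h2]

/-- The Weyl form of the canonical commutation relations. -/
theorem weyl_weyl (q p q' p' : Space d) (u : L2 d) :
    weyl q p (weyl q' p' u) =
      Complex.exp (((inner ℝ q' p - inner ℝ q p') / 2 : ℝ) * Complex.I) •
        weyl (q + q') (p + p') u := by
  apply Lp.ext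
  filter_upwards [weyl_coe q p (weyl q' p' u), Lp.coeFn_smul (Complex.exp
    (((inner ℝ q' p - inner ℝ q p') / 2 : ℝ) * Complex.I)) (weyl (q + q') (p + p') u),
    (measurePreserving_sub_right volume q).quasiMeasurePreserving.ae (weyl_coe q' p' u),
    weyl_coe (q + q') (p + p') u] with x h1 h2 h3 h4
  rw [h1, h2, h3, Pi.smul_apply, h4, smul_eq_mul, ← mul_assoc, ← mul_assoc, ← Complex.exp_add,
    ← Complex.exp_add, sub_sub]
  congr 2
  simp only [weylSymbol, inner_sub_left, inner_add_left, inner_add_right]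
  push_cast
  ring

theorem weyl_zero : weyl (0 : Space d) 0 = LinearIsometryEquiv.refl ℂ (L2 d) := by
  refine LinearIsometryEquiv.ext fun u => ?_
  apply Lp.ext
  filter_upwards [weyl_coe 0 0 u] with x h
  rw [h]
  simp [weylSymbol]

theorem weyl_symm (q p : Space d) : (weyl q p).symm = weyl (-q) (-p) := by
  refine LinearIsometryEquiv.ext fun u => ?_
  rw [LinearIsometryEquiv.symm_apply_eq, weyl_weyl]
  simp [weyl_zero]

/-- Weyl operators are strongly continuous. -/
theorem tendsto_weyl {ι : Type*} {l : Filter ι} [l.IsCountablyGenerated] {q p : ι → Space d}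
    {q₀ p₀ : Space d} (hq : Tendsto q l (𝓝 q₀)) (hp : Tendsto p l (𝓝 p₀)) (u : L2 d) :
    Tendsto (fun n => weyl (q n) (p n) u) l (𝓝 (weyl q₀ p₀ u)) := by
  have h1 := tendsto_phase (fun n => continuous_weylSymbol (q n) (p n))
    (continuous_weylSymbol q₀ p₀) (l := l) (fun x => ?_) (translate q₀ u)
  · have h2 := tendsto_translate hq u
    rw [tendsto_iff_norm_sub_tendsto_zero] at h1 h2 ⊢
    refine squeeze_zero (fun _ => norm_nonneg _) (fun n => ?_) (by simpa using h2.add h1)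
    have e : weyl (q n) (p n) u - weyl q₀ p₀ u =
        phase (weylSymbol (q n) (p n)) (continuous_weylSymbol _ _)
          (translate (q n) u - translate q₀ u) +
        (phase (weylSymbol (q n) (p n)) (continuous_weylSymbol _ _) (translate q₀ u) -
          phase (weylSymbol q₀ p₀) (continuous_weylSymbol _ _) (translate q₀ u)) := by
      rw [map_sub]
      simp only [weyl, LinearIsometryEquiv.trans_apply]
      abel
    rw [e]
    refine (norm_add_le _ _).trans ?_
    rw [LinearIsometryEquiv.norm_map]
  · exact ((hq.inner hp).const_mul _).add (tendsto_const_nhds.inner hp)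

/-- The Weyl operators on Schwartz functions. -/
def weylS (q p : Space d) (ψ : 𝓢(Space d, ℂ)) : 𝓢(Space d, ℂ) :=
  phaseS (weylSymbol q p) (shiftS q ψ)

theorem weyl_toL2 (q p : Space d) (ψ : 𝓢(Space d, ℂ)) :
    weyl q p (toL2 ψ) = toL2 (weylS q p ψ) := by
  rw [weyl, LinearIsometryEquiv.trans_apply, translate_toL2,
    phase_toL2 _ (hasTemperateGrowth_weylSymbol q p), weylS]

theorem posS_weylS (q p v : Space d) (ψ : 𝓢(Space d, ℂ)) :
    weylS q p (posS v ψ) = posS v (weylS q p ψ) - ((inner ℝ q v : ℝ) : ℂ) • weylS q p ψ := by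
  unfold weylS
  rw [posS_phaseS (hasTemperateGrowth_weylSymbol q p), posS_shiftS, map_add, map_smul,
    add_sub_cancel_right]

theorem fderiv_weylSymbol (q p x v : Space d) :
    fderiv ℝ (weylSymbol q p) x v = inner ℝ p v := by
  have h : HasFDerivAt (weylSymbol q p) (innerSL ℝ p) x := by
    have := (innerSL ℝ p).hasFDerivAt (x := x)
    refine (this.const_add (-(1 / 2) * inner ℝ q p)).congr_of_eventuallyEq ?_
    exact Eventually.of_forall fun y => by simp [weylSymbol, real_inner_comm]
  rw [h.fderiv]
  simp

theorem phaseS_weylSymbol_momS (q p v : Space d) (ψ : 𝓢(Space d, ℂ)) :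
    phaseS (weylSymbol q p) (momS v ψ) = momS v (phaseS (weylSymbol q p) ψ) -
      ((inner ℝ p v : ℝ) : ℂ) • phaseS (weylSymbol q p) ψ := by
  ext x
  rw [sub_apply, smul_apply, smul_eq_mul, momS_phaseS (hasTemperateGrowth_weylSymbol q p),
    fderiv_weylSymbol]
  ring

theorem momS_weylS (q p v : Space d) (ψ : 𝓢(Space d, ℂ)) :
    weylS q p (momS v ψ) = momS v (weylS q p ψ) - ((inner ℝ p v : ℝ) : ℂ) • weylS q p ψ := by
  unfold weylS
  rw [← momS_shiftS, phaseS_weylSymbol_momS]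

theorem fourier_shiftS (h : Space d) (ψ : 𝓢(Space d, ℂ)) :
    𝓕 (shiftS h ψ) = phaseS (shiftSymbol h) (𝓕 ψ) := by
  apply toL2_injective
  rw [← fourierU_toL2, ← translate_toL2, fourierU_translate, fourierU_toL2,
    phase_toL2 _ (hasTemperateGrowth_shiftSymbol h)]

theorem HasSDerivAt.shift {y : ℝ → 𝓢(Space d, ℂ)} {y' : 𝓢(Space d, ℂ)} {t : ℝ}
    (hy : HasSDerivAt y y' t) {q : ℝ → Space d} {q' : Space d} (hq : HasDerivAt q q' t) :
    HasSDerivAt (fun s => shiftS (q s) (y s))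
      (shiftS (q t) y' - Complex.I • momS q' (shiftS (q t) (y t))) t := by
  have h : HasSDerivAt (fun s => phaseS (shiftSymbol (q s)) (𝓕 (y s))) _ t :=
    hy.fourier.phase (θ := fun s => shiftSymbol (q s)) (θ' := fun ξ => shiftSymbol q' ξ)
      (K := 2 * Real.pi * (‖q'‖ + 1)) (χ := (-(2 * Real.pi : ℝ) : ℂ) •
        posS q' (phaseS (shiftSymbol (q t)) (𝓕 (y t))))
      (fun s => hasTemperateGrowth_shiftSymbol _) (fun x => ?_) ?_ (fun x => ?_)
  · have h2 := h.fourierInv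
    simp only [← fourier_shiftS, FourierTransform.fourierInv_fourier_eq] at h2
    refine h2.congr_deriv ?_
    rw [FourierTransform.fourierInv_add,
      FourierTransform.fourierInv_fourier_eq, FourierTransform.fourierInv_smul,
      FourierTransform.fourierInv_smul, fourierInv_posS, FourierTransform.fourierInv_fourier_eq,
      smul_smul (-((2 * Real.pi : ℝ) : ℂ))]
    have hpi : (-((2 * Real.pi : ℝ) : ℂ)) * ((1 / (2 * Real.pi) : ℝ) : ℂ) = -1 := by
      rw [neg_mul, ← Complex.ofReal_mul, mul_one_div_cancel (by positivity), Complex.ofReal_one]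
    rw [hpi]
    module
  · simp only [shiftSymbol]
    have := (hasDerivAt_const t x).inner ℝ hq
    simpa using this.const_mul (-(2 * Real.pi))
  · filter_upwards [eventually_norm_sub_le hq] with s hs x
    have e : shiftSymbol (q s) x - shiftSymbol (q t) x = -(2 * Real.pi) * inner ℝ x (q s - q t) :=
        by
      simp only [shiftSymbol, inner_sub_right]; ring
    have h1 := abs_real_inner_le_norm x (q s - q t)
    have h2 : ‖x‖ ≤ 1 + ‖x‖ ^ 2 := by nlinarith [sq_nonneg (‖x‖ - 1)]
    rw [e, abs_mul, abs_neg, abs_of_pos Real.two_pi_pos]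
    calc 2 * Real.pi * |inner ℝ x (q s - q t)|
        ≤ 2 * Real.pi * ((1 + ‖x‖ ^ 2) * (|s - t| * (‖q'‖ + 1))) := by
          have : ‖x‖ * ‖q s - q t‖ ≤ (1 + ‖x‖ ^ 2) * (|s - t| * (‖q'‖ + 1)) := by gcongr
          have hpi := Real.pi_pos
          gcongr
          exact h1.trans this
      _ = _ := by ring
  · rw [smul_apply, posS_apply, smul_eq_mul]
    simp only [shiftSymbol]
    push_cast
    ring

theorem HasSDerivAt.weyl {y : ℝ → 𝓢(Space d, ℂ)} {y' : 𝓢(Space d, ℂ)} {t : ℝ}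
    (hy : HasSDerivAt y y' t) {q p : ℝ → Space d} {q' p' : Space d} (hq : HasDerivAt q q' t)
    (hp : HasDerivAt p p' t) :
    HasSDerivAt (fun s => weylS (q s) (p s) (y s))
      (weylS (q t) (p t) y' + Complex.I • (posS p' (weylS (q t) (p t) (y t)) -
        momS q' (weylS (q t) (p t) (y t)) +
        (((inner ℝ q' (p t) - inner ℝ (q t) p') / 2 : ℝ) : ℂ) • weylS (q t) (p t) (y t))) t := by
  set c' : ℝ := -(1 / 2) * (inner ℝ q' (p t) + inner ℝ (q t) p') with hc'
  have hin : HasDerivAt (fun s => inner ℝ (q s) (p s)) (inner ℝ q' (p t) + inner ℝ (q t) p') t := by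
    have := hq.inner ℝ hp
    rwa [add_comm] at this
  have hc : HasDerivAt (fun s => -(1 / 2) * inner ℝ (q s) (p s)) c' t := hin.const_mul _
  have h : HasSDerivAt (fun s => phaseS (weylSymbol (q s) (p s)) (shiftS (q s) (y s))) _ t :=
    (hy.shift hq).phase (θ := fun s => weylSymbol (q s) (p s))
      (θ' := fun x => c' + inner ℝ x p') (K := (‖c'‖ + 1) + (‖p'‖ + 1))
      (χ := (c' : ℂ) • weylS (q t) (p t) (y t) + posS p' (weylS (q t) (p t) (y t)))
      (fun s => hasTemperateGrowth_weylSymbol _ _) (fun x => ?_) ?_ (fun x => ?_)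
  · refine h.congr_deriv ?_
    rw [map_sub, map_smul, phaseS_weylSymbol_momS]
    change weylS (q t) (p t) y' - Complex.I • (momS q' (weylS (q t) (p t) (y t)) -
      ((inner ℝ (p t) q' : ℝ) : ℂ) • weylS (q t) (p t) (y t)) + _ = _
    rw [real_inner_comm q' (p t), hc']
    push_cast
    module
  · have := (hasDerivAt_const t x).inner ℝ hp
    refine (hc.add this).congr_deriv ?_
    simp
  · filter_upwards [eventually_norm_sub_le hc, eventually_norm_sub_le hp] with s hs1 hs2 x
    have e : weylSymbol (q s) (p s) x - weylSymbol (q t) (p t) x =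
        (-(1 / 2) * inner ℝ (q s) (p s) - -(1 / 2) * inner ℝ (q t) (p t)) +
          inner ℝ x (p s - p t) := by
      simp only [weylSymbol, inner_sub_right]; ring
    have h1 := abs_real_inner_le_norm x (p s - p t)
    have h2 : ‖x‖ ≤ 1 + ‖x‖ ^ 2 := by nlinarith [sq_nonneg (‖x‖ - 1)]
    rw [e]
    refine (abs_add_le _ _).trans ?_
    have h3 : ‖x‖ * ‖p s - p t‖ ≤ (1 + ‖x‖ ^ 2) * (|s - t| * (‖p'‖ + 1)) := by gcongr
    rw [Real.norm_eq_abs] at hs1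
    have h4 : |s - t| * (‖c'‖ + 1) * 1 ≤ |s - t| * (‖c'‖ + 1) * (1 + ‖x‖ ^ 2) := by
      gcongr
      nlinarith [sq_nonneg ‖x‖]
    nlinarith
  · rw [add_apply, smul_apply, posS_apply, smul_eq_mul]
    simp only [weylS]
    push_cast
    ring

/-! ### Quadratic Hamiltonians -/

/-- The skew-symmetric operator `(i/2)(Δ - k|x|² + 2 f·x)` on Schwartz functions. -/
def genS (k : ℝ) (f : Space d) (ψ : 𝓢(Space d, ℂ)) : 𝓢(Space d, ℂ) :=
  (-(Complex.I / 2)) • (sqMomS ψ + (k : ℂ) • sqPosS ψ - (2 : ℂ) • posS f ψ)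

theorem inner_genS (k : ℝ) (f : Space d) (φ ψ : 𝓢(Space d, ℂ)) :
    inner ℂ (toL2 (genS k f φ)) (toL2 ψ) = -inner ℂ (toL2 φ) (toL2 (genS k f ψ)) := by
  have h1 : inner ℂ (toL2 (sqMomS φ)) (toL2 ψ) = inner ℂ (toL2 φ) (toL2 (sqMomS ψ)) := by
    simp only [sqMomS_eq, map_sum, sum_inner, inner_sum, inner_momS_left]
  have h2 : inner ℂ (toL2 (sqPosS φ)) (toL2 ψ) = inner ℂ (toL2 φ) (toL2 (sqPosS ψ)) := by
    simp only [sqPosS_eq, map_sum, sum_inner, inner_sum, inner_posS_left]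
  simp only [genS, map_smul, map_sub, map_add, inner_smul_left, inner_smul_right, inner_sub_left,
    inner_sub_right, inner_add_left, inner_add_right, h1, h2, inner_posS_left]
  rw [map_neg, map_div₀, Complex.conj_I, Complex.conj_ofNat, Complex.conj_ofReal]
  ring

/-- `T` solves `∂_t T ψ = (i/2)(Δ - k(t)|x|² + 2 f(t)·x) T ψ` for Schwartz functions `ψ` and `t` in
`s`, staying in the Schwartz space. -/
def IsFlowOn (k : ℝ → ℝ) (f : ℝ → Space d) (s : Set ℝ) (T : ℝ → (L2 d ≃ₗᵢ[ℂ] L2 d)) : Prop :=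
  ∀ ψ : 𝓢(Space d, ℂ), ∃ y : ℝ → 𝓢(Space d, ℂ), (∀ t, T t (toL2 ψ) = toL2 (y t)) ∧
    ∀ t ∈ s, HasSDerivAt y (genS (k t) (f t) (y t)) t

/-- The operator `x·v` conjugated by the product of a chirp and a free propagator. -/
def shearedPosS (β γ : ℝ) (v : Space d) (ψ : 𝓢(Space d, ℂ)) : 𝓢(Space d, ℂ) :=
  posS v ψ - (β : ℂ) • (momS v ψ - (γ : ℂ) • posS v ψ)

theorem chirpS_kinS_posS (β γ : ℝ) (v : Space d) (ψ : 𝓢(Space d, ℂ)) :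
    chirpS γ (kinS β (posS v ψ)) = shearedPosS β γ v (chirpS γ (kinS β ψ)) := by
  rw [posS_kinS, map_sub, map_smul, posS_chirpS, momS_chirpS, shearedPosS]

theorem kinS_smul (β : ℝ) (c : ℂ) (ψ : 𝓢(Space d, ℂ)) : kinS β (c • ψ) = c • kinS β ψ := by
  apply toL2_injective
  rw [← kin_toL2, map_smul, map_smul, map_smul, kin_toL2]

theorem kinS_sum {ι : Type*} (β : ℝ) (s : Finset ι) (ψ : ι → 𝓢(Space d, ℂ)) :
    kinS β (∑ i ∈ s, ψ i) = ∑ i ∈ s, kinS β (ψ i) := by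
  apply toL2_injective
  rw [← kin_toL2, map_sum, map_sum, map_sum]
  simp only [kin_toL2]

/-- The curve `exp(iγ|x|²/2) exp(iβΔ/2) exp(iα|x|²/2) φ` solves the Schrödinger equation with the
potential `k|x|²/2` if the parameters solve a system of ordinary differential equations. -/
theorem hasSDerivAt_shears {α β γ : ℝ → ℝ} {k t : ℝ} (hβ0 : β t ≠ 0)
    (hα : HasDerivAt α (γ t / β t) t) (hβ : HasDerivAt β (1 + β t * γ t) t)
    (hγ : HasDerivAt γ (-k - γ t * (1 + β t * γ t) / β t) t) (φ : 𝓢(Space d, ℂ)) :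
    HasSDerivAt (fun s => chirpS (γ s) (kinS (β s) (chirpS (α s) φ)))
      (genS k 0 (chirpS (γ t) (kinS (β t) (chirpS (α t) φ)))) t := by
  refine ((((hasSDerivAt_const φ t).chirp hα).kin hβ).chirp hγ).congr_deriv ?_
  set z := chirpS (α t) φ
  set y := chirpS (γ t) (kinS (β t) z) with hy
  have e1 : chirpS (γ t) (kinS (β t) (sqPosS z)) =
      ∑ j, shearedPosS (β t) (γ t) (basisVec j) (shearedPosS (β t) (γ t) (basisVec j) y) := by
    rw [sqPosS_eq, kinS_sum, map_sum]
    simp only [chirpS_kinS_posS, hy]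
  have e2 : chirpS (γ t) (sqMomS (kinS (β t) z)) =
      ∑ j, (momS (basisVec j) (momS (basisVec j) y - (γ t : ℂ) • posS (basisVec j) y) -
        (γ t : ℂ) • posS (basisVec j) (momS (basisVec j) y - (γ t : ℂ) • posS (basisVec j) y)) := by
    rw [sqMomS_eq, map_sum]
    simp only [momS_chirpS, hy]
  rw [map_zero, zero_add, kinS_smul, map_sub, map_smul, map_smul, e1, e2, genS, sqPosS_eq,
    sqMomS_eq, show posS (0 : Space d) y = 0 by ext x; simp [posS_apply], smul_zero, sub_zero,
    Finset.smul_sum, Finset.smul_sum, Finset.smul_sum, Finset.smul_sum, ← Finset.sum_sub_distrib,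
    ← Finset.sum_add_distrib, ← Finset.sum_add_distrib, Finset.smul_sum]
  refine Finset.sum_congr rfl fun j _ => ?_
  simp only [shearedPosS, map_sub, map_smul]
  have hβ0' : (β t : ℂ) ≠ 0 := Complex.ofReal_ne_zero.2 hβ0
  push_cast
  match_scalars <;> field_simp <;> ring

theorem chirpS_zero (ψ : 𝓢(Space d, ℂ)) : chirpS 0 ψ = ψ := by
  ext x
  rw [chirpS, phaseS_apply (hasTemperateGrowth_chirpSymbol 0)]
  simp [chirpSymbol]

theorem chirpS_chirpS (α β : ℝ) (ψ : 𝓢(Space d, ℂ)) :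
    chirpS α (chirpS β ψ) = chirpS (α + β) ψ := by
  ext x
  simp only [chirpS]
  rw [phaseS_apply (hasTemperateGrowth_chirpSymbol _), phaseS_apply
    (hasTemperateGrowth_chirpSymbol _), phaseS_apply (hasTemperateGrowth_chirpSymbol _),
    ← mul_assoc, ← Complex.exp_add]
  congr 2
  simp only [chirpSymbol]
  push_cast
  ring

theorem kinS_one_neg_one (ψ : 𝓢(Space d, ℂ)) : kinS 1 (kinS (-1) ψ) = ψ := by
  simp only [kinS, kinParam, FourierTransform.fourier_fourierInv_eq, chirpS_chirpS]
  rw [show -(4 * Real.pi ^ 2) * 1 + -(4 * Real.pi ^ 2) * -1 = 0 by ring, chirpS_zero,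
    FourierTransform.fourierInv_fourier_eq]

/-- Local existence of the propagator of a time dependent harmonic oscillator, as a product of
chirps and free propagators. -/
theorem exists_local_flow {k : ℝ → ℝ} (hk : Continuous k) (t₀ : ℝ) :
    ∃ (T : ℝ → (L2 d ≃ₗᵢ[ℂ] L2 d)) (τ : ℝ), 0 < τ ∧ T t₀ = LinearIsometryEquiv.refl ℂ (L2 d) ∧
      IsFlowOn k (fun _ => 0) (Set.Ioo (t₀ - τ) (t₀ + τ)) T := by
  obtain ⟨β, β', τ₁, hτ₁, hβ0, hβ'0, hβ⟩ := exists_local_linear_ode (E := ℝ) hk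
    (continuous_const (y := (0 : ℝ))) t₀ 1 1
  have hmem : t₀ ∈ Set.Ioo (t₀ - τ₁) (t₀ + τ₁) := ⟨by linarith, by linarith⟩
  have hcont : ContinuousAt β t₀ := (hβ t₀ hmem).1.continuousAt
  have hpos : ∀ᶠ t in 𝓝 t₀, 0 < β t := by
    refine hcont.eventually_const_lt ?_
    rw [hβ0]; exact one_pos
  obtain ⟨τ₂, hτ₂, hball⟩ := Metric.eventually_nhds_iff_ball.1 hpos
  set τ := min τ₁ τ₂ with hτ
  have hτ0 : 0 < τ := lt_min hτ₁ hτ₂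
  have hI1 : ∀ t ∈ Set.Ioo (t₀ - τ) (t₀ + τ), t ∈ Set.Ioo (t₀ - τ₁) (t₀ + τ₁) := fun t ht =>
    ⟨by linarith [ht.1, min_le_left τ₁ τ₂], by linarith [ht.2, min_le_left τ₁ τ₂]⟩
  have hI2 : ∀ t ∈ Set.Ioo (t₀ - τ) (t₀ + τ), 0 < β t := fun t ht => by
    refine hball t ?_
    rw [Real.ball_eq_Ioo]
    exact ⟨by linarith [ht.1, min_le_right τ₁ τ₂], by linarith [ht.2, min_le_right τ₁ τ₂]⟩
  set γ : ℝ → ℝ := fun t => (β' t - 1) / β t with hγ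
  have hγβ : ∀ t ∈ Set.Ioo (t₀ - τ) (t₀ + τ), 1 + β t * γ t = β' t := fun t ht => by
    have := (hI2 t ht).ne'
    simp only [hγ]
    field_simp
    ring
  have hγd : ∀ t ∈ Set.Ioo (t₀ - τ) (t₀ + τ),
      HasDerivAt γ (-k t - γ t * (1 + β t * γ t) / β t) t := fun t ht => by
    have h0 := (hI2 t ht).ne'
    obtain ⟨h1, h2⟩ := hβ t (hI1 t ht)
    refine ((h2.sub_const 1).div h1 h0).congr_deriv ?_
    rw [hγβ t ht]
    simp only [hγ, smul_eq_mul, add_zero]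
    field_simp
  have hcd : ContinuousOn (fun t => γ t / β t) (Set.Ioo (t₀ - τ) (t₀ + τ)) := fun t ht =>
    ((hγd t ht).continuousAt.div (hβ t (hI1 t ht)).1.continuousAt (hI2 t ht).ne').continuousWithinAt
  set α : ℝ → ℝ := fun t => ∫ s in t₀..t, γ s / β s with hα
  have hαd : ∀ t ∈ Set.Ioo (t₀ - τ) (t₀ + τ), HasDerivAt α (γ t / β t) t := fun t ht => by
    have hsub : Set.uIcc t₀ t ⊆ Set.Ioo (t₀ - τ) (t₀ + τ) := by
      refine Set.OrdConnected.uIcc_subset Set.ordConnected_Ioo ⟨by linarith, by linarith⟩ ht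
    refine intervalIntegral.integral_hasDerivAt_right (hcd.mono hsub).intervalIntegrable
      (hcd.stronglyMeasurableAtFilter isOpen_Ioo t ht) (hcd.continuousAt (isOpen_Ioo.mem_nhds ht))
  refine ⟨fun t => (((kin (-1)).trans (chirp (α t))).trans (kin (β t))).trans (chirp (γ t)), τ, hτ0,
    toL2_ext fun ψ => ?_, fun ψ => ⟨fun t => chirpS (γ t) (kinS (β t) (chirpS (α t) (kinS (-1) ψ))),
      fun t => ?_, fun t ht => ?_⟩⟩
  · have hα0 : α t₀ = 0 := by simp [hα]
    have hγ0 : γ t₀ = 0 := by simp [hγ, hβ'0]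
    simp only [LinearIsometryEquiv.trans_apply, kin_toL2, chirp_toL2, hα0, hβ0, hγ0, chirpS_zero,
      kinS_one_neg_one, LinearIsometryEquiv.coe_refl, id_eq]
  · simp only [LinearIsometryEquiv.trans_apply, kin_toL2, chirp_toL2]
  · refine hasSDerivAt_shears (hI2 t ht).ne' (hαd t ht) ?_ (hγd t ht) _
    rw [hγβ t ht]
    exact (hβ t (hI1 t ht)).1

/-! ### Weak solutions of linear Schrödinger equations -/

/-- `w` is a weak solution, continuous in `L²`, of
`∂_t w = (i/2)(Δ - k(t)|x|² + 2 f(t)·x) w` at all times in `s`. -/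
def IsWeakFlowOn (k : ℝ → ℝ) (f : ℝ → Space d) (s : Set ℝ) (w : ℝ → L2 d) : Prop :=
  ∀ t ∈ s, ContinuousAt w t ∧ ∀ φ : 𝓢(Space d, ℂ),
    HasDerivAt (fun r => inner ℂ (toL2 φ) (w r)) (-inner ℂ (toL2 (genS (k t) (f t) φ)) (w t)) t

theorem IsWeakFlowOn.mono {k : ℝ → ℝ} {f : ℝ → Space d} {s s' : Set ℝ} {w : ℝ → L2 d}
    (h : IsWeakFlowOn k f s w) (hs : s' ⊆ s) : IsWeakFlowOn k f s' w :=
  fun t ht => h t (hs ht)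

theorem IsFlowOn.mono {k : ℝ → ℝ} {f : ℝ → Space d} {s s' : Set ℝ} {T : ℝ → (L2 d ≃ₗᵢ[ℂ] L2 d)}
    (h : IsFlowOn k f s T) (hs : s' ⊆ s) : IsFlowOn k f s' T := fun ψ => by
  obtain ⟨y, h1, h2⟩ := h ψ
  exact ⟨y, h1, fun t ht => h2 t (hs ht)⟩

/-- The pairing of a weak solution with a solution in the Schwartz space is constant. -/
theorem IsWeakFlowOn.hasDerivAt_inner {k : ℝ → ℝ} {f : ℝ → Space d} {s : Set ℝ} {w : ℝ → L2 d}
    (hw : IsWeakFlowOn k f s w) {y : ℝ → 𝓢(Space d, ℂ)} {t : ℝ} (ht : t ∈ s)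
    (hy : HasSDerivAt y (genS (k t) (f t) (y t)) t) :
    HasDerivAt (fun r => inner ℂ (toL2 (y r)) (w r)) 0 t := by
  obtain ⟨hc, hd⟩ := hw t ht
  have h1 := hasDerivAt_iff_tendsto_slope.1 (hd (y t))
  have h2 := hasDerivAt_iff_tendsto_slope.1 hy
  rw [hasDerivAt_iff_tendsto_slope]
  have h3 := (h2.inner (hc.tendsto.mono_left nhdsWithin_le_nhds) (𝕜 := ℂ)).add h1
  rw [add_neg_cancel] at h3
  refine h3.congr fun r => ?_
  simp only [slope_def_module, real_smul_L2, Complex.real_smul, inner_smul_left,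
      Complex.conj_ofReal,
    inner_sub_left]
  ring

/-- A weak solution is transported by the propagator of the equation. -/
theorem IsFlowOn.eq_of_isWeakFlowOn {k : ℝ → ℝ} {f : ℝ → Space d} {s : Set ℝ}
    {T : ℝ → (L2 d ≃ₗᵢ[ℂ] L2 d)} (hT : IsFlowOn k f s T) (hs : IsOpen s) (hs' : IsPreconnected s)
    {w : ℝ → L2 d} (hw : IsWeakFlowOn k f s w) {t₀ t : ℝ} (ht₀ : t₀ ∈ s) (ht : t ∈ s) :
    w t = T t ((T t₀).symm (w t₀)) := by
  rw [← LinearIsometryEquiv.symm_apply_eq]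
  refine denseRange_toL2.eq_of_inner_right ℂ (fun ψ => ?_)
  obtain ⟨y, h1, h2⟩ := hT ψ
  have hd : ∀ r ∈ s, HasDerivAt (fun r => inner ℂ (toL2 (y r)) (w r)) 0 r := fun r hr =>
    hw.hasDerivAt_inner hr (h2 r hr)
  have hconst := hs.is_const_of_deriv_eq_zero hs'
    (fun r hr => (hd r hr).differentiableAt.differentiableWithinAt)
    (fun r hr => (hd r hr).deriv) ht ht₀
  rw [← (T t).inner_map_map, ← (T t₀).inner_map_map (toL2 ψ)]
  simp only [LinearIsometryEquiv.apply_symm_apply, h1]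
  exact hconst

theorem posS_eq_sum (v : Space d) (ψ : 𝓢(Space d, ℂ)) :
    posS v ψ = ∑ j, ((v j : ℝ) : ℂ) • posS (basisVec j) ψ := by
  ext x
  rw [sum_apply]
  simp only [smul_apply, posS_apply, inner_basisVec, smul_eq_mul]
  rw [PiLp.inner_apply]
  push_cast
  rw [Finset.sum_mul]
  refine Finset.sum_congr rfl fun j _ => ?_
  simp
  ring

theorem eq_sum_basisVec (v : Space d) : v = ∑ j, v j • basisVec j := by
  simpa [basisVec] using ((EuclideanSpace.basisFun (Fin d) ℝ).sum_repr v).symm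

theorem momS_eq_sum (v : Space d) (ψ : 𝓢(Space d, ℂ)) :
    momS v ψ = ∑ j, ((v j : ℝ) : ℂ) • momS (basisVec j) ψ := by
  ext x
  rw [sum_apply, momS_apply]
  conv_lhs => rw [eq_sum_basisVec v]
  rw [map_sum, Finset.mul_sum]
  refine Finset.sum_congr rfl fun j _ => ?_
  rw [map_smul, smul_apply, momS_apply, Complex.real_smul, smul_eq_mul]
  ring

theorem continuous_toL2_genS (φ : 𝓢(Space d, ℂ)) :
    Continuous fun z : ℝ × Space d => toL2 (genS z.1 z.2 φ) := by
  have e2 : (fun z : ℝ × Space d => toL2 (genS z.1 z.2 φ)) = fun z =>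
      (-(Complex.I / 2)) • (toL2 (sqMomS φ) + (z.1 : ℂ) • toL2 (sqPosS φ) -
        (2 : ℂ) • ∑ j, ((z.2 j : ℝ) : ℂ) • toL2 (posS (basisVec j) φ)) := by
    funext z
    rw [genS, posS_eq_sum]
    simp only [map_smul, map_sub, map_add, map_sum]
  rw [e2]
  fun_prop

theorem IsFlowOn.continuousAt {k : ℝ → ℝ} {f : ℝ → Space d} {s : Set ℝ}
    {T : ℝ → (L2 d ≃ₗᵢ[ℂ] L2 d)} (hT : IsFlowOn k f s T) (u : L2 d) {t : ℝ} (ht : t ∈ s) :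
    ContinuousAt (fun r => T r u) t := by
  rw [Metric.continuousAt_iff']
  intro ε hε
  obtain ⟨ψ, hψ⟩ := denseRange_toL2.exists_dist_lt u (by positivity : 0 < ε / 3)
  obtain ⟨y, h1, h2⟩ := hT ψ
  have h3 : ContinuousAt (fun r => T r (toL2 ψ)) t := by
    simp only [h1]
    exact HasDerivAt.continuousAt (h2 t ht)
  filter_upwards [Metric.continuousAt_iff'.1 h3 (ε / 3) (by positivity)] with r hr
  have h4 : dist (T r u) (T r (toL2 ψ)) < ε / 3 := by rwa [LinearIsometryEquiv.dist_map]
  have h5 : dist (T t (toL2 ψ)) (T t u) < ε / 3 := by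
    rwa [LinearIsometryEquiv.dist_map, dist_comm]
  have := dist_triangle4 (T r u) (T r (toL2 ψ)) (T t (toL2 ψ)) (T t u)
  linarith

/-- The orbits of a propagator are weak solutions, for arbitrary data in `L²`. -/
theorem IsFlowOn.isWeakFlowOn {k : ℝ → ℝ} {f : ℝ → Space d} {s : Set ℝ}
    {T : ℝ → (L2 d ≃ₗᵢ[ℂ] L2 d)} (hT : IsFlowOn k f s T) (hs : IsOpen s) (hk : ContinuousOn k s)
    (hf : ContinuousOn f s) (u : L2 d) : IsWeakFlowOn k f s fun t => T t u := by
  intro t ht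
  refine ⟨hT.continuousAt u ht, fun φ => ?_⟩
  obtain ⟨v, hv⟩ : ∃ v : ℕ → 𝓢(Space d, ℂ), Tendsto (fun n => toL2 (v n)) atTop (𝓝 u) := by
    obtain ⟨w, hw, hw'⟩ := mem_closure_iff_seq_limit.1 (denseRange_toL2 u)
    choose v hv using hw
    exact ⟨v, by simpa [hv] using hw'⟩
  have hcont : ContinuousAt (fun r => toL2 (genS (k r) (f r) φ)) t :=
    ((continuous_toL2_genS φ).continuousAt).comp (f := fun r => (k r, f r))
      ((hk.continuousAt (hs.mem_nhds ht)).prodMk (hf.continuousAt (hs.mem_nhds ht)))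
  set C : ℝ := ‖toL2 (genS (k t) (f t) φ)‖ + 1 with hC
  have hb : ∀ᶠ r in 𝓝 t, ‖toL2 (genS (k r) (f r) φ)‖ < C :=
    hcont.norm.eventually_lt_const (by simp only [hC]; linarith)
  refine hasDerivAt_of_tendstoUniformlyOnFilter (l := atTop)
    (f := fun n r => inner ℂ (toL2 φ) (T r (toL2 (v n))))
    (f' := fun n r => -inner ℂ (toL2 (genS (k r) (f r) φ)) (T r (toL2 (v n))))
    (g' := fun r => -inner ℂ (toL2 (genS (k r) (f r) φ)) (T r u)) ?_ ?_ ?_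
  · rw [Metric.tendstoUniformlyOnFilter_iff]
    intro ε hε
    have hC0 : 0 < C := by positivity
    have h1 : ∀ᶠ n in atTop, ‖toL2 (v n) - u‖ < ε / C :=
      (tendsto_iff_norm_sub_tendsto_zero.1 hv).eventually_lt_const (by positivity)
    filter_upwards [h1.prod_mk hb] with ⟨n, r⟩ ⟨h2, h3⟩
    rw [dist_eq_norm, neg_sub_neg, ← inner_sub_right, ← map_sub]
    refine (norm_inner_le_norm _ _).trans_lt ?_
    rw [LinearIsometryEquiv.norm_map]
    calc _ ≤ C * ‖toL2 (v n) - u‖ := by gcongr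
      _ < C * (ε / C) := by gcongr
      _ = ε := by field_simp
  · have h0 : ∀ᶠ r in 𝓝 t, r ∈ s := hs.mem_nhds ht
    refine (h0.prod_inr atTop).mono ?_
    rintro ⟨n, r⟩ hr
    change HasDerivAt (fun r => inner ℂ (toL2 φ) (T r (toL2 (v n)))) _ r
    obtain ⟨y, h1, h2⟩ := hT (v n)
    simp only [h1]
    have := (hasDerivAt_const r (toL2 φ)).inner ℂ (h2 r hr)
    simpa [inner_genS] using this
  · refine Eventually.of_forall fun r => ?_
    exact tendsto_const_nhds.inner (((T r).continuous.tendsto u).comp hv)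

/-! ### The group generated by `(i/2)(Δ - κ|x|²)` -/

theorem generator_eq_toL2_genS (κ : ℝ) (φ : 𝓢(Space d, ℂ)) (f' : L2 d) :
    (f' =ᵐ[volume] fun x => Complex.I / 2 * ((Δ φ) x - ((κ * ‖x‖ ^ 2 : ℝ) : ℂ) * φ x)) ↔
      f' = toL2 (genS κ 0 φ) := by
  have e : ∀ x, genS κ 0 φ x = Complex.I / 2 * ((Δ φ) x - ((κ * ‖x‖ ^ 2 : ℝ) : ℂ) * φ x) := by
    intro x
    simp only [genS, smul_apply, sub_apply, add_apply, sqPosS_apply, posS_apply, inner_zero_right,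
      sqMomS_eq_neg_laplacian, neg_apply, smul_eq_mul]
    push_cast
    ring
  constructor
  · intro h
    apply Lp.ext
    filter_upwards [h, toL2_coe (genS κ 0 φ)] with x h1 h2
    rw [h1, h2, e]
  · rintro rfl
    filter_upwards [toL2_coe (genS κ 0 φ)] with x h2
    rw [h2, e]

/-- The orbits of a Schrödinger group are weak solutions. -/
theorem IsSchrodingerGroup.isWeakFlowOn {κ : ℝ} {U : ℝ → (L2 d ≃ₗᵢ[ℂ] L2 d)}
    (hU : IsSchrodingerGroup κ U) (u : L2 d) :
    IsWeakFlowOn (fun _ => κ) (fun _ => 0) Set.univ fun t => U t u := by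
  intro t _
  refine ⟨(hU.continuous u).continuousAt, fun φ => ?_⟩
  have hinv : ∀ r v, U r (U (-r) v) = v := fun r v => by
    rw [← hU.add, add_neg_cancel, hU.zero]
  obtain ⟨f', h1, h2⟩ := hU.generator φ
  rw [generator_eq_toL2_genS] at h1
  subst h1
  rw [← toL2_apply] at h2
  have h3 : HasDerivAt (fun r => U (t - r) (toL2 φ)) (-toL2 (genS κ 0 φ)) t := by
    have h4 : HasDerivAt (fun r : ℝ => t - r) (-1) t := by
      simpa using (hasDerivAt_id t).const_sub t
    have h5 := HasDerivAt.scomp (h := fun r : ℝ => t - r) t (by rw [sub_self]; exact h2) h4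
    rw [neg_one_smul] at h5
    exact h5
  have h6 := h3.inner ℂ (hasDerivAt_const t (U t u))
  rw [inner_zero_right, zero_add, inner_neg_left] at h6
  refine h6.congr_of_eventuallyEq (Eventually.of_forall fun r => ?_)
  change inner ℂ (toL2 φ) (U r u) = inner ℂ (U (t - r) (toL2 φ)) (U t u)
  rw [← (U (t - r)).inner_map_map (toL2 φ), ← hU.add, sub_add_cancel]

/-- A local group of isometries of `L²`. -/
theorem exists_local_group (κ : ℝ) :
    ∃ (T : ℝ → (L2 d ≃ₗᵢ[ℂ] L2 d)) (τ : ℝ), 0 < τ ∧ T 0 = 1 ∧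
      IsFlowOn (fun _ => κ) (fun _ => 0) (Set.Ioo (-τ) τ) T ∧
      ∀ s t, s ∈ Set.Ioo (-τ) τ → t ∈ Set.Ioo (-τ) τ → s + t ∈ Set.Ioo (-τ) τ →
        T (s + t) = T s * T t := by
  obtain ⟨T, τ, hτ, h0, hT⟩ := exists_local_flow (d := d) (continuous_const (y := κ)) 0
  rw [zero_sub, zero_add] at hT
  refine ⟨T, τ, hτ, h0, hT, fun s t hs ht hst => LinearIsometryEquiv.ext fun u => ?_⟩
  set I : Set ℝ := Set.Ioo (-τ) τ with hI
  set J : Set ℝ := I ∩ (fun r => r + t) ⁻¹' I with hJ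
  have hJo : IsOpen J := isOpen_Ioo.inter (isOpen_Ioo.preimage (by fun_prop))
  have hJp : IsPreconnected J := by
    have : J = I ∩ Set.Ioo (-τ - t) (τ - t) := by rw [hJ, hI, Set.preimage_add_const_Ioo]
    rw [this]
    exact (Set.ordConnected_Ioo.inter Set.ordConnected_Ioo).isPreconnected
  have hw : IsWeakFlowOn (fun _ => κ) (fun _ => 0) J fun r => T (r + t) u := by
    have h1 := hT.isWeakFlowOn isOpen_Ioo continuousOn_const continuousOn_const u
    intro r hr
    obtain ⟨h2, h3⟩ := h1 (r + t) hr.2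
    refine ⟨h2.comp (f := fun r => r + t) (by fun_prop), fun φ => ?_⟩
    exact (h3 φ).comp_add_const r t
  have h0I : (0 : ℝ) ∈ I := ⟨by linarith, hτ⟩
  have h3 := (hT.mono (Set.inter_subset_left : J ⊆ I)).eq_of_isWeakFlowOn hJo hJp hw (t₀ := 0)
    (t := s) ⟨h0I, by simpa using ht⟩ ⟨hs, hst⟩
  simp only [zero_add, h0] at h3
  rw [h3]
  rfl

/-- A unitary operator maps Schwartz functions to Schwartz functions. -/
def PreservesSchwartz (T : L2 d ≃ₗᵢ[ℂ] L2 d) : Prop := ∀ ψ, ∃ ψ', T (toL2 ψ) = toL2 ψ'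

theorem PreservesSchwartz.pow {T : L2 d ≃ₗᵢ[ℂ] L2 d} (hT : PreservesSchwartz T) (n : ℕ) :
    PreservesSchwartz (T ^ n) := by
  induction n with
  | zero => exact fun ψ => ⟨ψ, rfl⟩
  | succ n ih =>
    intro ψ
    obtain ⟨ψ', h1⟩ := hT ψ
    obtain ⟨ψ'', h2⟩ := ih ψ'
    refine ⟨ψ'', ?_⟩
    rw [pow_succ]
    change (T ^ n) (T (toL2 ψ)) = _
    rw [h1, h2]

/-- The group is `U(t) = T(t/N)^N` for a local group `T` and `N` so large that `t/N` lies in its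
domain. -/
theorem exists_group (κ : ℝ) :
    ∃ U : ℝ → (L2 d ≃ₗᵢ[ℂ] L2 d), IsSchrodingerGroup κ U ∧ ∀ t, PreservesSchwartz (U t) := by
  obtain ⟨T, τ, hτ, h0, hT, hadd⟩ := exists_local_group (d := d) κ
  have hmem : ∀ x, x ∈ Set.Ioo (-τ) τ ↔ |x| < τ := fun x => by rw [Set.mem_Ioo, abs_lt]
  have hpow : ∀ (m : ℕ) (x : ℝ), |m * x| < τ → T (m * x) = T x ^ m := by
    intro m x
    induction m with
    | zero => simp [h0]
    | succ m ih =>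
      intro hm
      have h1 : |(m : ℝ) * x| ≤ |((m + 1 : ℕ) : ℝ) * x| := by
        rw [abs_mul, abs_mul]
        gcongr
        exact Nat.le_succ m
      have h2 : |x| ≤ |((m + 1 : ℕ) : ℝ) * x| := by
        rw [abs_mul, Nat.abs_cast]
        have : (1 : ℝ) ≤ ((m + 1 : ℕ) : ℝ) := by exact_mod_cast Nat.le_add_left 1 m
        nlinarith [abs_nonneg x]
      have e : ((m + 1 : ℕ) : ℝ) * x = m * x + x := by push_cast; ring
      rw [e, hadd _ _ ((hmem _).2 (h1.trans_lt hm)) ((hmem _).2 (h2.trans_lt hm))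
        ((hmem _).2 (by rwa [← e])), ih (h1.trans_lt hm), pow_succ]
  -- the value of `T (t / n) ^ n` does not depend on `n`, as long as `|t| / n < τ`
  let N : ℝ → ℕ := fun t => ⌈|t| / τ⌉₊ + 1
  have hN : ∀ t, |t| < N t * τ := fun t => by
    have h1 := Nat.le_ceil (|t| / τ)
    rw [div_le_iff₀ hτ] at h1
    have : ((N t : ℕ) : ℝ) = ⌈|t| / τ⌉₊ + 1 := by simp [N]
    rw [this]
    nlinarith
  have hNpos : ∀ t, 0 < N t := fun t => Nat.succ_pos _
  have hdiv : ∀ (t : ℝ) (n : ℕ), |t| < n * τ → 0 < n → |t / n| < τ := fun t n h hn => by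
    have : (0 : ℝ) < n := by exact_mod_cast hn
    rw [abs_div, Nat.abs_cast, div_lt_iff₀ this]
    linarith
  have hindep : ∀ (t : ℝ) (n m : ℕ), 0 < n → 0 < m → |t| < n * τ → |t| < m * τ →
      T (t / n) ^ n = T (t / m) ^ m := by
    have key : ∀ (t : ℝ) (n m : ℕ), 0 < n → 0 < m → |t| < n * τ →
        T (t / n) ^ n = T (t / (n * m)) ^ (m * n) := by
      intro t n m hn hm h
      have hn' : (n : ℝ) ≠ 0 := by exact_mod_cast hn.ne'
      have hm' : (m : ℝ) ≠ 0 := by exact_mod_cast hm.ne'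
      have e : t / n = m * (t / (n * m)) := by field_simp
      have h1 := hdiv t n h hn
      rw [e] at h1
      rw [e, hpow m _ h1, pow_mul]
    intro t n m hn hm h1 h2
    rw [key t n m hn hm h1, key t m n hm hn h2, mul_comm (n : ℝ), mul_comm n]
  let U : ℝ → (L2 d ≃ₗᵢ[ℂ] L2 d) := fun t => T (t / N t) ^ N t
  have hU : ∀ (t : ℝ) (n : ℕ), 0 < n → |t| < n * τ → U t = T (t / n) ^ n := fun t n hn h =>
    hindep t _ _ (hNpos t) hn (hN t) h
  have hU1 : ∀ t, |t| < τ → U t = T t := fun t ht => by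
    rw [hU t 1 one_pos (by simpa using ht)]
    simp
  have hUadd : ∀ s t, U (s + t) = U s * U t := by
    intro s t
    have h1 := hN s
    have h2 := hN t
    set n := N s + N t with hn
    have hn0 : 0 < n := by have := hNpos s; omega
    have hcast : (n : ℝ) * τ = N s * τ + N t * τ := by rw [hn]; push_cast; ring
    have hst : |s + t| < n * τ := by
      rw [hcast]; linarith [abs_add_le s t]
    have hs : |s| < n * τ := by rw [hcast]; linarith [abs_nonneg t]
    have ht : |t| < n * τ := by rw [hcast]; linarith [abs_nonneg s]
    have hs1 := (hmem _).2 (hdiv s n hs hn0)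
    have ht1 := (hmem _).2 (hdiv t n ht hn0)
    have hst1 := (hmem _).2 (hdiv (s + t) n hst hn0)
    rw [add_div] at hst1
    have hcomm : Commute (T (s / n)) (T (t / n)) := by
      rw [Commute, SemiconjBy, ← hadd _ _ hs1 ht1 hst1, add_comm,
          hadd _ _ ht1 hs1 (by rwa [add_comm])]
    rw [hU _ n hn0 hst, hU s n hn0 hs, hU t n hn0 ht, add_div, hadd _ _ hs1 ht1 hst1,
      hcomm.mul_pow]
  have h0mem : (0 : ℝ) ∈ Set.Ioo (-τ) τ := ⟨by linarith, hτ⟩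
  have hev : ∀ᶠ t in 𝓝 (0 : ℝ), U t = T t := by
    filter_upwards [isOpen_Ioo.mem_nhds h0mem] with t ht using hU1 t ((hmem t).1 ht)
  refine ⟨U, ⟨fun f => ?_, fun s t f => ?_, fun f => ?_, fun φ => ?_⟩, fun t => ?_⟩
  · rw [hU1 0 (by simpa using hτ), h0]
    rfl
  · rw [hUadd]
    rfl
  · rw [continuous_iff_continuousAt]
    intro t
    have h1 : ContinuousAt (fun r => U r f) 0 :=
      (hT.continuousAt f h0mem).congr (hev.mono fun r hr => by simp only [hr])
    have h2 : (fun r => U r f) = fun r => U t (U (r - t) f) := by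
      funext r
      conv_lhs => rw [show r = t + (r - t) by ring, hUadd]
      rfl
    rw [h2]
    refine (U t).continuous.continuousAt.comp ?_
    refine ContinuousAt.comp (f := fun r => r - t) (g := fun r => U r f) ?_ (by fun_prop)
    rwa [sub_self]
  · obtain ⟨y, h1, h2⟩ := hT φ
    refine ⟨toL2 (genS κ 0 φ), (generator_eq_toL2_genS κ φ _).2 rfl, ?_⟩
    have h3 := h2 0 h0mem
    have h4 : y 0 = φ := toL2_injective (by rw [← h1 0, h0]; rfl)
    rw [h4] at h3
    refine HasDerivAt.congr_of_eventuallyEq h3 ?_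
    filter_upwards [hev] with r hr
    rw [hr, ← toL2_apply, h1]
  · refine PreservesSchwartz.pow (fun ψ => ?_) _
    obtain ⟨y, h1, -⟩ := hT ψ
    exact ⟨_, h1 _⟩

/-- A Schrödinger group which preserves the Schwartz space solves the equation strongly there. -/
theorem IsSchrodingerGroup.isFlowOn {κ : ℝ} {U : ℝ → (L2 d ≃ₗᵢ[ℂ] L2 d)}
    (hU : IsSchrodingerGroup κ U) (hS : ∀ t, PreservesSchwartz (U t)) :
    IsFlowOn (fun _ => κ) (fun _ => 0) Set.univ U := by
  intro ψ
  choose y hy using fun t => hS t ψ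
  refine ⟨y, hy, fun t _ => ?_⟩
  obtain ⟨f', h1, h2⟩ := hU.generator (y t)
  rw [generator_eq_toL2_genS] at h1
  subst h1
  have h3 := HasDerivAt.comp_sub_const t t (by rw [sub_self]; exact h2)
  refine HasDerivAt.congr_of_eventuallyEq h3 (Eventually.of_forall fun r => ?_)
  change toL2 (y r) = U (r - t) (toL2 (y t))
  rw [← hy, ← hy, ← hU.add, sub_add_cancel]

/-- Existence and uniqueness of the group generated by `(i/2)(Δ - κ|x|²)`. -/
theorem existsUnique_isSchrodingerGroup (κ : ℝ) :
    ∃! U : ℝ → (L2 d ≃ₗᵢ[ℂ] L2 d), IsSchrodingerGroup κ U := by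
  obtain ⟨U, hU, hS⟩ := exists_group (d := d) κ
  refine ⟨U, hU, fun U' hU' => ?_⟩
  funext t
  refine LinearIsometryEquiv.ext fun u => ?_
  have h := (hU.isFlowOn hS).eq_of_isWeakFlowOn isOpen_univ isPreconnected_univ
    (hU'.isWeakFlowOn u) (t₀ := 0) (t := t) (Set.mem_univ _) (Set.mem_univ _)
  rw [h, hU'.zero]
  congr 1
  rw [LinearIsometryEquiv.symm_apply_eq, hU.zero]

theorem isSchrodingerGroup_propagator (κ : ℝ) :
    IsSchrodingerGroup κ (propagator κ : ℝ → (L2 d ≃ₗᵢ[ℂ] L2 d)) :=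
  @Classical.epsilon_spec_aux _ _ (IsSchrodingerGroup κ) (existsUnique_isSchrodingerGroup κ).exists

theorem preservesSchwartz_propagator (κ t : ℝ) :
    PreservesSchwartz (propagator κ t : L2 d ≃ₗᵢ[ℂ] L2 d) := by
  obtain ⟨U, hU, hS⟩ := exists_group (d := d) κ
  rw [(existsUnique_isSchrodingerGroup κ).unique (isSchrodingerGroup_propagator κ) hU]
  exact hS t

theorem isFlowOn_propagator (κ : ℝ) :
    IsFlowOn (fun _ => κ) (fun _ => 0) Set.univ
      (propagator κ : ℝ → (L2 d ≃ₗᵢ[ℂ] L2 d)) :=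
  (isSchrodingerGroup_propagator κ).isFlowOn (preservesSchwartz_propagator κ)

/-! ### Galilean covariance -/

/-- Multiplication by the constant phase `exp(iθ)`. -/
def scalarU (θ : ℝ) : L2 d ≃ₗᵢ[ℂ] L2 d := phase (fun _ => θ) continuous_const

theorem scalarU_apply (θ : ℝ) (u : L2 d) :
    scalarU θ u = Complex.exp ((θ : ℂ) * Complex.I) • u := by
  apply Lp.ext
  filter_upwards [phase_coe (fun _ : Space d => θ) continuous_const u,
    Lp.coeFn_smul (Complex.exp ((θ : ℂ) * Complex.I)) u] with x h1 h2
  rw [scalarU, h1, h2, Pi.smul_apply, smul_eq_mul]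

theorem HasSDerivAt.scalar {y : ℝ → 𝓢(Space d, ℂ)} {y' : 𝓢(Space d, ℂ)} {t : ℝ}
    (hy : HasSDerivAt y y' t) {θ : ℝ → ℝ} {θ' : ℝ} (hθ : HasDerivAt θ θ' t) :
    HasSDerivAt (fun s => Complex.exp ((θ s : ℂ) * Complex.I) • y s)
      (Complex.exp ((θ t : ℂ) * Complex.I) • (y' + (Complex.I * θ') • y t)) t := by
  have h1 : HasDerivAt (fun s => Complex.exp ((θ s : ℂ) * Complex.I)) _ t :=
    (hθ.ofReal_comp.mul_const Complex.I).cexp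
  have h2 := h1.smul hy
  unfold HasSDerivAt
  simp only [map_smul, map_add] at h2 ⊢
  refine h2.congr_deriv ?_
  module

/-- Weyl translation of a solution along a curve `(q, q')` changes the linear potential. -/
theorem hasSDerivAt_weyl_flow {y : ℝ → 𝓢(Space d, ℂ)} {k t : ℝ}
    (hy : HasSDerivAt y (genS k 0 (y t)) t)
    {q p : ℝ → Space d} {F : Space d} (hq : HasDerivAt q (p t) t) (hp : HasDerivAt p F t) :
    HasSDerivAt (fun s => weylS (q s) (p s) (y s))
      (genS k (F + k • q t) (weylS (q t) (p t) (y t)) -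
        (Complex.I * ((inner ℝ (q t) F + k * ‖q t‖ ^ 2) / 2 : ℝ)) • weylS (q t) (p t) (y t)) t := by
  refine (hy.weyl hq hp).congr_deriv ?_
  set z := weylS (q t) (p t) (y t) with hz
  have hlin : ∀ (c : ℂ) (φ : 𝓢(Space d, ℂ)), weylS (q t) (p t) (c • φ) =
      c • weylS (q t) (p t) φ := fun c φ => by simp only [weylS, map_smul]
  have hadd : ∀ (φ ψ : 𝓢(Space d, ℂ)), weylS (q t) (p t) (φ + ψ) =
      weylS (q t) (p t) φ + weylS (q t) (p t) ψ := fun φ ψ => by simp only [weylS, map_add]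
  have hsum : ∀ (φ : Fin d → 𝓢(Space d, ℂ)), weylS (q t) (p t) (∑ j, φ j) =
      ∑ j, weylS (q t) (p t) (φ j) := fun φ => by simp only [weylS, map_sum]
  have e0 : ∀ ψ : 𝓢(Space d, ℂ), posS (0 : Space d) ψ = 0 := fun ψ => by ext x; simp [posS_apply]
  have ein : ∀ v w : Space d, ((inner ℝ v w : ℝ) : ℂ) = ∑ j, (v j : ℂ) * (w j : ℂ) := fun v w => by
    rw [PiLp.inner_apply]
    push_cast
    exact Finset.sum_congr rfl fun j _ => by simp; ring
  have enorm : ((‖q t‖ ^ 2 : ℝ) : ℂ) = ∑ j, (q t j : ℂ) * (q t j : ℂ) := by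
    rw [← ein, real_inner_self_eq_norm_sq]
  have h1 : weylS (q t) (p t) (genS k 0 (y t)) = (-(Complex.I / 2)) • ∑ j,
      ((momS (basisVec j) (momS (basisVec j) z - (p t j : ℂ) • z) -
        (p t j : ℂ) • (momS (basisVec j) z - (p t j : ℂ) • z)) +
      (k : ℂ) • (posS (basisVec j) (posS (basisVec j) z - (q t j : ℂ) • z) -
        (q t j : ℂ) • (posS (basisVec j) z - (q t j : ℂ) • z))) := by
    rw [genS, e0, smul_zero, sub_zero, hlin, hadd, hlin, sqMomS_eq, sqPosS_eq, hsum, hsum,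
      Finset.smul_sum, ← Finset.sum_add_distrib]
    simp only [momS_weylS, posS_weylS, inner_basisVec, ← hz]
  rw [h1, genS, sqMomS_eq, sqPosS_eq, posS_eq_sum F, posS_eq_sum (F + _),
    momS_eq_sum (p t) z]
  have hc1 : (((inner ℝ (p t) (p t) - inner ℝ (q t) F) / 2 : ℝ) : ℂ) =
      ∑ j, ((p t j : ℂ) * (p t j : ℂ) - (q t j : ℂ) * (F j : ℂ)) / 2 := by
    push_cast
    rw [ein, ein, ← Finset.sum_sub_distrib, Finset.sum_div]
  have hc2 : (Complex.I * ((inner ℝ (q t) F + k * ‖q t‖ ^ 2) / 2 : ℝ)) =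
      ∑ j, Complex.I * (((q t j : ℂ) * (F j : ℂ) + k * ((q t j : ℂ) * (q t j : ℂ))) / 2) := by
    have : (((inner ℝ (q t) F + k * ‖q t‖ ^ 2) / 2 : ℝ) : ℂ) =
        (((inner ℝ (q t) F : ℝ) : ℂ) + k * ((‖q t‖ ^ 2 : ℝ) : ℂ)) / 2 := by push_cast; ring
    rw [this, enorm, ein, Finset.mul_sum, ← Finset.sum_add_distrib, Finset.sum_div, Finset.mul_sum]
  rw [hc1, hc2]
  simp only [Finset.smul_sum, Finset.sum_smul, ← Finset.sum_add_distrib, ← Finset.sum_sub_distrib]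
  refine Finset.sum_congr rfl fun j _ => ?_
  simp only [map_sub, map_smul, PiLp.add_apply, PiLp.smul_apply, smul_eq_mul]
  push_cast
  match_scalars <;> ring

/-- The propagator in a moving frame: Weyl translation along `(q, q')` and multiplication by a
scalar phase turn a flow of the harmonic oscillator into a flow with a linear potential. -/
theorem IsFlowOn.weyl {k : ℝ → ℝ} {s : Set ℝ} {T : ℝ → (L2 d ≃ₗᵢ[ℂ] L2 d)}
    (hT : IsFlowOn k (fun _ => 0) s T) {q p F : ℝ → Space d} {θ : ℝ → ℝ}
    (hq : ∀ t ∈ s, HasDerivAt q (p t) t) (hp : ∀ t ∈ s, HasDerivAt p (F t) t)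
    (hθ : ∀ t ∈ s, HasDerivAt θ ((inner ℝ (q t) (F t) + k t * ‖q t‖ ^ 2) / 2) t) :
    IsFlowOn k (fun t => F t + k t • q t) s
      (fun t => ((T t).trans (NonlocalSchrodinger.weyl (q t) (p t))).trans (scalarU (θ t))) := by
  intro ψ
  obtain ⟨y, h1, h2⟩ := hT ψ
  refine ⟨fun t => Complex.exp ((θ t : ℂ) * Complex.I) • weylS (q t) (p t) (y t), fun t => ?_,
    fun t ht => ?_⟩
  · simp only [LinearIsometryEquiv.trans_apply, h1, weyl_toL2, scalarU_apply, map_smul]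
  · refine ((hasSDerivAt_weyl_flow (h2 t ht) (hq t ht) (hp t ht)).scalar (hθ t ht)).congr_deriv ?_
    rw [sub_add_cancel]
    simp only [genS, map_smul]
    module

/-- Galilean covariance of the propagator of the harmonic oscillator. -/
theorem weyl_propagator (κ t : ℝ) (a b : Space d) (u : L2 d) :
    weyl (gSol κ t a b) (gSol' κ t a b) (propagator κ t u) = propagator κ t (weyl b a u) := by
  have hT := (isFlowOn_propagator (d := d) κ).weyl (q := fun t => gSol κ t a b)
    (p := fun t => gSol' κ t a b) (F := fun t => -κ • gSol κ t a b) (θ := fun _ => 0)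
    (fun t _ => hasDerivAt_gSol κ t a b) (fun t _ => hasDerivAt_gSol' κ t a b) (fun t _ => by
      have : (inner ℝ (gSol κ t a b) (-κ • gSol κ t a b) + κ * ‖gSol κ t a b‖ ^ 2) / 2 = 0 := by
        rw [inner_smul_right, real_inner_self_eq_norm_sq]; ring
      rw [this]
      exact hasDerivAt_const t _)
  have e : (fun t => -κ • gSol κ t a b + κ • gSol κ t a b) = fun _ => (0 : Space d) := by
    funext t; rw [neg_smul, neg_add_cancel]
  rw [e] at hT
  have hw := hT.isWeakFlowOn isOpen_univ continuousOn_const continuousOn_const u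
  have h := (isFlowOn_propagator (d := d) κ).eq_of_isWeakFlowOn isOpen_univ isPreconnected_univ hw
    (t₀ := 0) (t := t) (Set.mem_univ _) (Set.mem_univ _)
  have h0 : ∀ v : L2 d, propagator κ 0 v = v := (isSchrodingerGroup_propagator κ).zero
  have h0' : ∀ v : L2 d, (propagator κ 0).symm v = v := fun v => by
    rw [LinearIsometryEquiv.symm_apply_eq, h0]
  simp only [LinearIsometryEquiv.trans_apply, scalarU_apply, Complex.ofReal_zero, zero_mul,
    Complex.exp_zero, one_smul, gSol_zero, gSol'_zero, h0, h0'] at h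
  exact h

/-! ### The scalar fundamental solutions of `g'' = -κ g` -/

/-- The solution of `c'' = -κ c`, `c(0) = 1`, `c'(0) = 0`. -/
def cosK (κ t : ℝ) : ℝ :=
  if 0 < κ then Real.cos (√κ * t) else if κ < 0 then Real.cosh (√(-κ) * t) else 1

/-- The solution of `s'' = -κ s`, `s(0) = 0`, `s'(0) = 1`. -/
def sinK (κ t : ℝ) : ℝ :=
  if 0 < κ then Real.sin (√κ * t) / √κ else if κ < 0 then Real.sinh (√(-κ) * t) / √(-κ) else t

theorem gSol_eq (κ t : ℝ) (a b : Space d) : gSol κ t a b = cosK κ t • b + sinK κ t • a := by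
  unfold gSol cosK sinK
  split_ifs <;> simp

theorem gSol'_eq (κ t : ℝ) (a b : Space d) :
    gSol' κ t a b = cosK κ t • a - (κ * sinK κ t) • b := by
  unfold gSol' cosK sinK
  split_ifs with h1 h2
  · have hk : √κ ≠ 0 := (Real.sqrt_pos.2 h1).ne'
    have hs : √κ * √κ = κ := Real.mul_self_sqrt h1.le
    congr 2
    field_simp
    linear_combination Real.sin (√κ * t) * hs
  · have hk : √(-κ) ≠ 0 := (Real.sqrt_pos.2 (by linarith)).ne'
    have hs : √(-κ) * √(-κ) = -κ := Real.mul_self_sqrt (by linarith)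
    rw [sub_eq_add_neg, ← neg_smul]
    congr 2
    field_simp
    linear_combination Real.sinh (√(-κ) * t) * hs
  · have : κ = 0 := le_antisymm (not_lt.1 h1) (not_lt.1 h2)
    simp [this]

theorem cosK_zero (κ : ℝ) : cosK κ 0 = 1 := by unfold cosK; split_ifs <;> simp

theorem sinK_zero (κ : ℝ) : sinK κ 0 = 0 := by unfold sinK; split_ifs <;> simp

theorem hasDerivAt_sinK (κ t : ℝ) : HasDerivAt (sinK κ) (cosK κ t) t := by
  have h := (hasDerivAt_gSol κ t (basisVec (0 : Fin 1)) 0)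
  have h2 := ((EuclideanSpace.proj (0 : Fin 1) : Space 1 →L[ℝ] ℝ).hasFDerivAt).comp_hasDerivAt t h
  have e : (⇑(EuclideanSpace.proj (0 : Fin 1) : Space 1 →L[ℝ] ℝ) ∘
      fun s => gSol κ s (basisVec (0 : Fin 1)) 0) = sinK κ := by
    funext s; simp [gSol_eq, basisVec]
  rw [e] at h2
  refine h2.congr_deriv ?_
  simp [gSol'_eq, basisVec]

theorem hasDerivAt_cosK (κ t : ℝ) : HasDerivAt (cosK κ) (-(κ * sinK κ t)) t := by
  have h := (hasDerivAt_gSol κ t 0 (basisVec (0 : Fin 1)))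
  have h2 := ((EuclideanSpace.proj (0 : Fin 1) : Space 1 →L[ℝ] ℝ).hasFDerivAt).comp_hasDerivAt t h
  have e : (⇑(EuclideanSpace.proj (0 : Fin 1) : Space 1 →L[ℝ] ℝ) ∘
      fun s => gSol κ s 0 (basisVec (0 : Fin 1))) = cosK κ := by
    funext s; simp [gSol_eq, basisVec]
  rw [e] at h2
  refine h2.congr_deriv ?_
  simp [gSol'_eq, basisVec]

theorem cosK_sq_add (κ t : ℝ) : cosK κ t ^ 2 + κ * sinK κ t ^ 2 = 1 := by
  have h : ∀ r, HasDerivAt (fun r => cosK κ r ^ 2 + κ * sinK κ r ^ 2) 0 r := fun r => by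
    refine (((hasDerivAt_cosK κ r).pow 2).add
      (((hasDerivAt_sinK κ r).pow 2).const_mul κ)).congr_deriv ?_
    simp
    ring
  have := is_const_of_deriv_eq_zero (fun r => (h r).differentiableAt) (fun r => (h r).deriv) t 0
  simpa [cosK_zero, sinK_zero] using this

theorem abs_cosK_le {κ t R T : ℝ} (hκ : |κ| ≤ R) (ht : |t| ≤ T) :
    |cosK κ t| ≤ Real.cosh (√R * T) := by
  have hR : 0 ≤ R := (abs_nonneg κ).trans hκ
  have hT : 0 ≤ T := (abs_nonneg t).trans ht
  unfold cosK
  split_ifs with h1 h2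
  · exact (Real.abs_cos_le_one _).trans (Real.one_le_cosh _)
  · rw [abs_of_pos (Real.cosh_pos _), Real.cosh_le_cosh, abs_mul, abs_mul,
        abs_of_nonneg (Real.sqrt_nonneg _),
      abs_of_nonneg (Real.sqrt_nonneg _), abs_of_nonneg hT]
    have : -κ ≤ R := (neg_le_abs κ).trans hκ
    gcongr
  · simp

theorem abs_sinK_le {κ t R T : ℝ} (hκ : |κ| ≤ R) (ht : |t| ≤ T) :
    |sinK κ t| ≤ Real.cosh (√R * T) * T := by
  have hT : 0 ≤ T := (abs_nonneg t).trans ht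
  have h := (convex_Icc (-T) T).norm_image_sub_le_of_norm_hasDerivWithin_le (f := sinK κ)
    (f' := cosK κ) (C := Real.cosh (√R * T)) (x := 0) (y := t)
    (fun x _ => (hasDerivAt_sinK κ x).hasDerivWithinAt)
    (fun x hx => abs_cosK_le hκ (abs_le.2 hx)) ⟨by linarith, hT⟩ (abs_le.1 ht)
  rw [sinK_zero, sub_zero, sub_zero, Real.norm_eq_abs, Real.norm_eq_abs] at h
  exact h.trans (by gcongr)

/-- A common bound for the fundamental solutions. -/
theorem exists_bound_cosK_sinK (R T : ℝ) :
    ∃ B, 0 ≤ B ∧ ∀ κ t, |κ| ≤ R → |t| ≤ T → |cosK κ t| ≤ B ∧ |sinK κ t| ≤ B := by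
  refine ⟨Real.cosh (√R * T) * (1 + |T|), by positivity, fun κ t hκ ht => ?_⟩
  have h1 := abs_cosK_le hκ ht
  have h2 := abs_sinK_le hκ ht
  have h3 := Real.cosh_pos (√R * T)
  have h4 := le_abs_self T
  constructor <;> nlinarith [abs_nonneg T]

/-- Lipschitz dependence of the fundamental solutions on `κ`. -/
theorem exists_lipschitz_cosK_sinK (R T : ℝ) :
    ∃ C, 0 ≤ C ∧ ∀ κ κ' t, |κ| ≤ R → |κ'| ≤ R → |t| ≤ T →
      |cosK κ t - cosK κ' t| ≤ C * |κ - κ'| ∧ |sinK κ t - sinK κ' t| ≤ C * |κ - κ'| := by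
  obtain ⟨B, hB0, hB⟩ := exists_bound_cosK_sinK R T
  refine ⟨B * B * |T|, by positivity, fun κ κ' t hκ hκ' ht => ?_⟩
  have hsub : ∀ s : ℝ, HasDerivAt (fun s => t - s) (-1) s := fun s => by
    simpa using (hasDerivAt_id s).const_sub t
  have hs : ∀ s, HasDerivAt (fun s => sinK κ' (t - s)) (-cosK κ' (t - s)) s := fun s => by
    simpa [Function.comp_def] using (hasDerivAt_sinK κ' (t - s)).comp s (hsub s)
  have hc : ∀ s, HasDerivAt (fun s => cosK κ' (t - s)) (κ' * sinK κ' (t - s)) s := fun s => by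
    simpa [Function.comp_def] using (hasDerivAt_cosK κ' (t - s)).comp s (hsub s)
  have hin : ∀ s ∈ Set.uIcc 0 t, |s| ≤ T ∧ |t - s| ≤ T := fun s hs => by
    rcases Set.mem_uIcc.1 hs with h | h
    · rw [abs_of_nonneg h.1, abs_of_nonneg (sub_nonneg.2 h.2)]
      rw [abs_of_nonneg (h.1.trans h.2)] at ht
      constructor <;> linarith
    · rw [abs_of_nonpos h.2, abs_of_nonpos (sub_nonpos.2 h.1)]
      rw [abs_of_nonpos (h.1.trans h.2)] at ht
      constructor <;> linarith
  have htT : |t - 0| ≤ |T| := by rw [sub_zero]; exact ht.trans (le_abs_self T)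
  constructor
  · have hd : ∀ s, HasDerivAt (fun s => cosK κ' (t - s) * cosK κ s -
        κ' * (sinK κ' (t - s) * sinK κ s))
        ((κ' - κ) * (cosK κ' (t - s) * sinK κ s)) s := fun s => by
      refine (((hc s).mul (hasDerivAt_cosK κ s)).sub
        (((hs s).mul (hasDerivAt_sinK κ s)).const_mul κ')).congr_deriv ?_
      ring
    have h := (convex_uIcc 0 t).norm_image_sub_le_of_norm_hasDerivWithin_le
      (C := |κ - κ'| * (B * B)) (fun s _ => (hd s).hasDerivWithinAt) (fun s hs => ?_)
      Set.left_mem_uIcc Set.right_mem_uIcc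
    · simp only [sub_self, cosK_zero, sinK_zero, sub_zero, one_mul, mul_one, zero_mul, mul_zero,
        Real.norm_eq_abs] at h
      refine h.trans ?_
      rw [sub_zero] at htT
      nlinarith [mul_le_mul_of_nonneg_left htT (by positivity : 0 ≤ |κ - κ'| * (B * B))]
    · rw [Real.norm_eq_abs, abs_mul, abs_sub_comm, abs_mul]
      have h1 := (hB κ' (t - s) hκ' (hin s hs).2).1
      have h2 := (hB κ s hκ (hin s hs).1).2
      gcongr
  · have hd : ∀ s, HasDerivAt (fun s => sinK κ' (t - s) * cosK κ s + cosK κ' (t - s) * sinK κ s)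
        ((κ' - κ) * (sinK κ' (t - s) * sinK κ s)) s := fun s => by
      refine (((hs s).mul (hasDerivAt_cosK κ s)).add
        ((hc s).mul (hasDerivAt_sinK κ s))).congr_deriv ?_
      ring
    have h := (convex_uIcc 0 t).norm_image_sub_le_of_norm_hasDerivWithin_le
      (C := |κ - κ'| * (B * B)) (fun s _ => (hd s).hasDerivWithinAt) (fun s hs => ?_)
      Set.left_mem_uIcc Set.right_mem_uIcc
    · simp only [sub_self, cosK_zero, sinK_zero, sub_zero, one_mul, mul_one, zero_mul, mul_zero,
        zero_add, add_zero, Real.norm_eq_abs] at h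
      refine h.trans ?_
      rw [sub_zero] at htT
      nlinarith [mul_le_mul_of_nonneg_left htT (by positivity : 0 ≤ |κ - κ'| * (B * B))]
    · rw [Real.norm_eq_abs, abs_mul, abs_sub_comm, abs_mul]
      have h1 := (hB κ' (t - s) hκ' (hin s hs).2).2
      have h2 := (hB κ s hκ (hin s hs).1).2
      gcongr

theorem tendsto_cosK_sinK {ι : Type*} {l : Filter ι} {κ t : ι → ℝ} {κ₀ t₀ : ℝ}
    (hκ : Tendsto κ l (𝓝 κ₀)) (ht : Tendsto t l (𝓝 t₀)) :
    Tendsto (fun n => cosK (κ n) (t n)) l (𝓝 (cosK κ₀ t₀)) ∧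
      Tendsto (fun n => sinK (κ n) (t n)) l (𝓝 (sinK κ₀ t₀)) := by
  obtain ⟨C, hC0, hC⟩ := exists_lipschitz_cosK_sinK (|κ₀| + 1) (|t₀| + 1)
  have h1 : ∀ᶠ n in l, |κ n| ≤ |κ₀| + 1 :=
    (hκ.abs.eventually_lt_const (lt_add_one _)).mono fun _ h => h.le
  have h2 : ∀ᶠ n in l, |t n| ≤ |t₀| + 1 :=
    (ht.abs.eventually_lt_const (lt_add_one _)).mono fun _ h => h.le
  have h3 : Tendsto (fun n => C * |κ n - κ₀|) l (𝓝 0) := by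
    simpa using ((hκ.sub_const κ₀).abs.const_mul C)
  have hlim : ∀ f : ℝ → ℝ → ℝ, (∀ n, |κ n| ≤ |κ₀| + 1 → |t n| ≤ |t₀| + 1 →
      |f (κ n) (t n) - f κ₀ (t n)| ≤ C * |κ n - κ₀|) → Continuous (f κ₀) →
      Tendsto (fun n => f (κ n) (t n)) l (𝓝 (f κ₀ t₀)) := by
    intro f hf hfc
    have h4 : Tendsto (fun n => f (κ n) (t n) - f κ₀ (t n)) l (𝓝 0) :=
      squeeze_zero_norm' (by filter_upwards [h1, h2] with n a b using hf n a b) h3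
    simpa using h4.add ((hfc.tendsto t₀).comp ht)
  have hκ0 : |κ₀| ≤ |κ₀| + 1 := by linarith
  exact ⟨hlim cosK (fun n a b => (hC _ _ _ a hκ0 b).1)
      (continuous_iff_continuousAt.2 fun r => (hasDerivAt_cosK κ₀ r).continuousAt),
    hlim sinK (fun n a b => (hC _ _ _ a hκ0 b).2)
      (continuous_iff_continuousAt.2 fun r => (hasDerivAt_sinK κ₀ r).continuousAt)⟩

/-! ### Continuity of the propagator in the frequency -/

theorem weylS_zero (ψ : 𝓢(Space d, ℂ)) : weylS 0 0 ψ = ψ := by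
  apply toL2_injective
  rw [← weyl_toL2, weyl_zero]
  rfl

/-- The infinitesimal Weyl operators: `ε ↦ W(εq, εp)ψ` has the derivative `i(x·p - q·D)ψ` at `0`. -/
theorem hasDerivAt_weyl_toL2 (q p : Space d) (ψ : 𝓢(Space d, ℂ)) :
    HasDerivAt (fun ε : ℝ => weyl (ε • q) (ε • p) (toL2 ψ))
      (toL2 (Complex.I • (posS p ψ - momS q ψ))) 0 := by
  have hq : HasDerivAt (fun ε : ℝ => ε • q) q 0 := by
    simpa using (hasDerivAt_id (0 : ℝ)).smul_const q
  have hp : HasDerivAt (fun ε : ℝ => ε • p) p 0 := by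
    simpa using (hasDerivAt_id (0 : ℝ)).smul_const p
  have h : HasDerivAt _ _ _ := (hasSDerivAt_const ψ 0).weyl hq hp
  simp only [weyl_toL2]
  refine h.congr_deriv ?_
  have h0 : weylS (0 : Space d) 0 (0 : 𝓢(Space d, ℂ)) = 0 := weylS_zero 0
  simp only [zero_smul, weylS_zero, h0, inner_zero_left, inner_zero_right]
  simp

theorem gSol_smul (κ t ε : ℝ) (a b : Space d) :
    gSol κ t (ε • a) (ε • b) = ε • gSol κ t a b := by
  simp only [gSol_eq]; module

theorem gSol'_smul (κ t ε : ℝ) (a b : Space d) :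
    gSol' κ t (ε • a) (ε • b) = ε • gSol' κ t a b := by
  simp only [gSol'_eq]; module

/-- The initial data of the classical trajectory which passes through `(q, p)` at time `t`. -/
theorem gSol_backward (κ t : ℝ) (q p : Space d) :
    gSol κ t (cosK κ t • p + (κ * sinK κ t) • q) (cosK κ t • q - sinK κ t • p) = q ∧
      gSol' κ t (cosK κ t • p + (κ * sinK κ t) • q) (cosK κ t • q - sinK κ t • p) = p := by
  have h := cosK_sq_add κ t
  rw [gSol_eq, gSol'_eq]
  constructor
  · calc _ = (cosK κ t ^ 2 + κ * sinK κ t ^ 2) • q := by module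
      _ = q := by rw [h, one_smul]
  · calc _ = (cosK κ t ^ 2 + κ * sinK κ t ^ 2) • p := by module
      _ = p := by rw [h, one_smul]

/-- Galilean covariance, with the Weyl operator given at time `t`. -/
theorem weyl_propagator_backward (κ t : ℝ) (q p : Space d) (u : L2 d) :
    weyl q p (propagator κ t u) = propagator κ t
      (weyl (cosK κ t • q - sinK κ t • p) (cosK κ t • p + (κ * sinK κ t) • q) u) := by
  have h := weyl_propagator κ t (cosK κ t • p + (κ * sinK κ t) • q)
    (cosK κ t • q - sinK κ t • p) u
  rwa [(gSol_backward κ t q p).1, (gSol_backward κ t q p).2] at h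

/-- Egorov's theorem for the position operator, on Schwartz functions. -/
theorem posS_propagator {κ t : ℝ} {φ ψ : 𝓢(Space d, ℂ)}
    (h : propagator κ t (toL2 ψ) = toL2 φ) (v : Space d) :
    toL2 (posS v φ) = propagator κ t
      (toL2 ((cosK κ t : ℂ) • posS v ψ + (sinK κ t : ℂ) • momS v ψ)) := by
  have h1 := hasDerivAt_weyl_toL2 0 v φ
  have h2 := hasDerivAt_isometry_apply (T := fun _ => propagator κ t)
    (hasDerivAt_weyl_toL2 (-sinK κ t • v) (cosK κ t • v) ψ) (hasDerivAt_const _ _)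
    tendsto_const_nhds
  have e : (fun ε : ℝ => weyl (ε • (0 : Space d)) (ε • v) (toL2 φ)) = fun ε : ℝ =>
      propagator κ t (weyl (ε • -sinK κ t • v) (ε • cosK κ t • v) (toL2 ψ)) := by
    funext ε
    rw [← h, weyl_propagator_backward]
    congr 3 <;> module
  rw [e] at h1
  have h3 := h1.unique h2
  have e0 : ∀ χ : 𝓢(Space d, ℂ), momS (0 : Space d) χ = 0 := fun χ => by ext x; simp [momS_apply]
  have emom : momS (-sinK κ t • v) ψ = (-sinK κ t : ℂ) • momS v ψ := by
    ext x; simp [momS_apply]; ring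
  have epos : posS (cosK κ t • v) ψ = (cosK κ t : ℂ) • posS v ψ := by
    ext x; simp [posS_apply, inner_smul_right]; ring
  rw [e0, sub_zero, emom, epos, add_zero, map_smul, map_smul, map_smul, neg_smul,
    sub_neg_eq_add] at h3
  exact (smul_right_injective _ Complex.I_ne_zero) h3

theorem exists_bound_sqPosS_propagator (κ T : ℝ) (ψ : 𝓢(Space d, ℂ)) :
    ∃ C, 0 ≤ C ∧ ∀ t φ, |t| ≤ T → propagator κ t (toL2 ψ) = toL2 φ → ‖toL2 (sqPosS φ)‖ ≤ C := by
  obtain ⟨B, hB0, hB⟩ := exists_bound_cosK_sinK |κ| T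
  refine ⟨∑ j : Fin d, (B * B * ‖toL2 (posS (basisVec j) (posS (basisVec j) ψ))‖ +
    B * B * ‖toL2 (posS (basisVec j) (momS (basisVec j) ψ))‖ +
    B * B * ‖toL2 (momS (basisVec j) (posS (basisVec j) ψ))‖ +
    B * B * ‖toL2 (momS (basisVec j) (momS (basisVec j) ψ))‖),
    Finset.sum_nonneg fun j _ => by positivity, fun t φ ht h => ?_⟩
  rw [sqPosS_eq, map_sum]
  refine (norm_sum_le _ _).trans (Finset.sum_le_sum fun j _ => ?_)
  have h1 := posS_propagator h (basisVec j)
  have h2 := posS_propagator h1.symm (basisVec j)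
  obtain ⟨hc, hs⟩ := hB κ t le_rfl ht
  rw [h2, LinearIsometryEquiv.norm_map]
  have e : ∀ (r s : ℝ) (v : L2 d), |r| ≤ B → |s| ≤ B → ‖(r : ℂ) • (s : ℂ) • v‖ ≤ B * B * ‖v‖ := by
    intro r s v hr hs
    rw [norm_smul, norm_smul, Complex.norm_real, Complex.norm_real, ← mul_assoc]
    rw [Real.norm_eq_abs, Real.norm_eq_abs]
    gcongr
  simp only [map_add, map_smul, smul_add]
  refine (norm_add_le _ _).trans ?_
  have h3 := (norm_add_le ((cosK κ t : ℂ) • (cosK κ t : ℂ) • toL2 (posS (basisVec j)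
    (posS (basisVec j) ψ))) ((cosK κ t : ℂ) • (sinK κ t : ℂ) • toL2 (posS (basisVec j)
    (momS (basisVec j) ψ)))).trans (add_le_add (e _ _ _ hc hc) (e _ _ _ hc hs))
  have h4 := (norm_add_le ((sinK κ t : ℂ) • (cosK κ t : ℂ) • toL2 (momS (basisVec j)
    (posS (basisVec j) ψ))) ((sinK κ t : ℂ) • (sinK κ t : ℂ) • toL2 (momS (basisVec j)
    (momS (basisVec j) ψ)))).trans (add_le_add (e _ _ _ hs hc) (e _ _ _ hs hs))
  linarith

/-- Duhamel's formula gives a Lipschitz bound in `κ` on Schwartz functions. -/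
theorem exists_propagator_lipschitz (κ T : ℝ) (ψ : 𝓢(Space d, ℂ)) :
    ∃ C, 0 ≤ C ∧ ∀ κ' t, |t| ≤ T →
      ‖propagator κ t (toL2 ψ) - propagator κ' t (toL2 ψ)‖ ≤ C * |κ' - κ| := by
  obtain ⟨C, hC0, hC⟩ := exists_bound_sqPosS_propagator κ T ψ
  obtain ⟨y, hy1, hy2⟩ := isFlowOn_propagator (d := d) κ ψ
  refine ⟨C * |T|, by positivity, fun κ' t ht => ?_⟩
  have hU' := isSchrodingerGroup_propagator (d := d) κ'
  have hd : ∀ s, HasDerivAt (fun s => propagator κ' (t - s) (toL2 (y s)))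
      (propagator κ' (t - s) (toL2 ((Complex.I / 2 * ((κ' - κ : ℝ) : ℂ)) • sqPosS (y s)))) s := by
    intro s
    obtain ⟨z, hz1, hz2⟩ := isFlowOn_propagator (d := d) κ' (y s)
    have h1 : HasDerivAt (fun r => propagator κ' (t - r) (toL2 (y s)))
        (-propagator κ' (t - s) (toL2 (genS κ' 0 (y s)))) s := by
      obtain ⟨f', h1, h2⟩ := hU'.generator (y s)
      rw [generator_eq_toL2_genS] at h1
      subst h1
      have h3 : HasDerivAt (fun r => propagator κ' (s - r) (toL2 (y s)))
          (-toL2 (genS κ' 0 (y s))) s := by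
        have h4 : HasDerivAt (fun r : ℝ => s - r) (-1) s := by
          simpa using (hasDerivAt_id s).const_sub s
        rw [← toL2_apply] at h2
        have h5 := HasDerivAt.scomp (h := fun r : ℝ => s - r) s (by rw [sub_self]; exact h2) h4
        rw [neg_one_smul] at h5
        exact h5
      have h6 := hasDerivAt_isometry_apply (T := fun _ => propagator κ' (t - s)) h3
        (hasDerivAt_const _ _) tendsto_const_nhds
      rw [add_zero, map_neg] at h6
      refine h6.congr_of_eventuallyEq (Eventually.of_forall fun r => ?_)
      change _ = propagator κ' (t - s) (propagator κ' (s - r) (toL2 (y s)))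
      rw [← hU'.add, sub_add_sub_cancel]
    have hcont : Continuous fun r => propagator κ' (t - r) (toL2 (genS κ 0 (y s))) :=
      (hU'.continuous _).comp (by fun_prop)
    refine (hasDerivAt_isometry_apply (T := fun r => propagator κ' (t - r)) (hy2 s (Set.mem_univ s))
      h1 hcont.continuousAt).congr_deriv ?_
    rw [← sub_eq_add_neg, ← map_sub, ← map_sub]
    congr 2
    simp only [genS]
    push_cast
    module
  have h := (convex_uIcc 0 t).norm_image_sub_le_of_norm_hasDerivWithin_le
    (C := C * |κ' - κ|) (fun s _ => (hd s).hasDerivWithinAt) (fun s hs => ?_)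
    Set.left_mem_uIcc Set.right_mem_uIcc
  · have e0 : y 0 = ψ := toL2_injective (by
      rw [← hy1 0, (isSchrodingerGroup_propagator κ).zero])
    rw [sub_self, hU'.zero, sub_zero, ← hy1, e0] at h
    refine h.trans ?_
    have h1 : ‖t‖ ≤ |T| := by
      rw [Real.norm_eq_abs]; exact ht.trans (le_abs_self T)
    calc C * |κ' - κ| * ‖t‖ ≤ C * |κ' - κ| * |T| := by gcongr
      _ = _ := by ring
  · have hs' : |s| ≤ T := by
      refine le_trans ?_ ht
      rcases Set.mem_uIcc.1 hs with h | h
      · rw [abs_of_nonneg h.1, abs_of_nonneg (h.1.trans h.2)]; exact h.2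
      · rw [abs_of_nonpos h.2, abs_of_nonpos (h.1.trans h.2)]; linarith
    rw [LinearIsometryEquiv.norm_map, map_smul, norm_smul, norm_mul, Complex.norm_real,
      Real.norm_eq_abs]
    have h1 := hC s (y s) hs' (hy1 s)
    have h2 : ‖Complex.I / 2‖ ≤ 1 := by simp; norm_num
    calc ‖Complex.I / 2‖ * |κ' - κ| * ‖toL2 (sqPosS (y s))‖ ≤ 1 * |κ' - κ| * C := by gcongr
      _ = _ := by ring

/-- Joint strong continuity of the propagator in the frequency and time. -/
theorem tendsto_propagator {ι : Type*} {l : Filter ι} {κ t : ι → ℝ} {κ₀ t₀ : ℝ}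
    (hκ : Tendsto κ l (𝓝 κ₀)) (ht : Tendsto t l (𝓝 t₀)) (u : L2 d) :
    Tendsto (fun n => propagator (κ n) (t n) u) l (𝓝 (propagator κ₀ t₀ u)) := by
  have h2 : ∀ᶠ n in l, |t n| ≤ |t₀| + 1 :=
    (ht.abs.eventually_lt_const (lt_add_one _)).mono fun _ h => h.le
  have key : ∀ ψ : 𝓢(Space d, ℂ), Tendsto (fun n => propagator (κ n) (t n) (toL2 ψ)) l
      (𝓝 (propagator κ₀ t₀ (toL2 ψ))) := by
    intro ψ
    obtain ⟨C, hC0, hC⟩ := exists_propagator_lipschitz κ₀ (|t₀| + 1) ψ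
    have h3 : Tendsto (fun n => C * |κ n - κ₀|) l (𝓝 0) := by
      simpa using ((hκ.sub_const κ₀).abs.const_mul C)
    have h4 : Tendsto (fun n => propagator κ₀ (t n) (toL2 ψ) - propagator (κ n) (t n) (toL2 ψ)) l
        (𝓝 0) := squeeze_zero_norm' (by filter_upwards [h2] with n a using hC _ _ a) h3
    have h5 := ((((isSchrodingerGroup_propagator κ₀).continuous
        (toL2 ψ)).tendsto t₀).comp ht).sub h4
    simpa using h5
  rw [Metric.tendsto_nhds]
  intro ε hε
  obtain ⟨ψ, hψ⟩ := denseRange_toL2.exists_dist_lt u (by positivity : 0 < ε / 3)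
  filter_upwards [Metric.tendsto_nhds.1 (key ψ) (ε / 3) (by positivity)] with n hn
  have h4 : dist (propagator (κ n) (t n) u) (propagator (κ n) (t n) (toL2 ψ)) < ε / 3 := by
    rwa [LinearIsometryEquiv.dist_map]
  have h5 : dist (propagator κ₀ t₀ (toL2 ψ)) (propagator κ₀ t₀ u) < ε / 3 := by
    rwa [LinearIsometryEquiv.dist_map, dist_comm]
  have := dist_triangle4 (propagator (κ n) (t n) u) (propagator (κ n) (t n) (toL2 ψ))
    (propagator κ₀ t₀ (toL2 ψ)) (propagator κ₀ t₀ u)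
  linarith

/-! ### The space `Σ^{1/2}` through phase space translations -/

/-- The square of the norm of `Σ^{1/2}`, up to constants: `‖u‖² + ∫ |x| |u|² + ∫ |2πξ| |𝓕u|²`. -/
def sigmaHalfSq (u : L2 d) : ℝ≥0∞ :=
  (∫⁻ x : Space d, ENNReal.ofReal (‖x‖ * ‖u x‖ ^ 2)) +
    (∫⁻ ξ : Space d, ENNReal.ofReal (2 * Real.pi * ‖ξ‖ * ‖fourierU u ξ‖ ^ 2)) +
    ENNReal.ofReal (‖u‖ ^ 2)

theorem eLpNorm_two_sq {α : Type*} [MeasurableSpace α] {μ : Measure α} (f : α → ℂ) :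
    eLpNorm f 2 μ ^ 2 = ∫⁻ x, ENNReal.ofReal (‖f x‖ ^ 2) ∂μ := by
  have h := eLpNorm_nnreal_pow_eq_lintegral (f := f) (μ := μ) (p := 2) (by norm_num)
  simp only [NNReal.coe_ofNat, ENNReal.rpow_ofNat, ENNReal.coe_ofNat] at h
  rw [h]
  refine lintegral_congr fun x => ?_
  rw [ENNReal.ofReal_pow (norm_nonneg _), ofReal_norm]

theorem eLpNorm_weight_sq {s : ℝ} (w : Space d → ℝ) (u : L2 d) :
    eLpNorm (fun x : Space d => (((1 + w x ^ 2) ^ (s / 2) : ℝ) : ℂ) * u x) 2 volume ^ 2 =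
      ∫⁻ x : Space d, ENNReal.ofReal ((1 + w x ^ 2) ^ s * ‖u x‖ ^ 2) := by
  rw [eLpNorm_two_sq]
  refine lintegral_congr fun x => ?_
  have h : 0 ≤ 1 + w x ^ 2 := by positivity
  rw [norm_mul, Complex.norm_real, Real.norm_of_nonneg (Real.rpow_nonneg h _), mul_pow,
    ← Real.rpow_natCast, ← Real.rpow_mul h]
  norm_num

theorem weight_half_le {r : ℝ} (hr : 0 ≤ r) : (1 + r ^ 2) ^ (1 / 2 : ℝ) ≤ r + 1 := by
  rw [← Real.sqrt_eq_rpow]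
  exact Real.sqrt_le_iff.2 ⟨by positivity, by nlinarith⟩

theorem le_weight_half (r : ℝ) : r ≤ (1 + r ^ 2) ^ (1 / 2 : ℝ) := by
  rw [← Real.sqrt_eq_rpow]
  exact Real.le_sqrt_of_sq_le (by linarith)

theorem one_le_weight {s : ℝ} (hs : 0 ≤ s) (r : ℝ) : 1 ≤ (1 + r ^ 2) ^ s :=
  Real.one_le_rpow (by nlinarith [sq_nonneg r]) hs

theorem lintegral_weight_half_le (w : Space d → ℝ) (hw : ∀ x, 0 ≤ w x) (u : L2 d) :
    ∫⁻ x : Space d, ENNReal.ofReal ((1 + w x ^ 2) ^ (1 / 2 : ℝ) * ‖u x‖ ^ 2) ≤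
      (∫⁻ x : Space d, ENNReal.ofReal (w x * ‖u x‖ ^ 2)) + ENNReal.ofReal (‖u‖ ^ 2) := by
  rw [norm_sq_eq_lintegral, ← lintegral_add_right]
  · refine lintegral_mono fun x => ?_
    rw [← ENNReal.ofReal_add (mul_nonneg (hw x) (by positivity)) (by positivity)]
    refine ENNReal.ofReal_le_ofReal ?_
    have := weight_half_le (hw x)
    nlinarith [sq_nonneg ‖u x‖]
  · exact (Lp.stronglyMeasurable u).measurable.norm.pow_const 2 |>.ennreal_ofReal

theorem lintegral_weight_le_sigmaNorm (u : L2 d) {s : ℝ} {m : ℝ → ℝ}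
    (hm : ∀ r, 0 ≤ r → m r ≤ (1 + r ^ 2) ^ s) :
    (∫⁻ x : Space d, ENNReal.ofReal (m ‖x‖ * ‖u x‖ ^ 2)) ≤ sigmaNorm s u ^ 2 ∧
    (∫⁻ ξ : Space d, ENNReal.ofReal (m (2 * Real.pi * ‖ξ‖) * ‖fourierU u ξ‖ ^ 2)) ≤
      sigmaNorm s u ^ 2 := by
  constructor
  · refine le_trans ?_ (pow_le_pow_left₀ zero_le (le_self_add :
      _ ≤ sigmaNorm s u) 2)
    rw [eLpNorm_weight_sq (fun x => ‖x‖) u]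
    refine lintegral_mono fun x => ENNReal.ofReal_le_ofReal ?_
    exact mul_le_mul_of_nonneg_right (hm _ (norm_nonneg _)) (by positivity)
  · refine le_trans ?_ (pow_le_pow_left₀ zero_le (le_add_self :
      _ ≤ sigmaNorm s u) 2)
    have h := eLpNorm_weight_sq (s := s) (fun ξ : Space d => 2 * Real.pi * ‖ξ‖)
      (𝓕 u : L2 d)
    rw [h]
    refine lintegral_mono fun x => ENNReal.ofReal_le_ofReal ?_
    exact mul_le_mul_of_nonneg_right (hm _ (by positivity)) (by positivity)

theorem sigmaHalfSq_le (u : L2 d) : sigmaHalfSq u ≤ 3 * sigmaNorm (1 / 2) u ^ 2 := by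
  have h := lintegral_weight_le_sigmaNorm u (s := 1 / 2) (m := fun r => r)
    (fun r _ => le_weight_half r)
  have h' := lintegral_weight_le_sigmaNorm u (s := 1 / 2) (m := fun _ => 1)
    (fun r _ => one_le_weight (by norm_num) r)
  simp only [one_mul] at h'
  rw [← norm_sq_eq_lintegral] at h'
  calc sigmaHalfSq u ≤ _ := add_le_add (add_le_add h.1 h.2) h'.1
    _ = _ := by ring

theorem sigmaNorm_half_sq_le (u : L2 d) : sigmaNorm (1 / 2) u ^ 2 ≤ 4 * sigmaHalfSq u := by
  have h1 : eLpNorm (fun x : Space d => (((1 + ‖x‖ ^ 2) ^ (1 / 2 / 2 : ℝ) : ℝ) : ℂ) * u x) 2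
      volume ^ 2 ≤ sigmaHalfSq u := by
    rw [eLpNorm_weight_sq (fun x => ‖x‖) u]
    refine (lintegral_weight_half_le _ (fun x => norm_nonneg _) u).trans ?_
    rw [sigmaHalfSq, add_right_comm]
    exact le_self_add
  have h2 : eLpNorm (fun ξ : Space d => (((1 + (2 * Real.pi * ‖ξ‖) ^ 2) ^ (1 / 2 / 2 : ℝ) : ℝ) : ℂ)
      * (𝓕 u : L2 d) ξ) 2 volume ^ 2 ≤ sigmaHalfSq u := by
    have h := eLpNorm_weight_sq (s := 1 / 2) (fun ξ : Space d => 2 * Real.pi * ‖ξ‖)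
      (𝓕 u : L2 d)
    rw [h]
    refine (lintegral_weight_half_le _ (fun x => by positivity) _).trans ?_
    have e : ‖(𝓕 u : L2 d)‖ = ‖u‖ := (fourierU (d := d)).norm_map u
    rw [e, sigmaHalfSq, add_assoc]
    exact le_add_self
  have h3 : ∀ a b S : ℝ≥0∞, a ^ 2 ≤ S → b ^ 2 ≤ S → (a + b) ^ 2 ≤ 4 * S := by
    intro a b S ha hb
    rcases le_total a b with h | h
    · calc (a + b) ^ 2 ≤ (b + b) ^ 2 := by gcongr
        _ = 4 * b ^ 2 := by ring
        _ ≤ _ := by gcongr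
    · calc (a + b) ^ 2 ≤ (a + a) ^ 2 := by gcongr
        _ = 4 * a ^ 2 := by ring
        _ ≤ _ := by gcongr
  exact h3 _ _ _ h1 h2

theorem memSigma_half_iff (u : L2 d) : MemSigma (1 / 2) u ↔ sigmaHalfSq u < ∞ := by
  constructor
  · intro h
    exact (sigmaHalfSq_le u).trans_lt (ENNReal.mul_lt_top (by simp) (ENNReal.pow_lt_top h))
  · intro h
    by_contra h'
    have e : sigmaNorm (1 / 2) u = ∞ := not_lt_top_iff.1 h'
    have := sigmaNorm_half_sq_le u
    rw [e, ENNReal.top_pow (by norm_num)] at this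
    exact absurd (this.trans_lt (ENNReal.mul_lt_top (by simp) h)) (lt_irrefl _)

theorem tendsto_sigmaNorm_half_iff {ι : Type*} {l : Filter ι} (u : ι → L2 d) :
    Tendsto (fun n => sigmaNorm (1 / 2) (u n)) l (𝓝 0) ↔
      Tendsto (fun n => sigmaHalfSq (u n)) l (𝓝 0) := by
  constructor
  · intro h
    have h1 : Tendsto (fun n => 3 * sigmaNorm (1 / 2) (u n) ^ 2) l (𝓝 (3 * 0 ^ 2)) :=
      ENNReal.Tendsto.const_mul (ENNReal.Tendsto.pow (n := 2) h) (Or.inr (by simp))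
    simp only [ne_eq, OfNat.ofNat_ne_zero, not_false_eq_true, zero_pow, mul_zero] at h1
    exact tendsto_of_tendsto_of_tendsto_of_le_of_le tendsto_const_nhds h1 (fun _ => zero_le)
      fun n => sigmaHalfSq_le _
  · intro h
    have h1 : Tendsto (fun n => 4 * sigmaHalfSq (u n)) l (𝓝 (4 * 0)) :=
      ENNReal.Tendsto.const_mul h (Or.inr (by simp))
    rw [mul_zero] at h1
    have h2 : Tendsto (fun n => sigmaNorm (1 / 2) (u n) ^ 2) l (𝓝 0) :=
      tendsto_of_tendsto_of_tendsto_of_le_of_le tendsto_const_nhds h1 (fun _ => zero_le)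
        fun n => sigmaNorm_half_sq_le _
    have h3 := (ENNReal.continuous_rpow_const (y := 1 / 2)).continuousAt.tendsto.comp h2
    rw [ENNReal.zero_rpow_of_pos (by norm_num)] at h3
    refine h3.congr fun n => ?_
    simp only [Function.comp]
    rw [← ENNReal.rpow_natCast, ← ENNReal.rpow_mul]
    norm_num

/-- The upper bound `min(4, θ²)` of `|exp(iθ) - 1|²`. -/
def osc (θ : ℝ) : ℝ := min 4 (θ ^ 2)

theorem osc_nonneg (θ : ℝ) : 0 ≤ osc θ := le_min (by norm_num) (sq_nonneg _)

theorem continuous_osc : Continuous osc := by unfold osc; fun_prop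

theorem osc_le_osc {a b : ℝ} (h : |a| ≤ |b|) : osc a ≤ osc b :=
  min_le_min le_rfl (sq_le_sq.2 h)

theorem norm_expI_sub_one_sq_le (θ : ℝ) : ‖Complex.exp ((θ : ℂ) * Complex.I) - 1‖ ^ 2 ≤ osc θ := by
  refine le_min ?_ ?_
  · have h : ‖Complex.exp ((θ : ℂ) * Complex.I) - 1‖ ≤ 2 := by
      refine (norm_sub_le _ _).trans ?_
      rw [Complex.norm_exp_ofReal_mul_I, norm_one]; norm_num
    nlinarith [norm_nonneg (Complex.exp ((θ : ℂ) * Complex.I) - 1)]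
  · have h := norm_expI_sub_expI_le θ 0
    simp only [Complex.ofReal_zero, zero_mul, Complex.exp_zero, sub_zero] at h
    rw [← sq_abs θ]
    exact pow_le_pow_left₀ (norm_nonneg _) h 2

theorem le_norm_expI_sub_one_sq {θ : ℝ} (h : |θ| ≤ 1) :
    4 / Real.pi ^ 2 * θ ^ 2 ≤ ‖Complex.exp ((θ : ℂ) * Complex.I) - 1‖ ^ 2 := by
  have h1 := Real.cos_le_one_sub_mul_cos_sq (x := θ) (h.trans (by linarith [Real.pi_gt_three]))
  have h2 : ‖Complex.exp ((θ : ℂ) * Complex.I) - 1‖ ^ 2 = 2 - 2 * Real.cos θ := by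
    rw [Complex.sq_norm, Complex.normSq_apply]
    simp only [Complex.sub_re, Complex.sub_im, Complex.exp_ofReal_mul_I_re,
      Complex.exp_ofReal_mul_I_im, Complex.one_re, Complex.one_im]
    nlinarith [Real.sin_sq_add_cos_sq θ]
  rw [h2]
  have e : 4 / Real.pi ^ 2 * θ ^ 2 = 2 * (2 / Real.pi ^ 2 * θ ^ 2) := by ring
  linarith

/-- The quadratic behaviour of `osc` at `0` and its boundedness at infinity give
`∫₀^∞ osc(εr) ε⁻² dε ≲ r`. -/
theorem lintegral_osc_le {r : ℝ} (hr : 0 ≤ r) :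
    ∫⁻ ε in Set.Ioi (0 : ℝ), ENNReal.ofReal (osc (ε * r) / ε ^ 2) ≤ ENNReal.ofReal (5 * r) := by
  rcases hr.eq_or_lt with rfl | hr
  · simp [osc]
  have hr' : 0 < r⁻¹ := inv_pos.2 hr
  rw [← Set.Ioc_union_Ioi_eq_Ioi hr'.le]
  refine (lintegral_union_le _ _ _).trans ?_
  have h1 : ∫⁻ ε in Set.Ioc (0 : ℝ) r⁻¹, ENNReal.ofReal (osc (ε * r) / ε ^ 2) ≤
      ENNReal.ofReal r := by
    calc _ ≤ ∫⁻ _ in Set.Ioc (0 : ℝ) r⁻¹, ENNReal.ofReal (r ^ 2) := by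
          refine setLIntegral_mono measurable_const fun ε hε => ENNReal.ofReal_le_ofReal ?_
          rw [div_le_iff₀ (pow_pos hε.1 2)]
          exact (min_le_right _ _).trans_eq (by ring)
      _ = _ := by
          rw [setLIntegral_const, Real.volume_Ioc, sub_zero, ← ENNReal.ofReal_mul (by positivity)]
          congr 1
          field_simp
  have h2 : ∫⁻ ε in Set.Ioi r⁻¹, ENNReal.ofReal (osc (ε * r) / ε ^ 2) ≤ ENNReal.ofReal (4 * r) := by
    have hi := integrableOn_Ioi_rpow_of_lt (a := -2) (by norm_num) hr'
    calc _ ≤ ∫⁻ ε in Set.Ioi r⁻¹, ENNReal.ofReal (4 * ε ^ (-2 : ℝ)) := by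
          refine setLIntegral_mono (by fun_prop) fun ε hε => ENNReal.ofReal_le_ofReal ?_
          have hε0 : 0 < ε := hr'.trans hε
          rw [Real.rpow_neg hε0.le, Real.rpow_ofNat, ← div_eq_mul_inv]
          gcongr
          exact min_le_left _ _
      _ = _ := by
          rw [← ofReal_integral_eq_lintegral_ofReal (hi.const_mul 4)]
          · rw [integral_const_mul, integral_Ioi_rpow_of_lt (by norm_num) hr']
            norm_num [Real.rpow_neg_one]
          · refine (ae_restrict_iff' measurableSet_Ioi).2 (Eventually.of_forall fun ε hε => ?_)
            have hε0 : 0 < ε := hr'.trans hε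
            change 0 ≤ 4 * ε ^ (-2 : ℝ)
            positivity
  refine (add_le_add h1 h2).trans_eq ?_
  rw [← ENNReal.ofReal_add hr.le (by positivity)]
  congr 1
  ring

/-- The integral `∫₀^∞ |exp(iεr) - 1|² ε⁻² dε` is a multiple of `|r|`; the part `ε ≤ 1/|r|` suffices
for a lower bound. -/
theorem le_lintegral_norm_expI_sub_one_sq (r : ℝ) :
    ENNReal.ofReal (4 / Real.pi ^ 2 * |r|) ≤ ∫⁻ ε in Set.Ioi (0 : ℝ),
      ENNReal.ofReal (‖Complex.exp (((ε * r : ℝ) : ℂ) * Complex.I) - 1‖ ^ 2 / ε ^ 2) := by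
  rcases eq_or_ne r 0 with rfl | hr
  · simp
  have hr' : 0 < |r| := abs_pos.2 hr
  calc _ = ∫⁻ _ in Set.Ioc (0 : ℝ) |r|⁻¹, ENNReal.ofReal (4 / Real.pi ^ 2 * |r| ^ 2) := by
        rw [setLIntegral_const, Real.volume_Ioc, sub_zero, ← ENNReal.ofReal_mul (by positivity)]
        congr 1
        field_simp
    _ ≤ ∫⁻ ε in Set.Ioc (0 : ℝ) |r|⁻¹,
        ENNReal.ofReal (‖Complex.exp (((ε * r : ℝ) : ℂ) * Complex.I) - 1‖ ^ 2 / ε ^ 2) := by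
        refine setLIntegral_mono (by fun_prop) fun ε hε => ENNReal.ofReal_le_ofReal ?_
        rw [le_div_iff₀ (pow_pos hε.1 2)]
        refine le_trans (le_of_eq ?_) (le_norm_expI_sub_one_sq (θ := ε * r) ?_)
        · rw [sq_abs]; ring
        · rw [abs_mul, abs_of_pos hε.1]
          exact (le_inv_comm₀ hε.1 hr').1 (by simpa using hε.2) |> fun h => by
            have := mul_le_mul_of_nonneg_right hε.2 hr'.le
            rwa [inv_mul_cancel₀ hr'.ne'] at this
    _ ≤ _ := lintegral_mono_set Set.Ioc_subset_Ioi_self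

theorem lintegral_lintegral_osc_le {w : Space d → ℝ} (hw : Continuous w) (hw0 : ∀ x, 0 ≤ w x)
    (u : L2 d) :
    ∫⁻ ε in Set.Ioi (0 : ℝ), (∫⁻ x : Space d, ENNReal.ofReal (osc (ε * w x) * ‖u x‖ ^ 2)) *
      ENNReal.ofReal (ε ^ 2)⁻¹ ≤ 5 * ∫⁻ x : Space d, ENNReal.ofReal (w x * ‖u x‖ ^ 2) := by
  have hu : Measurable fun x => ‖u x‖ ^ 2 := (Lp.stronglyMeasurable u).measurable.norm.pow_const 2
  have hosc := continuous_osc.measurable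
  have hwm := hw.measurable
  have e : ∀ ε : ℝ, (∫⁻ x : Space d, ENNReal.ofReal (osc (ε * w x) * ‖u x‖ ^ 2)) *
      ENNReal.ofReal (ε ^ 2)⁻¹ =
      ∫⁻ x : Space d, ENNReal.ofReal (osc (ε * w x) / ε ^ 2) * ENNReal.ofReal (‖u x‖ ^ 2) := by
    intro ε
    rw [← lintegral_mul_const]
    · refine lintegral_congr fun x => ?_
      have := osc_nonneg (ε * w x)
      rw [← ENNReal.ofReal_mul (by positivity), ← ENNReal.ofReal_mul (by positivity)]
      congr 1
      ring
    · exact (((hosc.comp (hwm.const_mul ε)).mul hu)).ennreal_ofReal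
  simp_rw [e]
  rw [lintegral_lintegral_swap]
  · rw [← lintegral_const_mul]
    · refine lintegral_mono fun x => ?_
      rw [lintegral_mul_const]
      · refine (mul_le_mul_left (lintegral_osc_le (hw0 x)) _).trans_eq ?_
        rw [ENNReal.ofReal_mul (by norm_num), ENNReal.ofReal_mul (hw0 x), mul_assoc]
        norm_num
      · exact ((hosc.comp (measurable_id.mul_const _)).div
            (measurable_id.pow_const 2)).ennreal_ofReal
    · exact (hwm.mul hu).ennreal_ofReal
  · refine Measurable.aemeasurable ?_
    refine Measurable.mul (Measurable.ennreal_ofReal ?_) (hu.comp measurable_snd).ennreal_ofReal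
    exact (hosc.comp (measurable_fst.mul (hwm.comp measurable_snd))).div
      (measurable_fst.pow_const 2)

theorem norm_sq_phase_sub (θ : Space d → ℝ) (hθ : Continuous θ) (u : L2 d) :
    ENNReal.ofReal (‖phase θ hθ u - u‖ ^ 2) = ∫⁻ x : Space d,
      ENNReal.ofReal (‖Complex.exp ((θ x : ℂ) * Complex.I) - 1‖ ^ 2 * ‖u x‖ ^ 2) := by
  rw [norm_sq_eq_lintegral]
  refine lintegral_congr_ae ?_
  filter_upwards [Lp.coeFn_sub (phase θ hθ u) u, phase_coe θ hθ u] with x h1 h2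
  rw [h1, Pi.sub_apply, h2, ← mul_pow, ← norm_mul, sub_mul, one_mul]

theorem weyl_zero_left (p : Space d) :
    weyl 0 p = phase (fun x => inner ℝ x p) (by fun_prop) := by
  refine LinearIsometryEquiv.ext fun u => Lp.ext ?_
  filter_upwards [weyl_coe 0 p u, phase_coe (fun x => inner ℝ x p) (by fun_prop) u] with x h1 h2
  rw [h1, h2]
  simp [weylSymbol]

theorem weyl_zero_right (q : Space d) : weyl q 0 = translate q := by
  refine LinearIsometryEquiv.ext fun u => Lp.ext ?_
  filter_upwards [weyl_coe q 0 u, translate_coe q u] with x h1 h2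
  rw [h1, h2]
  simp [weylSymbol]

theorem norm_sq_weyl_zero_left (p : Space d) (u : L2 d) :
    ENNReal.ofReal (‖weyl 0 p u - u‖ ^ 2) = ∫⁻ x : Space d,
      ENNReal.ofReal (‖Complex.exp (((inner ℝ x p : ℝ) : ℂ) * Complex.I) - 1‖ ^ 2 * ‖u x‖ ^ 2) := by
  rw [weyl_zero_left, norm_sq_phase_sub]

theorem norm_sq_weyl_zero_right (q : Space d) (u : L2 d) :
    ENNReal.ofReal (‖weyl q 0 u - u‖ ^ 2) = ∫⁻ ξ : Space d,
      ENNReal.ofReal (‖Complex.exp (((shiftSymbol q ξ : ℝ) : ℂ) * Complex.I) - 1‖ ^ 2 *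
        ‖fourierU u ξ‖ ^ 2) := by
  rw [weyl_zero_right, ← fourierU.norm_map, map_sub, fourierU_translate, norm_sq_phase_sub]

theorem weyl_eq_weyl_weyl (q p : Space d) (u : L2 d) :
    weyl q p u = Complex.exp (((-(inner ℝ q p : ℝ) / 2 : ℝ) : ℂ) * Complex.I) •
      weyl 0 p (weyl q 0 u) := by
  rw [weyl_weyl, smul_smul, ← Complex.exp_add]
  simp only [inner_zero_left, sub_zero, zero_add, add_zero]
  rw [← add_mul, ← Complex.ofReal_add]
  ring_nf
  simp

/-- Phase space translations commute up to the symplectic phase. -/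
theorem weyl_comm (q p q' p' : Space d) (u : L2 d) :
    weyl q p (weyl q' p' u) =
      Complex.exp (((inner ℝ q' p - inner ℝ q p' : ℝ) : ℂ) * Complex.I) •
        weyl q' p' (weyl q p u) := by
  rw [weyl_weyl, weyl_weyl, smul_smul, ← Complex.exp_add, add_comm q' q, add_comm p' p]
  congr 2
  rw [← add_mul, ← Complex.ofReal_add]
  congr 2
  ring

/-- A modulus of continuity of the phase space translations at `u`: it dominates
`‖W(εq, εp) u - u‖²` for `|q|, |p| ≤ R`, and its integral against `ε⁻² dε` is controlled by the
norm of `u` in `Σ^{1/2}`. -/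
def modulus (R ε : ℝ) (u : L2 d) : ℝ≥0∞ :=
  (∫⁻ x : Space d, ENNReal.ofReal (osc (ε * (R * ‖x‖)) * ‖u x‖ ^ 2)) +
    (∫⁻ ξ : Space d, ENNReal.ofReal (osc (ε * (R * (2 * Real.pi * ‖ξ‖))) * ‖fourierU u ξ‖ ^ 2)) +
    ENNReal.ofReal (osc (ε * R) * ‖u‖ ^ 2)

theorem measurable_lintegral_osc (w : Space d → ℝ) (hw : Continuous w) (u : L2 d) :
    Measurable fun ε : ℝ => ∫⁻ x : Space d, ENNReal.ofReal (osc (ε * w x) * ‖u x‖ ^ 2) := by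
  have hu : Measurable fun x => ‖u x‖ ^ 2 := (Lp.stronglyMeasurable u).measurable.norm.pow_const 2
  refine Measurable.lintegral_prod_right' (f := fun z : ℝ × Space d =>
    ENNReal.ofReal (osc (z.1 * w z.2) * ‖u z.2‖ ^ 2)) (Measurable.ennreal_ofReal ?_)
  exact (continuous_osc.measurable.comp (measurable_fst.mul (hw.measurable.comp
    measurable_snd))).mul (hu.comp measurable_snd)

/-- The integral of the modulus against `ε⁻² dε` is bounded by the norm of `Σ^{1/2}`. -/
theorem lintegral_modulus_le {R : ℝ} (hR : 0 ≤ R) (u : L2 d) :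
    ∫⁻ ε in Set.Ioi (0 : ℝ), modulus R ε u * ENNReal.ofReal (ε ^ 2)⁻¹ ≤
      ENNReal.ofReal (5 * R) * sigmaHalfSq u := by
  have hm : Measurable fun ε : ℝ => ENNReal.ofReal (ε ^ 2)⁻¹ := by fun_prop
  have h1 := lintegral_lintegral_osc_le (w := fun x : Space d => R * ‖x‖) (by fun_prop)
    (fun x => by positivity) u
  have h2 := lintegral_lintegral_osc_le (w := fun x : Space d => R * (2 * Real.pi * ‖x‖))
    (by fun_prop) (fun x => by positivity) (fourierU u)
  have h3 : ∫⁻ ε in Set.Ioi (0 : ℝ), ENNReal.ofReal (osc (ε * R) * ‖u‖ ^ 2) *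
      ENNReal.ofReal (ε ^ 2)⁻¹ ≤ ENNReal.ofReal (5 * R) * ENNReal.ofReal (‖u‖ ^ 2) := by
    refine le_trans (le_of_eq ?_) (mul_le_mul_left (lintegral_osc_le hR) _)
    rw [← lintegral_mul_const]
    · refine lintegral_congr fun ε => ?_
      have := osc_nonneg (ε * R)
      rw [← ENNReal.ofReal_mul (by positivity), ← ENNReal.ofReal_mul (by positivity)]
      congr 1
      ring
    · exact ((continuous_osc.measurable.comp (measurable_id.mul_const _)).div
        (measurable_id.pow_const 2)).ennreal_ofReal
  have e1 : ∀ (w : Space d → ℝ) (v : L2 d), (∀ x, 0 ≤ w x) → Continuous w →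
      5 * ∫⁻ x : Space d, ENNReal.ofReal (R * w x * ‖v x‖ ^ 2) =
      ENNReal.ofReal (5 * R) * ∫⁻ x : Space d, ENNReal.ofReal (w x * ‖v x‖ ^ 2) := by
    intro w v hw hwc
    have hv : Measurable fun x => ‖v x‖ ^ 2 := (Lp.stronglyMeasurable v).measurable.norm.pow_const 2
    have : ∀ x, ENNReal.ofReal (R * w x * ‖v x‖ ^ 2) =
        ENNReal.ofReal R * ENNReal.ofReal (w x * ‖v x‖ ^ 2) := fun x => by
      rw [mul_assoc, ENNReal.ofReal_mul hR]
    simp_rw [this]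
    have hm' : Measurable fun x => ENNReal.ofReal (w x * ‖v x‖ ^ 2) :=
      (hwc.measurable.mul hv).ennreal_ofReal
    rw [lintegral_const_mul _ hm', ← mul_assoc,
      ENNReal.ofReal_mul (by norm_num)]
    norm_num
  rw [e1 (fun x => ‖x‖) u (fun x => norm_nonneg x) continuous_norm] at h1
  rw [e1 (fun x => 2 * Real.pi * ‖x‖) (fourierU u) (fun x => by positivity) (by fun_prop)] at h2
  simp only [modulus, add_mul]
  rw [lintegral_add_left, lintegral_add_left]
  · exact (add_le_add (add_le_add h1 h2) h3).trans_eq (by rw [sigmaHalfSq]; ring)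
  · exact (measurable_lintegral_osc _ (by fun_prop) _).mul hm
  · exact ((measurable_lintegral_osc _ (by fun_prop) _).mul hm).add
      ((measurable_lintegral_osc _ (by fun_prop) _).mul hm)

theorem osc_add_sq_le {s α : ℝ} (hs : 0 ≤ s) (h : |α| ≤ s + s ^ 2 / 2) : osc α ≤ 4 * osc s := by
  have h0 := osc_nonneg s
  rcases le_total s 2 with h2 | h2
  · have e : osc s = s ^ 2 := min_eq_right (by nlinarith)
    rw [e]
    refine (min_le_right _ _).trans ?_
    have h3 : |α| ≤ 2 * s := by nlinarith
    rw [← sq_abs α]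
    nlinarith [abs_nonneg α]
  · have e : osc s = 4 := min_eq_left (by nlinarith)
    rw [e]
    exact (min_le_left _ _).trans (by norm_num)

/-- The modulus dominates small phase space translations, also when they carry a phase `exp(iεσ)` as
in the covariance relation `weyl_framed`. -/
theorem norm_sq_smul_weyl_sub_le {R ε σ : ℝ} {q p : Space d} (hε : 0 < ε) (hq : ‖q‖ ≤ R)
    (hp : ‖p‖ ≤ R) (hσ : |σ| ≤ R) (u : L2 d) :
    ENNReal.ofReal (‖Complex.exp (((ε * σ : ℝ) : ℂ) * Complex.I) • weyl (ε • q) (ε • p) u - u‖ ^ 2)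
      ≤ 12 * modulus R ε u := by
  have hR : 0 ≤ R := (norm_nonneg q).trans hq
  set A := weyl (ε • q) 0 u - u with hA
  set B := weyl 0 (ε • p) u - u with hB
  set α : ℝ := ε * σ + -(inner ℝ (ε • q) (ε • p) : ℝ) / 2 with hα
  have hα' : |α| ≤ ε * R + (ε * R) ^ 2 / 2 := by
    have h1 : |inner ℝ q p| ≤ R * R := (abs_real_inner_le_norm q p).trans (by gcongr)
    rw [hα, inner_smul_left, inner_smul_right]
    refine (abs_add_le _ _).trans (add_le_add ?_ ?_)
    · rw [abs_mul, abs_of_pos hε]; gcongr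
    · rw [abs_div, abs_neg, abs_mul, abs_mul, RCLike.conj_to_real, abs_of_pos hε, abs_two]
      calc ε * (ε * |inner ℝ q p|) / 2 ≤ ε * (ε * (R * R)) / 2 := by gcongr
        _ = _ := by ring
  have e : Complex.exp (((ε * σ : ℝ) : ℂ) * Complex.I) • weyl (ε • q) (ε • p) u - u =
      Complex.exp ((α : ℂ) * Complex.I) • weyl 0 (ε • p) A +
      (Complex.exp ((α : ℂ) * Complex.I) • B +
      (Complex.exp ((α : ℂ) * Complex.I) - 1) • u) := by
    rw [weyl_eq_weyl_weyl (ε • q) (ε • p), smul_smul, ← Complex.exp_add, ← add_mul,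
      ← Complex.ofReal_add, ← hα, hA, hB, map_sub]
    module
  have hn : ‖Complex.exp ((α : ℂ) * Complex.I)‖ = 1 := Complex.norm_exp_ofReal_mul_I α
  have h1 : ‖Complex.exp (((ε * σ : ℝ) : ℂ) * Complex.I) • weyl (ε • q) (ε • p) u - u‖ ^ 2 ≤
      3 * (‖A‖ ^ 2 + ‖B‖ ^ 2 + 4 * (osc (ε * R) * ‖u‖ ^ 2)) := by
    have h2 : ‖Complex.exp (((ε * σ : ℝ) : ℂ) * Complex.I) • weyl (ε • q) (ε • p) u - u‖ ≤
        ‖A‖ + (‖B‖ + ‖Complex.exp ((α : ℂ) * Complex.I) - 1‖ * ‖u‖) := by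
      rw [e]
      refine (norm_add_le _ _).trans (add_le_add ?_ ((norm_add_le _ _).trans (add_le_add ?_ ?_)))
      · rw [norm_smul, hn, one_mul, LinearIsometryEquiv.norm_map]
      · rw [norm_smul, hn, one_mul]
      · rw [norm_smul]
    have h3 : ‖Complex.exp ((α : ℂ) * Complex.I) - 1‖ ^ 2 ≤ 4 * osc (ε * R) :=
      (norm_expI_sub_one_sq_le α).trans (osc_add_sq_le (by positivity) hα')
    have h4 : (‖Complex.exp ((α : ℂ) * Complex.I) - 1‖ * ‖u‖) ^ 2 ≤
        4 * (osc (ε * R) * ‖u‖ ^ 2) := by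
      rw [mul_pow, ← mul_assoc]; gcongr
    refine (pow_le_pow_left₀ (norm_nonneg _) h2 2).trans ?_
    nlinarith [sq_nonneg (‖A‖ - ‖B‖),
      sq_nonneg (‖A‖ - ‖Complex.exp ((α : ℂ) * Complex.I) - 1‖ * ‖u‖),
      sq_nonneg (‖B‖ - ‖Complex.exp ((α : ℂ) * Complex.I) - 1‖ * ‖u‖)]
  have hAB : ENNReal.ofReal (‖B‖ ^ 2) ≤
        ∫⁻ x : Space d, ENNReal.ofReal (osc (ε * (R * ‖x‖)) * ‖u x‖ ^ 2) := by
    rw [hB, norm_sq_weyl_zero_left]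
    refine lintegral_mono fun x => ENNReal.ofReal_le_ofReal ?_
    refine mul_le_mul_of_nonneg_right ((norm_expI_sub_one_sq_le _).trans (osc_le_osc ?_))
      (by positivity)
    rw [inner_smul_right, abs_mul, abs_mul, abs_of_nonneg (by positivity : 0 ≤ R * ‖x‖)]
    gcongr
    exact (abs_real_inner_le_norm _ _).trans (by rw [mul_comm]; gcongr)
  have hAB' : ENNReal.ofReal (‖A‖ ^ 2) ≤ ∫⁻ ξ : Space d,
        ENNReal.ofReal (osc (ε * (R * (2 * Real.pi * ‖ξ‖))) * ‖fourierU u ξ‖ ^ 2) := by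
    rw [hA, norm_sq_weyl_zero_right]
    refine lintegral_mono fun x => ENNReal.ofReal_le_ofReal ?_
    refine mul_le_mul_of_nonneg_right ((norm_expI_sub_one_sq_le _).trans (osc_le_osc ?_))
      (by positivity)
    have hpi := Real.pi_pos
    rw [shiftSymbol, inner_smul_right, abs_mul, abs_mul, abs_mul, abs_neg,
      abs_of_pos (by positivity : 0 < 2 * Real.pi),
      abs_of_nonneg (by positivity : 0 ≤ R * (2 * Real.pi * ‖x‖)), abs_of_pos hε]
    calc 2 * Real.pi * (ε * |inner ℝ x q|) ≤ 2 * Real.pi * (ε * (‖x‖ * R)) := by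
          gcongr
          exact (abs_real_inner_le_norm _ _).trans (by gcongr)
      _ = _ := by ring
  have h0 := osc_nonneg (ε * R)
  refine (ENNReal.ofReal_le_ofReal h1).trans ?_
  rw [ENNReal.ofReal_mul (by norm_num), ENNReal.ofReal_add (by positivity) (by positivity),
    ENNReal.ofReal_add (by positivity) (by positivity), ENNReal.ofReal_mul (p := 4) (by norm_num)]
  simp only [ENNReal.ofReal_ofNat]
  calc _ ≤ 3 * (4 * (∫⁻ ξ : Space d,
        ENNReal.ofReal (osc (ε * (R * (2 * Real.pi * ‖ξ‖))) * ‖fourierU u ξ‖ ^ 2)) +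
        4 * (∫⁻ x : Space d, ENNReal.ofReal (osc (ε * (R * ‖x‖)) * ‖u x‖ ^ 2)) +
        4 * ENNReal.ofReal (osc (ε * R) * ‖u‖ ^ 2)) := by
        have h14 : (1 : ℝ≥0∞) ≤ 4 := by norm_num
        gcongr
        · exact hAB'.trans (le_mul_of_one_le_left zero_le h14)
        · exact hAB.trans (le_mul_of_one_le_left zero_le h14)
    _ = _ := by rw [modulus]; ring

/-! ### Operators on `Σ^{1/2}` -/

/-- The phase space translations of `T u` are controlled by the modulus of `u`. -/
def TranslationBound (R : ℝ) (T : L2 d ≃ₗᵢ[ℂ] L2 d) : Prop :=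
  ∀ (u : L2 d) (ε : ℝ), 0 < ε → ∀ q p : Space d, ‖q‖ ≤ 1 → ‖p‖ ≤ 1 →
    ENNReal.ofReal (‖weyl (ε • q) (ε • p) (T u) - T u‖ ^ 2) ≤ 12 * modulus R ε u

/-- The propagator in a moving frame, with a scalar phase. -/
def framed (θ : ℝ) (q p : Space d) (κ t : ℝ) : L2 d ≃ₗᵢ[ℂ] L2 d :=
  ((propagator κ t).trans (weyl q p)).trans (scalarU θ)

theorem framed_apply (θ : ℝ) (q p : Space d) (κ t : ℝ) (u : L2 d) :
    framed θ q p κ t u = Complex.exp ((θ : ℂ) * Complex.I) • weyl q p (propagator κ t u) := by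
  rw [framed, LinearIsometryEquiv.trans_apply, LinearIsometryEquiv.trans_apply, scalarU_apply]

/-- Covariance: a framed propagator intertwines the phase space translation by `(q, p)` and the one
by the point which the classical flow carries to `(q, p)`, up to a phase. -/
theorem weyl_framed (θ : ℝ) (q₀ p₀ q p : Space d) (κ t : ℝ) (u : L2 d) :
    weyl q p (framed θ q₀ p₀ κ t u) = framed θ q₀ p₀ κ t
      (Complex.exp (((inner ℝ q₀ p - inner ℝ q p₀ : ℝ) : ℂ) * Complex.I) •
        weyl (cosK κ t • q - sinK κ t • p) (cosK κ t • p + (κ * sinK κ t) • q) u) := by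
  rw [framed_apply, framed_apply, map_smul, weyl_comm, weyl_propagator_backward, map_smul,
    map_smul]

/-- The framed propagators satisfy the translation bound uniformly for bounded parameters. -/
theorem exists_translationBound_framed (B : ℝ) : ∃ R, 0 ≤ R ∧ ∀ (θ : ℝ) (q p : Space d) (κ t : ℝ),
    ‖q‖ ≤ B → ‖p‖ ≤ B → |κ| ≤ B → |t| ≤ B → TranslationBound R (framed θ q p κ t) := by
  obtain ⟨C, hC0, hC⟩ := exists_bound_cosK_sinK B B
  refine ⟨2 * C + |B| * C + 2 * |B|, by positivity,
      fun θ q₀ p₀ κ t hq0 hp0 hκ ht u ε hε q p hq hp =>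
    ?_⟩
  have hB : 0 ≤ B := (norm_nonneg _).trans hq0
  rw [abs_of_nonneg hB]
  obtain ⟨hc, hs⟩ := hC κ t hκ ht
  rw [weyl_framed, ← map_sub, LinearIsometryEquiv.norm_map]
  have e1 : cosK κ t • ε • q - sinK κ t • ε • p = ε • (cosK κ t • q - sinK κ t • p) := by module
  have e2 : cosK κ t • ε • p + (κ * sinK κ t) • ε • q =
    ε • (cosK κ t • p + (κ * sinK κ t) • q) := by module
  have e3 : (inner ℝ q₀ (ε • p) - inner ℝ (ε • q) p₀ : ℝ) =
      ε * (inner ℝ q₀ p - inner ℝ q p₀ : ℝ) := by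
    rw [inner_smul_left, inner_smul_right, RCLike.conj_to_real]; ring
  rw [e1, e2, e3]
  have hBC : 0 ≤ B * C := by positivity
  refine norm_sq_smul_weyl_sub_le hε ?_ ?_ ?_ u
  · refine (norm_sub_le _ _).trans ?_
    rw [norm_smul, norm_smul, Real.norm_eq_abs, Real.norm_eq_abs]
    have h1 : |cosK κ t| * ‖q‖ ≤ C * 1 := by gcongr
    have h2 : |sinK κ t| * ‖p‖ ≤ C * 1 := by gcongr
    linarith
  · refine (norm_add_le _ _).trans ?_
    rw [norm_smul, norm_smul, Real.norm_eq_abs, Real.norm_eq_abs, abs_mul]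
    have h1 : |cosK κ t| * ‖p‖ ≤ C * 1 := by gcongr
    have h2 : |κ| * |sinK κ t| * ‖q‖ ≤ B * C * 1 := by gcongr
    linarith
  · refine (abs_sub _ _).trans ?_
    have h1 : |inner ℝ q₀ p| ≤ B * 1 := (abs_real_inner_le_norm _ _).trans (by gcongr)
    have h2 : |inner ℝ q p₀| ≤ 1 * B := (abs_real_inner_le_norm _ _).trans (by gcongr)
    linarith

theorem continuous_weyl_smul (q p : Space d) (u : L2 d) :
    Continuous fun ε : ℝ => weyl (ε • q) (ε • p) u :=
  continuous_iff_continuousAt.2 fun ε => tendsto_weyl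
    ((continuous_id.smul continuous_const).tendsto ε)
    ((continuous_id.smul continuous_const).tendsto ε) u

/-- The integral `∫₀^∞ ‖W(εq, εp) u - u‖² ε⁻² dε`, a Besov type seminorm of order `1/2` in the
direction `(q, p)` of phase space. -/
def directionEnergy (q p : Space d) (u : L2 d) : ℝ≥0∞ :=
  ∫⁻ ε in Set.Ioi (0 : ℝ), ENNReal.ofReal (‖weyl (ε • q) (ε • p) u - u‖ ^ 2) *
    ENNReal.ofReal (ε ^ 2)⁻¹

theorem le_lintegral_lintegral_expI {w : Space d → ℝ} (hw : Continuous w) (u : L2 d) :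
    ENNReal.ofReal (4 / Real.pi ^ 2) * ∫⁻ x : Space d, ENNReal.ofReal (|w x| * ‖u x‖ ^ 2) ≤
      ∫⁻ ε in Set.Ioi (0 : ℝ), (∫⁻ x : Space d, ENNReal.ofReal
        (‖Complex.exp (((ε * w x : ℝ) : ℂ) * Complex.I) - 1‖ ^ 2 * ‖u x‖ ^ 2)) *
        ENNReal.ofReal (ε ^ 2)⁻¹ := by
  have hu : Measurable fun x => ‖u x‖ ^ 2 := (Lp.stronglyMeasurable u).measurable.norm.pow_const 2
  have hwm := hw.measurable
  have hE : Measurable fun θ : ℝ => ‖Complex.exp ((θ : ℂ) * Complex.I) - 1‖ ^ 2 := by fun_prop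
  have e : ∀ ε : ℝ, (∫⁻ x : Space d, ENNReal.ofReal
        (‖Complex.exp (((ε * w x : ℝ) : ℂ) * Complex.I) - 1‖ ^ 2 * ‖u x‖ ^ 2)) *
      ENNReal.ofReal (ε ^ 2)⁻¹ =
      ∫⁻ x : Space d, ENNReal.ofReal
        (‖Complex.exp (((ε * w x : ℝ) : ℂ) * Complex.I) - 1‖ ^ 2 / ε ^ 2) *
          ENNReal.ofReal (‖u x‖ ^ 2) := by
    intro ε
    rw [← lintegral_mul_const]
    · refine lintegral_congr fun x => ?_
      rw [← ENNReal.ofReal_mul (by positivity), ← ENNReal.ofReal_mul (by positivity)]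
      congr 1
      ring
    · exact (((hE.comp (hwm.const_mul ε)).mul hu)).ennreal_ofReal
  simp_rw [e]
  rw [lintegral_lintegral_swap]
  · have hm : Measurable fun x => ENNReal.ofReal (|w x| * ‖u x‖ ^ 2) :=
      (((measurable_abs.comp hwm)).mul hu).ennreal_ofReal
    rw [← lintegral_const_mul _ hm]
    refine lintegral_mono fun x => ?_
    rw [lintegral_mul_const]
    · refine le_trans (le_of_eq ?_) (mul_le_mul_left (le_lintegral_norm_expI_sub_one_sq (w x)) _)
      rw [← ENNReal.ofReal_mul (by positivity), ← ENNReal.ofReal_mul (by positivity), mul_assoc]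
    · exact ((hE.comp (measurable_id.mul_const _)).div (measurable_id.pow_const 2)).ennreal_ofReal
  · refine Measurable.aemeasurable ?_
    refine Measurable.mul (Measurable.ennreal_ofReal ?_) (hu.comp measurable_snd).ennreal_ofReal
    exact (hE.comp (measurable_fst.mul (hwm.comp measurable_snd))).div
      (measurable_fst.pow_const 2)

theorem le_directionEnergy_position (p : Space d) (u : L2 d) :
    ENNReal.ofReal (4 / Real.pi ^ 2) *
      ∫⁻ x : Space d, ENNReal.ofReal (|inner ℝ x p| * ‖u x‖ ^ 2) ≤ directionEnergy 0 p u := by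
  refine (le_lintegral_lintegral_expI (w := fun x => inner ℝ x p) (by fun_prop) u).trans_eq ?_
  refine lintegral_congr fun ε => ?_
  rw [smul_zero, norm_sq_weyl_zero_left]
  simp only [inner_smul_right]

theorem le_directionEnergy_momentum (q : Space d) (u : L2 d) :
    ENNReal.ofReal (4 / Real.pi ^ 2) * ∫⁻ ξ : Space d,
      ENNReal.ofReal (2 * Real.pi * |inner ℝ ξ q| * ‖fourierU u ξ‖ ^ 2) ≤
        directionEnergy q 0 u := by
  have h := le_lintegral_lintegral_expI (continuous_shiftSymbol q) (fourierU u)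
  have hpi := Real.pi_pos
  have e : ∀ ξ : Space d, |shiftSymbol q ξ| = 2 * Real.pi * |inner ℝ ξ q| := fun ξ => by
    rw [shiftSymbol, abs_mul, abs_neg, abs_of_pos (by positivity)]
  simp only [e] at h
  refine h.trans_eq (lintegral_congr fun ε => ?_)
  rw [smul_zero, norm_sq_weyl_zero_right]
  congr 1
  refine lintegral_congr fun ξ => ?_
  have : shiftSymbol (ε • q) ξ = ε * shiftSymbol q ξ := by
    simp only [shiftSymbol, inner_smul_right]; ring
  rw [this]

theorem norm_le_sum_abs_inner (x : Space d) : ‖x‖ ≤ ∑ j, |inner ℝ x (basisVec j)| := by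
  conv_lhs => rw [eq_sum_basisVec x]
  refine (norm_sum_le _ _).trans (Finset.sum_le_sum fun j _ => ?_)
  rw [norm_smul, norm_basisVec, mul_one, inner_basisVec, Real.norm_eq_abs]

theorem lintegral_norm_le_sum (c : ℝ) (hc : 0 ≤ c) (u : L2 d) :
    ∫⁻ x : Space d, ENNReal.ofReal (c * ‖x‖ * ‖u x‖ ^ 2) ≤
      ∑ j, ∫⁻ x : Space d, ENNReal.ofReal (c * |inner ℝ x (basisVec j)| * ‖u x‖ ^ 2) := by
  have hu : Measurable fun x => ‖u x‖ ^ 2 := (Lp.stronglyMeasurable u).measurable.norm.pow_const 2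
  rw [← lintegral_finsetSum]
  · refine lintegral_mono fun x => ?_
    rw [← ENNReal.ofReal_sum_of_nonneg fun j _ => by positivity]
    refine ENNReal.ofReal_le_ofReal ?_
    rw [← Finset.sum_mul, ← Finset.mul_sum]
    gcongr
    exact norm_le_sum_abs_inner x
  · intro j _
    refine Measurable.ennreal_ofReal (Measurable.mul ?_ hu)
    fun_prop

/-- The seminorm of `Σ^{1/2}` in terms of phase space translations. -/
def translationEnergy (u : L2 d) : ℝ≥0∞ :=
  (∑ j, directionEnergy 0 (basisVec j) u) + ∑ j, directionEnergy (basisVec j) 0 u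

theorem sigmaHalfSq_le_translationEnergy (u : L2 d) :
    sigmaHalfSq u ≤ ENNReal.ofReal (Real.pi ^ 2 / 4) * translationEnergy u +
      ENNReal.ofReal (‖u‖ ^ 2) := by
  have hpi := Real.pi_pos
  have e : ENNReal.ofReal (Real.pi ^ 2 / 4) * ENNReal.ofReal (4 / Real.pi ^ 2) = 1 := by
    rw [← ENNReal.ofReal_mul (by positivity)]
    have : Real.pi ^ 2 / 4 * (4 / Real.pi ^ 2) = 1 := by field_simp
    rw [this, ENNReal.ofReal_one]
  have key : ∀ a b : ℝ≥0∞, ENNReal.ofReal (4 / Real.pi ^ 2) * a ≤ b →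
      a ≤ ENNReal.ofReal (Real.pi ^ 2 / 4) * b := by
    intro a b h
    calc a = ENNReal.ofReal (Real.pi ^ 2 / 4) * (ENNReal.ofReal (4 / Real.pi ^ 2) * a) := by
          rw [← mul_assoc, e, one_mul]
      _ ≤ _ := by gcongr
  have h1 := lintegral_norm_le_sum 1 zero_le_one u
  have h2 := lintegral_norm_le_sum (2 * Real.pi) (by positivity) (fourierU u)
  simp only [one_mul] at h1
  rw [sigmaHalfSq, translationEnergy, mul_add, Finset.mul_sum, Finset.mul_sum]
  gcongr
  · exact h1.trans (Finset.sum_le_sum fun j _ => key _ _ (le_directionEnergy_position _ _))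
  · exact h2.trans (Finset.sum_le_sum fun j _ => key _ _ (le_directionEnergy_momentum _ _))

theorem TranslationBound.directionEnergy_le {R : ℝ} (hR : 0 ≤ R) {T : L2 d ≃ₗᵢ[ℂ] L2 d}
    (hT : TranslationBound R T) {q p : Space d} (hq : ‖q‖ ≤ 1) (hp : ‖p‖ ≤ 1) (u : L2 d) :
    directionEnergy q p (T u) ≤ 12 * (ENNReal.ofReal (5 * R) * sigmaHalfSq u) := by
  calc directionEnergy q p (T u) ≤ ∫⁻ ε in Set.Ioi (0 : ℝ),
        12 * (modulus R ε u * ENNReal.ofReal (ε ^ 2)⁻¹) := by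
        refine setLIntegral_mono' measurableSet_Ioi fun ε hε => ?_
        rw [← mul_assoc]
        gcongr
        exact hT u ε hε q p hq hp
    _ = 12 * ∫⁻ ε in Set.Ioi (0 : ℝ), modulus R ε u * ENNReal.ofReal (ε ^ 2)⁻¹ :=
        lintegral_const_mul' _ _ (by norm_num)
    _ ≤ _ := by
        gcongr
        exact lintegral_modulus_le hR u

/-- Operators which respect phase space translations are bounded on `Σ^{1/2}`. -/
theorem TranslationBound.sigmaHalfSq_le {R : ℝ} (hR : 0 ≤ R) :
    ∃ C : ℝ≥0∞, C ≠ ∞ ∧ ∀ T : L2 d ≃ₗᵢ[ℂ] L2 d, TranslationBound R T → ∀ u,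
      sigmaHalfSq (T u) ≤ C * sigmaHalfSq u := by
  refine ⟨ENNReal.ofReal (Real.pi ^ 2 / 4) * (d * (12 * ENNReal.ofReal (5 * R)) +
    d * (12 * ENNReal.ofReal (5 * R))) + 1, ?_, fun T hT u => ?_⟩
  · refine ENNReal.add_ne_top.2 ⟨ENNReal.mul_ne_top ENNReal.ofReal_ne_top ?_, ENNReal.one_ne_top⟩
    have : (d : ℝ≥0∞) * (12 * ENNReal.ofReal (5 * R)) ≠ ∞ :=
      ENNReal.mul_ne_top (ENNReal.natCast_ne_top d)
        (ENNReal.mul_ne_top (by norm_num) ENNReal.ofReal_ne_top)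
    exact ENNReal.add_ne_top.2 ⟨this, this⟩
  · have h0 : ‖(0 : Space d)‖ ≤ 1 := by simp
    have h1 : ∀ j : Fin d, ‖basisVec j‖ ≤ 1 := fun j => (norm_basisVec j).le
    have h2 : translationEnergy (T u) ≤
        ∑ _j : Fin d, 12 * (ENNReal.ofReal (5 * R) * sigmaHalfSq u) +
          ∑ _j : Fin d, 12 * (ENNReal.ofReal (5 * R) * sigmaHalfSq u) :=
      add_le_add (Finset.sum_le_sum fun j _ => hT.directionEnergy_le hR h0 (h1 j) u)
        (Finset.sum_le_sum fun j _ => hT.directionEnergy_le hR (h1 j) h0 u)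
    rw [Finset.sum_const, Finset.card_univ, Fintype.card_fin, nsmul_eq_mul] at h2
    have h3 : ENNReal.ofReal (‖u‖ ^ 2) ≤ sigmaHalfSq u := le_add_self
    calc _ ≤ _ := sigmaHalfSq_le_translationEnergy (T u)
      _ ≤ ENNReal.ofReal (Real.pi ^ 2 / 4) *
          (d * (12 * (ENNReal.ofReal (5 * R) * sigmaHalfSq u)) +
            d * (12 * (ENNReal.ofReal (5 * R) * sigmaHalfSq u))) + sigmaHalfSq u := by
          rw [T.norm_map]
          gcongr
      _ = _ := by ring

theorem lintegral_norm_add_sq_le (w : Space d → ℝ) (hw : Continuous w) (hw0 : ∀ x, 0 ≤ w x)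
    (u v : L2 d) :
    ∫⁻ x : Space d, ENNReal.ofReal (w x * ‖(u + v) x‖ ^ 2) ≤
      2 * (∫⁻ x : Space d, ENNReal.ofReal (w x * ‖u x‖ ^ 2)) +
        2 * ∫⁻ x : Space d, ENNReal.ofReal (w x * ‖v x‖ ^ 2) := by
  have hm : ∀ u : L2 d, Measurable fun x => ENNReal.ofReal (w x * ‖u x‖ ^ 2) := fun u =>
    (hw.measurable.mul ((Lp.stronglyMeasurable u).measurable.norm.pow_const 2)).ennreal_ofReal
  rw [← lintegral_const_mul _ (hm u), ← lintegral_const_mul _ (hm v),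
    ← lintegral_add_left ((hm u).const_mul 2)]
  refine lintegral_mono_ae ?_
  filter_upwards [Lp.coeFn_add u v] with x hx
  have h0 := hw0 x
  have e2 : ∀ r : ℝ, 2 * ENNReal.ofReal r = ENNReal.ofReal (2 * r) := fun r => by
    rw [ENNReal.ofReal_mul (by norm_num), ENNReal.ofReal_ofNat]
  rw [hx, Pi.add_apply, e2, e2, ← ENNReal.ofReal_add (by positivity) (by positivity)]
  refine ENNReal.ofReal_le_ofReal ?_
  have h1 : ‖u x + v x‖ ^ 2 ≤ 2 * ‖u x‖ ^ 2 + 2 * ‖v x‖ ^ 2 := by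
    nlinarith [norm_add_le (u x) (v x), norm_nonneg (u x + v x), norm_nonneg (u x),
      norm_nonneg (v x), sq_nonneg (‖u x‖ - ‖v x‖)]
  calc w x * ‖u x + v x‖ ^ 2 ≤ w x * (2 * ‖u x‖ ^ 2 + 2 * ‖v x‖ ^ 2) := by gcongr
    _ = _ := by ring

theorem ofReal_norm_add_sq_le (u v : L2 d) : ENNReal.ofReal (‖u + v‖ ^ 2) ≤
    2 * ENNReal.ofReal (‖u‖ ^ 2) + 2 * ENNReal.ofReal (‖v‖ ^ 2) := by
  have h := lintegral_norm_add_sq_le (fun _ => 1) continuous_const (fun _ => zero_le_one) u v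
  simpa only [one_mul, ← norm_sq_eq_lintegral] using h

theorem sigmaHalfSq_add_le (u v : L2 d) :
    sigmaHalfSq (u + v) ≤ 2 * sigmaHalfSq u + 2 * sigmaHalfSq v := by
  have h1 := lintegral_norm_add_sq_le (fun x => ‖x‖) continuous_norm (fun _ => norm_nonneg _) u v
  have h2 := lintegral_norm_add_sq_le (fun x => 2 * Real.pi * ‖x‖) (by fun_prop)
    (fun _ => by positivity) (fourierU u) (fourierU v)
  rw [← map_add] at h2
  refine (add_le_add (add_le_add h1 h2) (ofReal_norm_add_sq_le u v)).trans_eq ?_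
  rw [sigmaHalfSq, sigmaHalfSq]
  ring

/-- Dominated convergence in the translation parameter `ε`: strong convergence in `L²` together with
a uniform translation bound gives convergence in `Σ^{1/2}`. -/
theorem TranslationBound.tendsto_directionEnergy {ι : Type*} {l : Filter ι}
    [l.IsCountablyGenerated] {R : ℝ} (hR : 0 ≤ R) {T : ι → (L2 d ≃ₗᵢ[ℂ] L2 d)}
    {T₀ : L2 d ≃ₗᵢ[ℂ] L2 d} (hT : ∀ᶠ n in l, TranslationBound R (T n)) (hT₀ : TranslationBound R T₀)
    {u : L2 d} (hu : sigmaHalfSq u < ∞) (h : Tendsto (fun n => T n u) l (𝓝 (T₀ u)))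
    {q p : Space d} (hq : ‖q‖ ≤ 1) (hp : ‖p‖ ≤ 1) :
    Tendsto (fun n => directionEnergy q p (T n u - T₀ u)) l (𝓝 0) := by
  have hz : (0 : ℝ≥0∞) = ∫⁻ _ in Set.Ioi (0 : ℝ), 0 := by simp
  rw [hz]
  have hm : ∀ v : L2 d, Measurable fun ε : ℝ =>
      ENNReal.ofReal (‖weyl (ε • q) (ε • p) v - v‖ ^ 2) * ENNReal.ofReal (ε ^ 2)⁻¹ := by
    intro v
    have := continuous_weyl_smul q p v
    refine Measurable.mul (Measurable.ennreal_ofReal (Continuous.measurable ?_)) (by fun_prop)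
    fun_prop
  refine tendsto_lintegral_filter_of_dominated_convergence
    (fun ε => 48 * (modulus R ε u * ENNReal.ofReal (ε ^ 2)⁻¹))
    (Eventually.of_forall fun n => hm _) ?_ ?_ ?_
  · filter_upwards [hT] with n hn
    refine (ae_restrict_iff' measurableSet_Ioi).2 (Eventually.of_forall fun ε hε => ?_)
    rw [← mul_assoc]
    gcongr
    have e : weyl (ε • q) (ε • p) (T n u - T₀ u) - (T n u - T₀ u) =
        (weyl (ε • q) (ε • p) (T n u) - T n u) + -(weyl (ε • q) (ε • p) (T₀ u) - T₀ u) := by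
      rw [map_sub]; abel
    rw [e]
    refine (ofReal_norm_add_sq_le _ _).trans ?_
    rw [norm_neg]
    calc _ ≤ 2 * (12 * modulus R ε u) + 2 * (12 * modulus R ε u) := by
          gcongr
          · exact hn u ε hε q p hq hp
          · exact hT₀ u ε hε q p hq hp
      _ = _ := by ring
  · rw [lintegral_const_mul' _ _ (by norm_num)]
    refine (ENNReal.mul_lt_top (by norm_num) ((lintegral_modulus_le hR u).trans_lt ?_)).ne
    exact ENNReal.mul_lt_top ENNReal.ofReal_lt_top hu
  · refine Eventually.of_forall fun ε => ?_
    have h1 : Tendsto (fun n => T n u - T₀ u) l (𝓝 0) := by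
      simpa using h.sub_const (T₀ u)
    have h2 : Tendsto (fun n => ‖weyl (ε • q) (ε • p) (T n u - T₀ u) - (T n u - T₀ u)‖ ^ 2) l
        (𝓝 0) := by
      have := ((((weyl (ε • q) (ε • p)).continuous.tendsto 0).comp h1).sub h1).norm.pow 2
      simpa using this
    have h3 := ENNReal.Tendsto.mul_const (b := ENNReal.ofReal (ε ^ 2)⁻¹)
      ((ENNReal.continuous_ofReal.tendsto _).comp h2) (Or.inr ENNReal.ofReal_ne_top)
    simpa using h3

theorem TranslationBound.tendsto_apply {ι : Type*} {l : Filter ι}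
    [l.IsCountablyGenerated] {R : ℝ} (hR : 0 ≤ R) {T : ι → (L2 d ≃ₗᵢ[ℂ] L2 d)}
    {T₀ : L2 d ≃ₗᵢ[ℂ] L2 d} (hT : ∀ᶠ n in l, TranslationBound R (T n)) (hT₀ : TranslationBound R T₀)
    {u : ι → L2 d} {u₀ : L2 d} (hu₀ : sigmaHalfSq u₀ < ∞)
    (hu : Tendsto (fun n => sigmaHalfSq (u n - u₀)) l (𝓝 0))
    (h : Tendsto (fun n => T n u₀) l (𝓝 (T₀ u₀))) :
    Tendsto (fun n => sigmaHalfSq (T n (u n) - T₀ u₀)) l (𝓝 0) := by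
  obtain ⟨C, hC, hCb⟩ := TranslationBound.sigmaHalfSq_le (d := d) hR
  have h0 : ‖(0 : Space d)‖ ≤ 1 := by simp
  have h1 : ∀ j : Fin d, ‖basisVec j‖ ≤ 1 := fun j => (norm_basisVec j).le
  have hE : Tendsto (fun n => translationEnergy (T n u₀ - T₀ u₀)) l (𝓝 0) := by
    have e1 := tendsto_finsetSum Finset.univ fun (j : Fin d) _ =>
      TranslationBound.tendsto_directionEnergy hR hT hT₀ hu₀ h h0 (h1 j)
    have e2 := tendsto_finsetSum Finset.univ fun (j : Fin d) _ =>
      TranslationBound.tendsto_directionEnergy hR hT hT₀ hu₀ h (h1 j) h0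
    simpa [translationEnergy] using e1.add e2
  have hn : Tendsto (fun n => ENNReal.ofReal (‖T n u₀ - T₀ u₀‖ ^ 2)) l (𝓝 0) := by
    have := (h.sub_const (T₀ u₀)).norm.pow 2
    have h2 := (ENNReal.continuous_ofReal.tendsto _).comp this
    rwa [sub_self, norm_zero, zero_pow two_ne_zero, ENNReal.ofReal_zero] at h2
  have hb : Tendsto (fun n => 2 * (C * sigmaHalfSq (u n - u₀)) +
      2 * (ENNReal.ofReal (Real.pi ^ 2 / 4) * translationEnergy (T n u₀ - T₀ u₀) +
        ENNReal.ofReal (‖T n u₀ - T₀ u₀‖ ^ 2))) l (𝓝 0) := by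
    have a1 := ENNReal.Tendsto.const_mul (a := 2)
      (ENNReal.Tendsto.const_mul (a := C) hu (Or.inr hC)) (Or.inr (by simp))
    have a2 := ENNReal.Tendsto.const_mul (a := 2) ((ENNReal.Tendsto.const_mul
      (a := ENNReal.ofReal (Real.pi ^ 2 / 4)) hE (Or.inr ENNReal.ofReal_ne_top)).add hn)
      (Or.inr (by simp))
    simpa using a1.add a2
  refine tendsto_of_tendsto_of_tendsto_of_le_of_le' tendsto_const_nhds hb
    (Eventually.of_forall fun _ => zero_le) ?_
  filter_upwards [hT] with n hn'
  have e : T n (u n) - T₀ u₀ = T n (u n - u₀) + (T n u₀ - T₀ u₀) := by rw [map_sub]; abel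
  rw [e]
  refine (sigmaHalfSq_add_le _ _).trans ?_
  gcongr
  · exact hCb _ hn' _
  · exact sigmaHalfSq_le_translationEnergy _

/-- Joint continuity of the framed propagators on `Σ^{1/2}`, in the parameters and the datum. -/
theorem tendsto_framed {ι : Type*} {l : Filter ι} [l.IsCountablyGenerated]
    {θ κ t : ι → ℝ} {q p : ι → Space d} {θ₀ κ₀ t₀ : ℝ} {q₀ p₀ : Space d}
    (hθ : Tendsto θ l (𝓝 θ₀)) (hq : Tendsto q l (𝓝 q₀)) (hp : Tendsto p l (𝓝 p₀))
    (hκ : Tendsto κ l (𝓝 κ₀)) (ht : Tendsto t l (𝓝 t₀)) {u : ι → L2 d} {u₀ : L2 d}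
    (hu₀ : sigmaHalfSq u₀ < ∞) (hu : Tendsto (fun n => sigmaHalfSq (u n - u₀)) l (𝓝 0)) :
    Tendsto (fun n => sigmaHalfSq (framed (θ n) (q n) (p n) (κ n) (t n) (u n) -
      framed θ₀ q₀ p₀ κ₀ t₀ u₀)) l (𝓝 0) := by
  set B : ℝ := ‖q₀‖ + ‖p₀‖ + |κ₀| + |t₀| + 1 with hB
  have b1 := norm_nonneg q₀
  have b2 := norm_nonneg p₀
  have b3 := abs_nonneg κ₀
  have b4 := abs_nonneg t₀
  obtain ⟨R, hR, hRb⟩ := exists_translationBound_framed (d := d) B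
  refine TranslationBound.tendsto_apply hR ?_ (hRb _ _ _ _ _ (by linarith) (by linarith)
    (by linarith) (by linarith)) hu₀ hu ?_
  · filter_upwards [hq.norm.eventually_lt_const (lt_add_one _),
      hp.norm.eventually_lt_const (lt_add_one _), hκ.abs.eventually_lt_const (lt_add_one _),
      ht.abs.eventually_lt_const (lt_add_one _)] with n h1 h2 h3 h4
    exact hRb _ _ _ _ _ (by linarith) (by linarith) (by linarith) (by linarith)
  · simp only [framed_apply]
    refine Tendsto.smul ?_ ?_
    · exact (Complex.continuous_exp.tendsto _).comp
        (((Complex.continuous_ofReal.tendsto _).comp hθ).mul_const _)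
    · have h1 := tendsto_weyl hq hp (propagator κ₀ t₀ u₀)
      have h2 := tendsto_propagator hκ ht u₀
      rw [tendsto_iff_norm_sub_tendsto_zero] at h1 h2 ⊢
      refine squeeze_zero (fun _ => norm_nonneg _) (fun n => ?_) (by simpa using h2.add h1)
      refine (norm_sub_le_norm_sub_add_norm_sub _
        (weyl (q n) (p n) (propagator κ₀ t₀ u₀)) _).trans (add_le_add ?_ le_rfl)
      rw [← map_sub, LinearIsometryEquiv.norm_map]

/-! ### First moments -/

theorem position_lt_top {u : L2 d} (hu : sigmaHalfSq u < ∞) :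
    ∫⁻ x : Space d, ENNReal.ofReal (‖x‖ * ‖u x‖ ^ 2) < ∞ :=
  lt_of_le_of_lt (le_self_add.trans le_self_add) hu

theorem two_pi_mul_position_fourier (u : L2 d) :
    ∫⁻ ξ : Space d, ENNReal.ofReal (2 * Real.pi * ‖ξ‖ * ‖fourierU u ξ‖ ^ 2) =
      ENNReal.ofReal (2 * Real.pi) *
        ∫⁻ ξ : Space d, ENNReal.ofReal (‖ξ‖ * ‖fourierU u ξ‖ ^ 2) := by
  rw [← lintegral_const_mul' _ _ ENNReal.ofReal_ne_top]
  refine lintegral_congr fun ξ => ?_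
  rw [mul_assoc, ENNReal.ofReal_mul (by positivity)]

theorem position_fourier_le (u : L2 d) :
    ∫⁻ ξ : Space d, ENNReal.ofReal (‖ξ‖ * ‖fourierU u ξ‖ ^ 2) ≤ sigmaHalfSq u := by
  have h1 : (1 : ℝ≥0∞) ≤ ENNReal.ofReal (2 * Real.pi) := by
    rw [← ENNReal.ofReal_one]
    exact ENNReal.ofReal_le_ofReal (by linarith [Real.pi_gt_three])
  calc _ ≤ _ := le_mul_of_one_le_left zero_le h1
    _ = _ := (two_pi_mul_position_fourier u).symm
    _ ≤ _ := le_add_self.trans le_self_add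

theorem momentum_lt_top {u : L2 d} (hu : sigmaHalfSq u < ∞) :
    ∫⁻ ξ : Space d, ENNReal.ofReal (‖ξ‖ * ‖fourierU u ξ‖ ^ 2) < ∞ :=
  (position_fourier_le u).trans_lt hu

theorem integrable_position {u : L2 d}
    (hu : ∫⁻ x : Space d, ENNReal.ofReal (‖x‖ * ‖u x‖ ^ 2) < ∞) :
    Integrable fun x : Space d => ‖u x‖ ^ 2 • x := by
  have hm : Measurable fun x => ‖u x‖ ^ 2 := (Lp.stronglyMeasurable u).measurable.norm.pow_const 2
  refine ⟨(hm.smul measurable_id).aestronglyMeasurable, ?_⟩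
  rw [hasFiniteIntegral_iff_norm]
  refine lt_of_eq_of_lt (lintegral_congr fun x => ?_) hu
  rw [norm_smul, Real.norm_of_nonneg (by positivity), mul_comm]

theorem integrable_norm_sq (u : L2 d) : Integrable fun x : Space d => ‖u x‖ ^ 2 :=
  (Lp.memLp u).integrable_norm_pow (by norm_num)

theorem integral_norm_sq (u : L2 d) : ∫ x : Space d, ‖u x‖ ^ 2 = ‖u‖ ^ 2 := by
  have h := norm_sq_eq_lintegral u
  rw [← ofReal_integral_eq_lintegral_ofReal (integrable_norm_sq u)
    (Eventually.of_forall fun x => by positivity)] at h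
  exact ((ENNReal.ofReal_eq_ofReal_iff (by positivity)
    (integral_nonneg fun x => by positivity)).1 h).symm

theorem inner_meanPosition {u : L2 d}
    (hu : ∫⁻ x : Space d, ENNReal.ofReal (‖x‖ * ‖u x‖ ^ 2) < ∞) (p : Space d) :
    (inner ℝ (meanPosition u) p : ℝ) = ∫ x : Space d, inner ℝ x p * ‖u x‖ ^ 2 := by
  have h := (innerSL ℝ p).integral_comp_comm (integrable_position hu)
  rw [real_inner_comm, meanPosition]
  refine Eq.trans h.symm (integral_congr_ae (Eventually.of_forall fun x => ?_))
  simp only [innerSL_apply_apply, inner_smul_right, real_inner_comm]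
  ring

theorem meanMomentum_eq (u : L2 d) :
    meanMomentum u = (2 * Real.pi) • meanPosition (fourierU u) := by
  rw [meanMomentum, meanPosition, ← integral_smul]
  refine integral_congr_ae (Eventually.of_forall fun ξ => ?_)
  change ‖fourierU u ξ‖ ^ 2 • (2 * Real.pi) • ξ = (2 * Real.pi) • ‖fourierU u ξ‖ ^ 2 • ξ
  rw [smul_comm]

theorem inner_phase_self (θ : Space d → ℝ) (hθ : Continuous θ) (u : L2 d) :
    inner ℂ u (phase θ hθ u) =
      ∫ x : Space d, Complex.exp ((θ x : ℂ) * Complex.I) * ((‖u x‖ ^ 2 : ℝ) : ℂ) := by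
  rw [L2.inner_def]
  refine integral_congr_ae ?_
  filter_upwards [phase_coe θ hθ u] with x hx
  rw [hx, ← smul_eq_mul, inner_smul_right, inner_self_eq_norm_sq_to_K]
  push_cast
  rfl

theorem hasDerivAt_integral_expI {w : Space d → ℝ} (hw : Continuous w) (u : L2 d)
    (hi : Integrable fun x : Space d => w x * ‖u x‖ ^ 2) :
    HasDerivAt (fun ε : ℝ => ∫ x : Space d,
      Complex.exp (((ε * w x : ℝ) : ℂ) * Complex.I) * ((‖u x‖ ^ 2 : ℝ) : ℂ))
      (Complex.I * ((∫ x : Space d, w x * ‖u x‖ ^ 2 : ℝ) : ℂ)) 0 := by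
  have hm : Measurable fun x => ‖u x‖ ^ 2 := (Lp.stronglyMeasurable u).measurable.norm.pow_const 2
  have hwm := hw.measurable
  have h := hasDerivAt_integral_of_dominated_loc_of_deriv_le (μ := volume) (𝕜 := ℝ)
    (F := fun (ε : ℝ) (x : Space d) =>
      Complex.exp (((ε * w x : ℝ) : ℂ) * Complex.I) * ((‖u x‖ ^ 2 : ℝ) : ℂ))
    (F' := fun (ε : ℝ) (x : Space d) => Complex.exp (((ε * w x : ℝ) : ℂ) * Complex.I) *
      ((w x : ℂ) * Complex.I) * ((‖u x‖ ^ 2 : ℝ) : ℂ)) (x₀ := 0) (s := Set.univ)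
    (bound := fun x => ‖w x * ‖u x‖ ^ 2‖) univ_mem ?_ ?_ ?_ ?_ hi.norm ?_
  · refine h.2.congr_deriv ?_
    rw [← integral_complex_ofReal, ← integral_const_mul]
    refine integral_congr_ae (Eventually.of_forall fun x => ?_)
    simp only [zero_mul, Complex.ofReal_zero, Complex.exp_zero, one_mul]
    push_cast
    ring
  · exact Eventually.of_forall fun ε => Measurable.aestronglyMeasurable (by fun_prop)
  · simpa using (integrable_norm_sq u).ofReal (𝕜 := ℂ)
  · exact Measurable.aestronglyMeasurable (by fun_prop)
  · refine Eventually.of_forall fun x ε _ => ?_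
    rw [norm_mul, norm_mul, norm_mul, Complex.norm_exp_ofReal_mul_I, Complex.norm_I,
      Complex.norm_real, Complex.norm_real, norm_mul]
    simp
  · refine Eventually.of_forall fun x ε _ => ?_
    have h1 : HasDerivAt (fun ε : ℝ => ((ε * w x : ℝ) : ℂ) * Complex.I) ((w x : ℂ) * Complex.I)
        ε := by
      have := (((hasDerivAt_id ε).mul_const (w x)).ofReal_comp).mul_const Complex.I
      simpa using this
    exact h1.cexp.mul_const _

theorem hasDerivAt_inner_weyl_position {u : L2 d}
    (hu : ∫⁻ x : Space d, ENNReal.ofReal (‖x‖ * ‖u x‖ ^ 2) < ∞) (p : Space d) :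
    HasDerivAt (fun ε : ℝ => inner ℂ u (weyl 0 (ε • p) u))
      (Complex.I * ((inner ℝ (meanPosition u) p : ℝ) : ℂ)) 0 := by
  have hi : Integrable fun x : Space d => inner ℝ x p * ‖u x‖ ^ 2 := by
    have := (integrable_position hu).inner_const (𝕜 := ℝ) p
    refine this.congr (Eventually.of_forall fun x => ?_)
    simp only [inner_smul_left, RCLike.conj_to_real]
    ring
  have h := hasDerivAt_integral_expI (w := fun x => inner ℝ x p) (by fun_prop) u hi
  rw [← inner_meanPosition hu] at h
  refine h.congr_of_eventuallyEq (Eventually.of_forall fun ε => ?_)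
  simp only [weyl_zero_left, inner_phase_self, inner_smul_right]

theorem hasDerivAt_inner_weyl_momentum {u : L2 d}
    (hu : ∫⁻ x : Space d, ENNReal.ofReal (‖x‖ * ‖fourierU u x‖ ^ 2) < ∞) (q : Space d) :
    HasDerivAt (fun ε : ℝ => inner ℂ u (weyl (ε • q) 0 u))
      (-(Complex.I * ((inner ℝ (meanMomentum u) q : ℝ) : ℂ))) 0 := by
  have h := hasDerivAt_inner_weyl_position hu (-(2 * Real.pi) • q)
  refine (h.congr_of_eventuallyEq (Eventually.of_forall fun ε => ?_)).congr_deriv ?_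
  · change inner ℂ u (weyl (ε • q) 0 u) = inner ℂ (fourierU u) _
    rw [← fourierU.inner_map_map, weyl_zero_right, fourierU_translate, weyl_zero_left]
    simp only [inner_phase_self, shiftSymbol, inner_smul_right]
    refine integral_congr_ae (Eventually.of_forall fun x => ?_)
    simp only
    congr 4
    ring
  · rw [meanMomentum_eq, inner_smul_left, inner_smul_right, RCLike.conj_to_real]
    push_cast
    ring

theorem hasDerivAt_zero_of_norm_le {E : Type*} [NormedAddCommGroup E] [NormedSpace ℝ E] {f : ℝ → E}
    {g : ℝ → ℝ} (hg : HasDerivAt g 0 0) (hg0 : g 0 = 0) (h : ∀ ε, ‖f ε‖ ≤ g ε) :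
    HasDerivAt f 0 0 := by
  have hf0 : f 0 = 0 := norm_le_zero_iff.1 ((h 0).trans hg0.le)
  rw [hasDerivAt_iff_isLittleO] at hg ⊢
  simp only [hf0, hg0, smul_zero, sub_zero] at hg ⊢
  refine (Asymptotics.IsBigO.of_bound 1 (Eventually.of_forall fun ε => ?_)).trans_isLittleO hg
  rw [one_mul]
  exact (h ε).trans (le_abs_self _)

/-- For an isometry the norm of `T u - u` is determined by the real part of `⟨u, T u⟩`. -/
theorem norm_isometry_sub_sq (T : L2 d ≃ₗᵢ[ℂ] L2 d) (u : L2 d) :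
    ‖T u - u‖ ^ 2 = 2 * ‖u‖ ^ 2 - 2 * (inner ℂ u (T u)).re := by
  have h := norm_sub_sq (𝕜 := ℂ) (T u) u
  rw [T.norm_map] at h
  have h2 : RCLike.re (inner ℂ (T u) u) = (inner ℂ u (T u)).re := inner_re_symm _ _
  rw [h, h2]
  ring

theorem hasDerivAt_norm_isometry_sub_sq {T : ℝ → (L2 d ≃ₗᵢ[ℂ] L2 d)} {u : L2 d} {c : ℝ}
    (h : HasDerivAt (fun ε => inner ℂ u (T ε u)) (Complex.I * (c : ℂ)) 0) :
    HasDerivAt (fun ε => ‖T ε u - u‖ ^ 2) 0 0 := by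
  have h1 : HasDerivAt (fun ε => (inner ℂ u (T ε u)).re) (Complex.I * (c : ℂ)).re 0 :=
    (Complex.reCLM.hasFDerivAt.comp_hasDerivAt 0 h)
  refine (((h1.const_mul 2).const_sub (2 * ‖u‖ ^ 2)).congr_of_eventuallyEq
    (Eventually.of_forall fun ε => norm_isometry_sub_sq _ _)).congr_deriv ?_
  simp

/-- The phase in `weyl_eq_weyl_weyl` is of second order, and does not contribute to first
derivatives at the origin. -/
theorem hasDerivAt_weyl_cocycle (q p : Space d) :
    HasDerivAt (fun ε : ℝ => Complex.exp (((-(inner ℝ (ε • q) (ε • p) : ℝ) / 2 : ℝ) : ℂ) *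
      Complex.I)) 0 0 := by
  have h3 : HasDerivAt (fun ε : ℝ => -(inner ℝ (ε • q) (ε • p) : ℝ) / 2) 0 0 := by
    have h4 := ((hasDerivAt_id (0 : ℝ)).pow 2).const_mul (-(inner ℝ q p : ℝ) / 2)
    refine (h4.congr_of_eventuallyEq (Eventually.of_forall fun ε => ?_)).congr_deriv (by simp)
    simp only [inner_smul_left, inner_smul_right, RCLike.conj_to_real, id, Pi.pow_apply]
    ring
  have := ((h3.ofReal_comp).mul_const Complex.I).cexp
  simpa using this

/-- The first moments are the derivatives at the origin of the Fourier-Wigner transform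
`(q, p) ↦ ⟨u, W(q, p) u⟩`. -/
theorem hasDerivAt_inner_weyl {u : L2 d} (hu : sigmaHalfSq u < ∞) (q p : Space d) :
    HasDerivAt (fun ε : ℝ => inner ℂ u (weyl (ε • q) (ε • p) u))
      (Complex.I * ((inner ℝ (meanPosition u) p - inner ℝ (meanMomentum u) q : ℝ) : ℂ)) 0 := by
  have hpos := position_lt_top hu
  have hmom := momentum_lt_top hu
  have h1 := hasDerivAt_inner_weyl_position hpos p
  have h2 := hasDerivAt_inner_weyl_momentum hmom q
  have n1 := hasDerivAt_norm_isometry_sub_sq (hasDerivAt_inner_weyl_position hpos (-p)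
    |>.congr_of_eventuallyEq (f₁ := fun ε : ℝ => inner ℂ u (weyl 0 (-(ε • p)) u))
      (Eventually.of_forall fun ε => by simp only [smul_neg]))
  have n2 := hasDerivAt_norm_isometry_sub_sq (c := -inner ℝ (meanMomentum u) q)
    (h2.congr_deriv (by push_cast; ring))
  -- the remainder in the expansion of the product of the two translations
  have hR : HasDerivAt (fun ε : ℝ => inner ℂ (weyl 0 (-(ε • p)) u - u) (weyl (ε • q) 0 u - u))
      0 0 := by
    refine hasDerivAt_zero_of_norm_le (g := fun ε => ‖weyl 0 (-(ε • p)) u - u‖ ^ 2 +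
      ‖weyl (ε • q) 0 u - u‖ ^ 2) ((n1.add n2).congr_deriv (add_zero 0))
      (by simp [weyl_zero]) fun ε => ?_
    refine (norm_inner_le_norm _ _).trans ?_
    nlinarith [sq_nonneg (‖weyl 0 (-(ε • p)) u - u‖ - ‖weyl (ε • q) 0 u - u‖),
      sq_nonneg ‖weyl 0 (-(ε • p)) u - u‖, sq_nonneg ‖weyl (ε • q) 0 u - u‖]
  have hsum := ((h1.add h2).sub_const (inner ℂ u u)).add hR
  have hprod := (hasDerivAt_weyl_cocycle q p).mul hsum
  refine (hprod.congr_of_eventuallyEq (Eventually.of_forall fun ε => ?_)).congr_deriv ?_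
  · rw [weyl_eq_weyl_weyl, inner_smul_right]
    simp only [Pi.mul_apply, Pi.add_apply]
    congr 1
    have e1 : ∀ v : L2 d, inner ℂ u (weyl 0 (ε • p) v) = inner ℂ (weyl 0 (-(ε • p)) u) v := by
      intro v
      rw [← (weyl 0 (-(ε • p))).inner_map_map u, weyl_weyl]
      simp [weyl_zero]
    rw [e1, e1, inner_sub_left, inner_sub_right, inner_sub_right]
    ring
  · simp only [zero_smul, inner_zero_left, neg_zero, zero_div, Complex.ofReal_zero,
      zero_mul, Complex.exp_zero, one_mul, zero_add, add_zero]
    push_cast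
    ring

theorem sigmaHalfSq_framed_lt_top (θ : ℝ) (q p : Space d) (κ t : ℝ) {u : L2 d}
    (hu : sigmaHalfSq u < ∞) : sigmaHalfSq (framed θ q p κ t u) < ∞ := by
  obtain ⟨R, hR, hRb⟩ := exists_translationBound_framed (d := d) (‖q‖ + ‖p‖ + |κ| + |t|)
  have b1 := norm_nonneg q
  have b2 := norm_nonneg p
  have b3 := abs_nonneg κ
  have b4 := abs_nonneg t
  obtain ⟨C, hC, hCb⟩ := TranslationBound.sigmaHalfSq_le (d := d) hR
  exact (hCb _ (hRb θ q p κ t (by linarith) (by linarith) (by linarith) (by linarith)) u).trans_lt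
    (ENNReal.mul_lt_top hC.lt_top hu)

/-- The first moments of a moved state: a form of Ehrenfest's theorem. -/
theorem moments_framed_inner (θ : ℝ) (q₀ p₀ : Space d) (κ t : ℝ) {u : L2 d}
    (hu : sigmaHalfSq u < ∞) (q p : Space d) :
    (inner ℝ (meanPosition (framed θ q₀ p₀ κ t u)) p -
      inner ℝ (meanMomentum (framed θ q₀ p₀ κ t u)) q : ℝ) =
    (inner ℝ q₀ p - inner ℝ q p₀) * mass u +
      (inner ℝ (meanPosition u) (cosK κ t • p + (κ * sinK κ t) • q) -
        inner ℝ (meanMomentum u) (cosK κ t • q - sinK κ t • p)) := by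
  have h1 := hasDerivAt_inner_weyl (sigmaHalfSq_framed_lt_top θ q₀ p₀ κ t hu) q p
  have h2 := hasDerivAt_inner_weyl hu (cosK κ t • q - sinK κ t • p)
    (cosK κ t • p + (κ * sinK κ t) • q)
  have h3 : HasDerivAt (fun ε : ℝ => Complex.exp (((ε * (inner ℝ q₀ p - inner ℝ q p₀) : ℝ) : ℂ) *
      Complex.I)) (((inner ℝ q₀ p - inner ℝ q p₀ : ℝ) : ℂ) * Complex.I) 0 := by
    have := ((((hasDerivAt_id (0 : ℝ)).mul_const
        (inner ℝ q₀ p - inner ℝ q p₀)).ofReal_comp).mul_const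
      Complex.I).cexp
    simpa using this
  have h4 := h3.mul h2
  have h5 := h1.unique (h4.congr_of_eventuallyEq (Eventually.of_forall fun ε => by
    simp only [Pi.mul_apply]
    rw [weyl_framed, (framed θ q₀ p₀ κ t).inner_map_map, inner_smul_right]
    have e1 : cosK κ t • ε • q - sinK κ t • ε • p = ε • (cosK κ t • q - sinK κ t • p) := by module
    have e2 : cosK κ t • ε • p + (κ * sinK κ t) • ε • q =
      ε • (cosK κ t • p + (κ * sinK κ t) • q) := by module
    have e3 : (inner ℝ q₀ (ε • p) - inner ℝ (ε • q) p₀ : ℝ) =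
        ε * (inner ℝ q₀ p - inner ℝ q p₀ : ℝ) := by
      rw [inner_smul_left, inner_smul_right, RCLike.conj_to_real]; ring
    rw [e1, e2, e3]))
  simp only [zero_smul, weyl_zero, zero_mul, Complex.ofReal_zero, Complex.exp_zero, one_mul,
    LinearIsometryEquiv.coe_refl, id, inner_self_eq_norm_sq_to_K] at h5
  have h6 : Complex.I * ((inner ℝ (meanPosition (framed θ q₀ p₀ κ t u)) p -
      inner ℝ (meanMomentum (framed θ q₀ p₀ κ t u)) q : ℝ) : ℂ) = Complex.I *
      (((inner ℝ q₀ p - inner ℝ q p₀) * mass u +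
      (inner ℝ (meanPosition u) (cosK κ t • p + (κ * sinK κ t) • q) -
        inner ℝ (meanMomentum u) (cosK κ t • q - sinK κ t • p)) : ℝ) : ℂ) := by
    rw [h5]
    simp only [mass]
    push_cast
    simp only [Complex.coe_algebraMap]
    ring
  exact Complex.ofReal_injective (mul_left_cancel₀ Complex.I_ne_zero h6)

/-- The centre of a state moves along a trajectory of the classical harmonic oscillator. -/
theorem moments_framed (θ : ℝ) (q₀ p₀ : Space d) (κ t : ℝ) {u : L2 d} (hu : sigmaHalfSq u < ∞) :
    meanPosition (framed θ q₀ p₀ κ t u) =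
      mass u • q₀ + gSol κ t (meanMomentum u) (meanPosition u) ∧
    meanMomentum (framed θ q₀ p₀ κ t u) =
      mass u • p₀ + gSol' κ t (meanMomentum u) (meanPosition u) := by
  constructor
  · refine ext_inner_right ℝ fun p => ?_
    have h := moments_framed_inner θ q₀ p₀ κ t hu 0 p
    simp only [inner_zero_right, inner_zero_left, sub_zero, smul_zero, add_zero, zero_sub,
      inner_neg_right, inner_smul_right] at h
    rw [h, gSol_eq]
    simp only [inner_add_left, inner_smul_left, RCLike.conj_to_real]
    ring
  · refine ext_inner_right ℝ fun q => ?_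
    have h := moments_framed_inner θ q₀ p₀ κ t hu q 0
    simp only [inner_zero_right, sub_zero, smul_zero, zero_add, zero_sub,
      inner_smul_right] at h
    rw [gSol'_eq]
    simp only [inner_add_left, inner_sub_left, inner_smul_left, RCLike.conj_to_real]
    rw [real_inner_comm p₀ q] at *
    linarith

/-- The quadratic functional `X` is continuous, by
`||u|² - |v|²| ≤ (1 + 1/δ) |u - v|² + δ |v|²`. -/
theorem norm_meanPosition_sub_le {u v : L2 d}
    (hu : ∫⁻ x : Space d, ENNReal.ofReal (‖x‖ * ‖u x‖ ^ 2) < ∞)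
    (hv : ∫⁻ x : Space d, ENNReal.ofReal (‖x‖ * ‖v x‖ ^ 2) < ∞)
    (hw : ∫⁻ x : Space d, ENNReal.ofReal (‖x‖ * ‖(u - v) x‖ ^ 2) < ∞) {δ : ℝ} (hδ : 0 < δ) :
    ‖meanPosition u - meanPosition v‖ ≤
      (1 + 1 / δ) * (∫⁻ x : Space d, ENNReal.ofReal (‖x‖ * ‖(u - v) x‖ ^ 2)).toReal +
        δ * (∫⁻ x : Space d, ENNReal.ofReal (‖x‖ * ‖v x‖ ^ 2)).toReal := by
  have hm : ∀ u : L2 d, Measurable fun x => ‖x‖ * ‖u x‖ ^ 2 := fun u =>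
    measurable_norm.mul ((Lp.stronglyMeasurable u).measurable.norm.pow_const 2)
  have hi : ∀ u : L2 d, ∫⁻ x : Space d, ENNReal.ofReal (‖x‖ * ‖u x‖ ^ 2) < ∞ →
      Integrable fun x : Space d => ‖x‖ * ‖u x‖ ^ 2 := fun u hu =>
    (integrable_position hu).norm.congr (Eventually.of_forall fun x => by
      simp only [norm_smul, norm_pow, norm_norm]; ring)
  have ht : ∀ u : L2 d, (∫⁻ x : Space d, ENNReal.ofReal (‖x‖ * ‖u x‖ ^ 2)).toReal =
      ∫ x : Space d, ‖x‖ * ‖u x‖ ^ 2 := fun u =>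
    (integral_eq_lintegral_of_nonneg_ae (Eventually.of_forall fun x => by positivity)
      (hm u).aestronglyMeasurable).symm
  rw [ht, ht, meanPosition, meanPosition,
    ← integral_sub (integrable_position hu) (integrable_position hv), ← integral_const_mul,
    ← integral_const_mul, ← integral_add ((hi _ hw).const_mul _) ((hi _ hv).const_mul _)]
  refine norm_integral_le_of_norm_le (((hi _ hw).const_mul _).add ((hi _ hv).const_mul _)) ?_
  filter_upwards [Lp.coeFn_sub u v] with x hx
  rw [hx, Pi.sub_apply, ← sub_smul, norm_smul, Real.norm_eq_abs]
  have key : |‖u x‖ ^ 2 - ‖v x‖ ^ 2| ≤ (1 + 1 / δ) * ‖u x - v x‖ ^ 2 + δ * ‖v x‖ ^ 2 := by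
    set a := ‖u x‖
    set b := ‖v x‖
    set c := ‖u x - v x‖
    have h1 : |a - b| ≤ c := abs_norm_sub_norm_le _ _
    have h2 : |a ^ 2 - b ^ 2| ≤ c * (c + 2 * b) := by
      have e : a ^ 2 - b ^ 2 = (a - b) * ((a - b) + 2 * b) := by ring
      rw [e, abs_mul]
      have hb : 0 ≤ b := norm_nonneg _
      have : |a - b + 2 * b| ≤ c + 2 * b :=
        (abs_add_le _ _).trans (add_le_add h1 (abs_of_nonneg (by positivity)).le)
      gcongr
    have h3 : 2 * (c * b) ≤ 1 / δ * c ^ 2 + δ * b ^ 2 := by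
      have h4 : 0 ≤ (c - δ * b) ^ 2 / δ := by positivity
      have e : (c - δ * b) ^ 2 / δ = 1 / δ * c ^ 2 + δ * b ^ 2 - 2 * (c * b) := by
        field_simp; ring
      linarith
    calc _ ≤ _ := h2
      _ = c ^ 2 + 2 * (c * b) := by ring
      _ ≤ c ^ 2 + (1 / δ * c ^ 2 + δ * b ^ 2) := by linarith
      _ = _ := by ring
  calc _ ≤ ((1 + 1 / δ) * ‖u x - v x‖ ^ 2 + δ * ‖v x‖ ^ 2) * ‖x‖ := by gcongr
    _ = _ := by ring

theorem tendsto_meanPosition {ι : Type*} {l : Filter ι} {u : ι → L2 d} {v : L2 d}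
    (hv : ∫⁻ x : Space d, ENNReal.ofReal (‖x‖ * ‖v x‖ ^ 2) < ∞)
    (h : Tendsto (fun n => ∫⁻ x : Space d, ENNReal.ofReal (‖x‖ * ‖(u n - v) x‖ ^ 2)) l (𝓝 0)) :
    Tendsto (fun n => meanPosition (u n)) l (𝓝 (meanPosition v)) := by
  set S := (∫⁻ x : Space d, ENNReal.ofReal (‖x‖ * ‖v x‖ ^ 2)).toReal with hS
  have hS0 : 0 ≤ S := ENNReal.toReal_nonneg
  have h' := (ENNReal.tendsto_toReal ENNReal.zero_ne_top).comp h
  rw [ENNReal.toReal_zero] at h'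
  rw [tendsto_iff_norm_sub_tendsto_zero, Metric.tendsto_nhds]
  intro ε hε
  have hδ : 0 < ε / (2 * (S + 1)) := by positivity
  have h1 := h'.const_mul (1 + 1 / (ε / (2 * (S + 1))))
  rw [mul_zero] at h1
  filter_upwards [h1.eventually_lt_const (half_pos hε), h.eventually_lt_const ENNReal.zero_lt_top]
    with n hn1 hn2
  rw [Real.dist_eq, sub_zero, abs_of_nonneg (norm_nonneg _)]
  have hu : ∫⁻ x : Space d, ENNReal.ofReal (‖x‖ * ‖u n x‖ ^ 2) < ∞ := by
    have := lintegral_norm_add_sq_le (fun x => ‖x‖) continuous_norm (fun _ => norm_nonneg _)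
      (u n - v) v
    rw [sub_add_cancel] at this
    exact this.trans_lt (ENNReal.add_lt_top.2 ⟨ENNReal.mul_lt_top (by simp) hn2,
      ENNReal.mul_lt_top (by simp) hv⟩)
  refine (norm_meanPosition_sub_le hu hv hn2 hδ).trans_lt ?_
  rw [← hS]
  have e : ε / (2 * (S + 1)) * S ≤ ε / 2 := by
    rw [div_mul_eq_mul_div, div_le_div_iff₀ (by positivity) (by norm_num)]
    nlinarith
  simp only [Function.comp] at hn1
  linarith

/-- The mass and the first moments are continuous on `Σ^{1/2}`. -/
theorem tendsto_moments {ι : Type*} {l : Filter ι} {u : ι → L2 d} {v : L2 d}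
    (hv : sigmaHalfSq v < ∞) (h : Tendsto (fun n => sigmaHalfSq (u n - v)) l (𝓝 0)) :
    Tendsto u l (𝓝 v) ∧ Tendsto (fun n => mass (u n)) l (𝓝 (mass v)) ∧
      Tendsto (fun n => meanPosition (u n)) l (𝓝 (meanPosition v)) ∧
      Tendsto (fun n => meanMomentum (u n)) l (𝓝 (meanMomentum v)) := by
  have h0 : Tendsto u l (𝓝 v) := by
    rw [tendsto_iff_norm_sub_tendsto_zero]
    have h1 : Tendsto (fun n => ENNReal.ofReal (‖u n - v‖ ^ 2)) l (𝓝 0) :=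
      tendsto_of_tendsto_of_tendsto_of_le_of_le tendsto_const_nhds h (fun _ => zero_le)
        fun n => le_add_self
    have h2 := (ENNReal.tendsto_toReal ENNReal.zero_ne_top).comp h1
    have h3 := (Real.continuous_sqrt.tendsto _).comp h2
    simpa [Function.comp_def, ENNReal.toReal_ofReal] using h3
  refine ⟨h0, h0.norm.pow 2, tendsto_meanPosition (position_lt_top hv) ?_, ?_⟩
  · exact tendsto_of_tendsto_of_tendsto_of_le_of_le tendsto_const_nhds h (fun _ => zero_le)
      fun n => le_self_add.trans le_self_add
  · simp only [meanMomentum_eq]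
    refine (tendsto_meanPosition (momentum_lt_top hv) ?_).const_smul _
    simp only [← map_sub]
    exact tendsto_of_tendsto_of_tendsto_of_le_of_le tendsto_const_nhds h (fun _ => zero_le)
      fun n => position_fourier_le _

/-! ### The equation -/

theorem nonlocalPotential_eq {u : L2 d} (hu : sigmaHalfSq u < ∞) (x : Space d) :
    nonlocalPotential u x = mass u * ‖x‖ ^ 2 - 2 * inner ℝ x (meanPosition u) := by
  have hi := (integrable_position (position_lt_top hu)).inner_const (𝕜 := ℝ) x
  have e : ∀ y : Space d, (‖x - y‖ ^ 2 - ‖y‖ ^ 2) * ‖u y‖ ^ 2 =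
      ‖x‖ ^ 2 * ‖u y‖ ^ 2 - 2 * inner ℝ (‖u y‖ ^ 2 • y) x := by
    intro y
    rw [norm_sub_sq_real, inner_smul_left, RCLike.conj_to_real, real_inner_comm x y]
    ring
  simp only [nonlocalPotential, e]
  rw [integral_sub ((integrable_norm_sq u).const_mul _) (hi.const_mul _), integral_const_mul,
    integral_const_mul, integral_norm_sq, real_inner_comm,
    inner_meanPosition (position_lt_top hu), mass, mul_comm]
  congr 2
  refine integral_congr_ae (Eventually.of_forall fun y => ?_)
  simp only [inner_smul_left, RCLike.conj_to_real]
  ring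

/-- Complex conjugation of Schwartz functions. -/
def conjS (φ : 𝓢(Space d, ℂ)) : 𝓢(Space d, ℂ) :=
  SchwartzMap.postcompCLM (𝕜 := ℝ) (Complex.conjCLE : ℂ →L[ℝ] ℂ) φ

theorem conjS_apply (φ : 𝓢(Space d, ℂ)) (x : Space d) :
    conjS φ x = (starRingEnd ℂ) (φ x) := rfl

theorem conjS_conjS (φ : 𝓢(Space d, ℂ)) : conjS (conjS φ) = φ := by
  ext x; simp [conjS_apply]

theorem posS_conjS (v : Space d) (φ : 𝓢(Space d, ℂ)) : posS v (conjS φ) = conjS (posS v φ) := by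
  ext x; simp [conjS_apply, posS_apply]

theorem sqPosS_conjS (φ : 𝓢(Space d, ℂ)) : sqPosS (conjS φ) = conjS (sqPosS φ) := by
  ext x; simp [conjS_apply, sqPosS_apply]

theorem momS_conjS (v : Space d) (φ : 𝓢(Space d, ℂ)) : momS v (conjS φ) = -conjS (momS v φ) := by
  ext x
  have h : fderiv ℝ (conjS φ) x = (Complex.conjCLE : ℂ →L[ℝ] ℂ).comp (fderiv ℝ φ x) :=
    ((Complex.conjCLE : ℂ →L[ℝ] ℂ).hasFDerivAt.comp x
      (φ.differentiableAt.hasFDerivAt)).fderiv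
  rw [neg_apply, conjS_apply, momS_apply, momS_apply, h]
  simp

theorem sqMomS_conjS (φ : 𝓢(Space d, ℂ)) : sqMomS (conjS φ) = conjS (sqMomS φ) := by
  have e : ∀ v : Space d, momS v (momS v (conjS φ)) = conjS (momS v (momS v φ)) := fun v => by
    rw [momS_conjS, map_neg, momS_conjS, neg_neg]
  simp only [sqMomS_eq, e]
  ext x
  simp [conjS_apply, sum_apply]

theorem genS_conjS (k : ℝ) (f : Space d) (φ : 𝓢(Space d, ℂ)) :
    genS k f (conjS φ) = -conjS (genS k f φ) := by
  ext x
  simp only [genS, sqMomS_conjS, sqPosS_conjS, posS_conjS, neg_apply, conjS_apply, smul_apply,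
    sub_apply, add_apply, smul_eq_mul, map_mul, map_sub, map_add, map_neg, map_div₀,
    Complex.conj_I, Complex.conj_ofReal, Complex.conj_ofNat]
  ring

theorem pairing_eq_inner (u : L2 d) (φ : 𝓢(Space d, ℂ)) :
    pairing u φ = inner ℂ (toL2 (conjS φ)) u := by
  rw [L2.inner_def, pairing]
  refine integral_congr_ae ?_
  filter_upwards [toL2_coe (conjS φ)] with x hx
  rw [hx, conjS_apply]
  simp [RCLike.inner_apply]

/-- The nonlocal potential is a quadratic polynomial in `x`, so that the right-hand side of the
equation is a quadratic Hamiltonian applied to `u`. -/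
theorem rhs_eq {u : L2 d} (hu : sigmaHalfSq u < ∞) (lam eta : ℝ) (φ : 𝓢(Space d, ℂ)) :
    rhs lam eta u φ = -(2 * Complex.I) * inner ℂ
      (toL2 (genS (lam + eta * mass u) (eta • meanPosition u) (conjS φ))) u := by
  have e : rhs lam eta u φ = 2 * Complex.I *
      pairing u (genS (lam + eta * mass u) (eta • meanPosition u) φ) := by
    rw [rhs, pairing, ← integral_const_mul]
    refine integral_congr_ae (Eventually.of_forall fun x => ?_)
    simp only [genS, smul_apply, sub_apply, add_apply, sqPosS_apply, posS_apply, inner_smul_right,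
      sqMomS_eq_neg_laplacian, neg_apply, smul_eq_mul, nonlocalPotential_eq hu]
    push_cast
    linear_combination (u x * (-(Δ φ) x + (lam * ‖x‖ ^ 2) * φ x
      + (eta * (mass u * ‖x‖ ^ 2 - 2 * (inner ℝ x (meanPosition u) : ℝ))) * φ x)) * Complex.I_sq
  rw [e, pairing_eq_inner, genS_conjS, map_neg, inner_neg_left]
  ring

/-- Weak solutions are the weak solutions of the linear equation with the frequency and the force
determined by their own mass and centre. -/
theorem isWeakSolution_iff {lam eta : ℝ} {v : ℝ → L2 d} (hv : ContinuousSigmaHalf v) :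
    IsWeakSolution lam eta v ↔ IsWeakFlowOn (fun t => lam + eta * mass (v t))
      (fun t => eta • meanPosition (v t)) Set.univ v := by
  have hS : ∀ t, sigmaHalfSq (v t) < ∞ := fun t => (memSigma_half_iff _).1 (hv.1 t)
  have hc : ∀ t, ContinuousAt v t := fun t =>
    (tendsto_moments (hS t) ((tendsto_sigmaNorm_half_iff _).1 (hv.2 t))).1
  have e : ∀ t φ, rhs lam eta (v t) φ / (2 * Complex.I) = -inner ℂ (toL2 (genS
      (lam + eta * mass (v t)) (eta • meanPosition (v t)) (conjS φ))) (v t) := by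
    intro t φ
    rw [rhs_eq (hS t)]
    field_simp
  constructor
  · intro h t _
    refine ⟨hc t, fun φ => ?_⟩
    have := h.equation (conjS φ) t
    rw [e, conjS_conjS] at this
    simpa only [pairing_eq_inner, conjS_conjS] using this
  · intro h
    refine ⟨hv, fun φ t => ?_⟩
    rw [e]
    simpa only [pairing_eq_inner] using (h t (Set.mem_univ t)).2 (conjS φ)

/-! ### Estimates in `Σ^{-3/2}` -/

theorem fourier_conjS (φ : 𝓢(Space d, ℂ)) (ξ : Space d) :
    (𝓕 (conjS φ)) ξ = (starRingEnd ℂ) ((𝓕 φ) (-ξ)) := by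
  rw [SchwartzMap.fourier_coe, SchwartzMap.fourier_coe, Real.fourier_eq', Real.fourier_eq',
    ← integral_conj]
  refine integral_congr_ae (Eventually.of_forall fun x => ?_)
  simp only [smul_eq_mul, conjS_apply, map_mul, ← Complex.exp_conj, Complex.conj_I,
    Complex.conj_ofReal, inner_neg_right]
  congr 2
  push_cast
  ring

theorem sigmaNorm_conjS (s : ℝ) (φ : 𝓢(Space d, ℂ)) :
    sigmaNorm s (toL2 (conjS φ)) = sigmaNorm s (toL2 φ) := by
  have hF : ∀ ψ : 𝓢(Space d, ℂ), (𝓕 (toL2 ψ) : L2 d) = toL2 (𝓕 ψ) := fourierU_toL2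
  have hs : ∀ (w : Space d → ℝ) (ψ : 𝓢(Space d, ℂ)),
      eLpNorm (fun x => ((w x : ℝ) : ℂ) * toL2 ψ x) 2 volume =
        eLpNorm (fun x => ((w x : ℝ) : ℂ) * ψ x) 2 volume := fun w ψ =>
    eLpNorm_congr_ae (by filter_upwards [toL2_coe ψ] with x hx; rw [hx])
  rw [sigmaNorm, sigmaNorm, hF, hF, hs, hs, hs, hs]
  congr 1
  · refine eLpNorm_congr_norm_ae (Eventually.of_forall fun x => ?_)
    rw [norm_mul, norm_mul, conjS_apply, RCLike.norm_conj]
  · rw [← eLpNorm_comp_measurePreserving (f := fun x : Space d => -x) (μ := volume)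
      (g := fun ξ => (((1 + (2 * Real.pi * ‖ξ‖) ^ 2) ^ (s / 2) : ℝ) : ℂ) *
        (𝓕 φ : 𝓢(Space d, ℂ)) ξ) ?_
      (Measure.measurePreserving_neg volume)]
    · refine eLpNorm_congr_norm_ae (Eventually.of_forall fun x => ?_)
      simp only [Function.comp, norm_mul, norm_neg, fourier_conjS, RCLike.norm_conj]
    · have h1 : Measurable fun ξ : Space d => (1 + (2 * Real.pi * ‖ξ‖) ^ 2) ^ (s / 2) := by fun_prop
      exact ((Complex.measurable_ofReal.comp h1).mul
        (𝓕 φ : 𝓢(Space d, ℂ)).continuous.measurable).aestronglyMeasurable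

/-- The Cauchy-Schwarz inequality with the weight `w` split between the two factors. -/
theorem enorm_inner_le_of_weight {w : Space d → ℝ} (hw : Measurable w) (hw0 : ∀ x, 0 < w x)
    {ψ φ : 𝓢(Space d, ℂ)} {c : ℝ} (hc : ∀ x, ‖ψ x‖ ≤ c * w x * ‖φ x‖) {s r : ℝ}
    (hsr : s / 2 + r / 2 = 1) (u : L2 d) :
    ‖inner ℂ (toL2 ψ) u‖ₑ ≤ ENNReal.ofReal c *
      (eLpNorm (fun x : Space d => ((w x ^ (s / 2) : ℝ) : ℂ) * toL2 φ x) 2 volume *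
       eLpNorm (fun x : Space d => ((w x ^ (r / 2) : ℝ) : ℂ) * u x) 2 volume) := by
  have hm1 : Measurable fun x : Space d => ((w x ^ (s / 2) : ℝ) : ℂ) * toL2 φ x :=
    (Complex.measurable_ofReal.comp (hw.pow_const _)).mul (Lp.stronglyMeasurable _).measurable
  have hm2 : Measurable fun x : Space d => ((w x ^ (r / 2) : ℝ) : ℂ) * u x :=
    (Complex.measurable_ofReal.comp (hw.pow_const _)).mul (Lp.stronglyMeasurable _).measurable
  have h := eLpNorm_smul_le_mul_eLpNorm (p := 2) (q := 2) (r := 1) (μ := volume)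
    hm2.aestronglyMeasurable hm1.aestronglyMeasurable
  rw [eLpNorm_one_eq_lintegral_enorm] at h
  rw [L2.inner_def]
  refine (enorm_integral_le_lintegral_enorm _).trans (le_trans ?_ (mul_le_mul_right h _))
  rw [← lintegral_const_mul' _ _ ENNReal.ofReal_ne_top]
  refine lintegral_mono_ae ?_
  filter_upwards [toL2_coe ψ, toL2_coe φ] with x h1 h2
  rw [h1, Pi.smul_apply', h2, ← ofReal_norm, ← ofReal_norm, smul_eq_mul]
  have hcw : 0 ≤ c * w x * ‖φ x‖ := (norm_nonneg _).trans (hc x)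
  rw [← ENNReal.ofReal_mul' (norm_nonneg _)]
  refine ENNReal.ofReal_le_ofReal ((norm_inner_le_norm _ _).trans ?_)
  have e : w x ^ (s / 2) * w x ^ (r / 2) = w x := by
    rw [← Real.rpow_add (hw0 x), hsr, Real.rpow_one]
  simp only [norm_mul, Complex.norm_real]
  rw [Real.norm_of_nonneg (Real.rpow_nonneg (hw0 x).le _),
    Real.norm_of_nonneg (Real.rpow_nonneg (hw0 x).le _)]
  calc ‖ψ x‖ * ‖u x‖ ≤ c * w x * ‖φ x‖ * ‖u x‖ := by gcongr; exact hc x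
    _ = c * (w x ^ (s / 2) * w x ^ (r / 2)) * ‖φ x‖ * ‖u x‖ := by rw [e]
    _ = _ := by ring

theorem enorm_inner_position_le {ψ φ : 𝓢(Space d, ℂ)} {c : ℝ}
    (hc : ∀ x, ‖ψ x‖ ≤ c * (1 + ‖x‖ ^ 2) * ‖φ x‖) (u : L2 d) :
    ‖inner ℂ (toL2 ψ) u‖ₑ ≤ ENNReal.ofReal c *
      (sigmaNorm (3 / 2) (toL2 φ) * sigmaNorm (1 / 2) u) := by
  refine (enorm_inner_le_of_weight (w := fun x => 1 + ‖x‖ ^ 2) (by fun_prop)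
    (fun x => by positivity) hc (s := 3 / 2) (r := 1 / 2) (by norm_num) u).trans ?_
  gcongr
  · exact le_self_add
  · exact le_self_add

theorem fourier_sqMomS (φ : 𝓢(Space d, ℂ)) :
    𝓕 (sqMomS φ) = (((2 * Real.pi) ^ 2 : ℝ) : ℂ) • sqPosS (𝓕 φ) := by
  have hsum : 𝓕 (sqMomS φ) = ∑ j, 𝓕 (momS (basisVec j) (momS (basisVec j) φ)) := by
    rw [sqMomS_eq]
    exact map_sum (FourierTransform.fourierCLM ℂ 𝓢(Space d, ℂ)) _ _
  rw [hsum, sqPosS_eq, Finset.smul_sum]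
  refine Finset.sum_congr rfl fun j _ => ?_
  rw [fourier_momS, fourier_momS, map_smul, smul_smul]
  congr 1
  push_cast
  ring

theorem enorm_inner_sqMomS_le (φ : 𝓢(Space d, ℂ)) (u : L2 d) :
    ‖inner ℂ (toL2 (sqMomS φ)) u‖ₑ ≤ sigmaNorm (3 / 2) (toL2 φ) * sigmaNorm (1 / 2) u := by
  rw [← fourierU.inner_map_map, fourierU_toL2]
  have h := enorm_inner_le_of_weight (w := fun ξ : Space d => 1 + (2 * Real.pi * ‖ξ‖) ^ 2)
    (by fun_prop) (fun x => by positivity) (ψ := 𝓕 (sqMomS φ)) (φ := 𝓕 φ) (c := 1) (fun ξ => ?_)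
    (s := 3 / 2) (r := 1 / 2) (by norm_num) (fourierU u)
  · refine h.trans ?_
    rw [ENNReal.ofReal_one, one_mul, ← fourierU_toL2]
    gcongr
    · exact le_add_self
    · exact le_add_self
  · rw [fourier_sqMomS, smul_apply, sqPosS_apply, norm_smul, norm_mul, Complex.norm_real,
      Complex.norm_real, Real.norm_of_nonneg (by positivity), Real.norm_of_nonneg (by positivity)]
    rw [← mul_assoc, one_mul, mul_pow]
    gcongr
    linarith

theorem enorm_inner_potential_le (k : ℝ) (f : Space d) (φ : 𝓢(Space d, ℂ)) (u : L2 d) :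
    ‖inner ℂ (toL2 ((k : ℂ) • sqPosS φ - (2 : ℂ) • posS f φ)) u‖ₑ ≤ (‖k‖ₑ + 2 * ‖f‖ₑ) *
      (sigmaNorm (3 / 2) (toL2 φ) * sigmaNorm (1 / 2) u) := by
  have h2 := enorm_inner_position_le (ψ := sqPosS φ) (φ := φ) (c := 1) (fun x => by
    rw [sqPosS_apply, norm_mul, Complex.norm_real, Real.norm_of_nonneg (by positivity), one_mul]
    gcongr
    linarith) u
  have h3 := enorm_inner_position_le (ψ := posS f φ) (φ := φ) (c := ‖f‖) (fun x => by
    rw [posS_apply, norm_mul, Complex.norm_real]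
    gcongr
    refine (norm_inner_le_norm _ _).trans ?_
    rw [mul_comm]
    gcongr
    nlinarith [sq_nonneg (‖x‖ - 1)]) u
  rw [ENNReal.ofReal_one, one_mul] at h2
  rw [ofReal_norm] at h3
  have hk : ‖(k : ℂ)‖ₑ = ‖k‖ₑ := by rw [← ofReal_norm, ← ofReal_norm, Complex.norm_real]
  have h2' : ‖(2 : ℂ)‖ₑ = 2 := by rw [← ofReal_norm]; simp
  rw [map_sub, map_smul, map_smul, inner_sub_left, inner_smul_left, inner_smul_left]
  refine enorm_sub_le.trans ?_
  rw [enorm_mul, enorm_mul, RCLike.enorm_conj, RCLike.enorm_conj, hk, h2']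
  calc _ ≤ ‖k‖ₑ * (sigmaNorm (3 / 2) (toL2 φ) * sigmaNorm (1 / 2) u) +
        2 * (‖f‖ₑ * (sigmaNorm (3 / 2) (toL2 φ) * sigmaNorm (1 / 2) u)) := by gcongr
    _ = _ := by ring

theorem enorm_neg_I_div_two_le : ‖-(Complex.I / 2)‖ₑ ≤ 1 := by
  rw [← ofReal_norm, ← ENNReal.ofReal_one]
  refine ENNReal.ofReal_le_ofReal ?_
  simp
  norm_num

theorem enorm_inner_genS_le (k : ℝ) (f : Space d) (φ : 𝓢(Space d, ℂ)) (u : L2 d) :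
    ‖inner ℂ (toL2 (genS k f φ)) u‖ₑ ≤ (1 + (‖k‖ₑ + 2 * ‖f‖ₑ)) *
      (sigmaNorm (3 / 2) (toL2 φ) * sigmaNorm (1 / 2) u) := by
  rw [genS, map_smul, add_sub_assoc, map_add, inner_smul_left, inner_add_left, enorm_mul,
    RCLike.enorm_conj, add_mul, one_mul]
  refine (mul_le_mul_left enorm_neg_I_div_two_le _).trans ?_
  rw [one_mul]
  exact (enorm_add_le _ _).trans
    (add_le_add (enorm_inner_sqMomS_le φ u) (enorm_inner_potential_le k f φ u))

theorem enorm_inner_genS_sub_le (k k' : ℝ) (f f' : Space d) (φ : 𝓢(Space d, ℂ)) (u : L2 d) :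
    ‖inner ℂ (toL2 (genS k f φ - genS k' f' φ)) u‖ₑ ≤ (‖k - k'‖ₑ + 2 * ‖f - f'‖ₑ) *
      (sigmaNorm (3 / 2) (toL2 φ) * sigmaNorm (1 / 2) u) := by
  have e : genS k f φ - genS k' f' φ = (-(Complex.I / 2)) •
      (((k - k' : ℝ) : ℂ) • sqPosS φ - (2 : ℂ) • posS (f - f') φ) := by
    have e1 : posS (f - f') φ = posS f φ - posS f' φ := by
      ext x
      simp only [sub_apply, posS_apply, inner_sub_right]
      push_cast
      ring
    rw [e1, genS, genS]
    push_cast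
    module
  rw [e, map_smul, inner_smul_left, enorm_mul, RCLike.enorm_conj]
  refine (mul_le_mul_left enorm_neg_I_div_two_le _).trans ?_
  rw [one_mul]
  exact enorm_inner_potential_le _ _ φ u

theorem enorm_neg_two_I : ‖-(2 * Complex.I)‖ₑ = 2 := by
  rw [← ofReal_norm]; simp

theorem sigmaDualNorm_rhs_le {u : L2 d} (hu : sigmaHalfSq u < ∞) (lam eta : ℝ) :
    sigmaDualNorm (3 / 2) (rhs lam eta u) ≤
      2 * ((1 + (‖lam + eta * mass u‖ₑ + 2 * ‖eta • meanPosition u‖ₑ)) * sigmaNorm (1 / 2) u) := by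
  refine iSup₂_le fun φ hφ => ?_
  rw [← toL2_apply, ← sigmaNorm_conjS] at hφ
  rw [rhs_eq hu, enorm_mul, enorm_neg_two_I]
  gcongr
  refine (enorm_inner_genS_le _ _ _ _).trans ?_
  gcongr
  exact mul_le_of_le_one_left zero_le hφ

theorem sigmaDualNorm_rhs_sub_le {u v : L2 d} (hu : sigmaHalfSq u < ∞) (hv : sigmaHalfSq v < ∞)
    (lam eta : ℝ) :
    sigmaDualNorm (3 / 2) (fun φ => rhs lam eta u φ - rhs lam eta v φ) ≤
      2 * ((1 + (‖lam + eta * mass u‖ₑ + 2 * ‖eta • meanPosition u‖ₑ)) * sigmaNorm (1 / 2) (u - v) +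
        (‖(lam + eta * mass u) - (lam + eta * mass v)‖ₑ +
          2 * ‖eta • meanPosition u - eta • meanPosition v‖ₑ) * sigmaNorm (1 / 2) v) := by
  refine iSup₂_le fun φ hφ => ?_
  rw [← toL2_apply, ← sigmaNorm_conjS] at hφ
  have e : ∀ (k k' : ℝ) (f f' : Space d) (φ : 𝓢(Space d, ℂ)),
      inner ℂ (toL2 (genS k f φ)) u - inner ℂ (toL2 (genS k' f' φ)) v =
      inner ℂ (toL2 (genS k f φ)) (u - v) + inner ℂ (toL2 (genS k f φ - genS k' f' φ)) v := by
    intro k k' f f' φ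
    rw [inner_sub_right, map_sub, inner_sub_left]
    ring
  beta_reduce
  rw [rhs_eq hu, rhs_eq hv, ← mul_sub, enorm_mul, enorm_neg_two_I, e]
  gcongr
  refine (enorm_add_le _ _).trans (add_le_add ?_ ?_)
  · refine (enorm_inner_genS_le _ _ _ _).trans ?_
    gcongr
    exact mul_le_of_le_one_left zero_le hφ
  · refine (enorm_inner_genS_sub_le _ _ _ _ _ _).trans ?_
    gcongr
    exact mul_le_of_le_one_left zero_le hφ

theorem tendsto_enorm_of_tendsto {E ι : Type*} [NormedAddCommGroup E] {l : Filter ι} {f : ι → E}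
    {a : E} (h : Tendsto f l (𝓝 a)) : Tendsto (fun n => ‖f n‖ₑ) l (𝓝 ‖a‖ₑ) :=
  (continuous_enorm.tendsto a).comp h

/-- A weak solution in `C(ℝ; Σ^{1/2})` is differentiable with values in `Σ^{-3/2}`, because the
right-hand side of the equation is continuous with values in `Σ^{-3/2}`. -/
theorem IsWeakSolution.isSolution {lam eta : ℝ} {v : ℝ → L2 d} (h : IsWeakSolution lam eta v) :
    IsSolution lam eta v := by
  have hS : ∀ t, sigmaHalfSq (v t) < ∞ := fun t => (memSigma_half_iff _).1 (h.continuous.1 t)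
  have hcont : ∀ t : ℝ, Tendsto (fun s : ℝ => sigmaDualNorm (3 / 2) (fun φ =>
      rhs lam eta (v s) φ - rhs lam eta (v t) φ)) (𝓝 t) (𝓝 0) := by
    intro t
    obtain ⟨-, hM, hX, -⟩ :=
      tendsto_moments (hS t) ((tendsto_sigmaNorm_half_iff _).1 (h.continuous.2 t))
    have hk : Tendsto (fun s => lam + eta * mass (v s)) (𝓝 t) (𝓝 (lam + eta * mass (v t))) :=
      (hM.const_mul eta).const_add lam
    have hf := hX.const_smul eta
    have a1 := tendsto_enorm_of_tendsto hk
    have a2 := ENNReal.Tendsto.const_mul (a := 2) (tendsto_enorm_of_tendsto hf)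
      (Or.inr (by norm_num))
    have a3 := tendsto_enorm_of_tendsto (hk.sub_const (lam + eta * mass (v t)))
    have a4 := ENNReal.Tendsto.const_mul (a := 2)
      (tendsto_enorm_of_tendsto (hf.sub_const (eta • meanPosition (v t)))) (Or.inr (by norm_num))
    rw [sub_self, enorm_zero] at a3 a4
    have b1 := ENNReal.Tendsto.mul ((a1.add a2).const_add 1)
      (Or.inr ENNReal.zero_ne_top) (h.continuous.2 t) (Or.inr (by
        refine ENNReal.add_ne_top.2 ⟨ENNReal.one_ne_top, ENNReal.add_ne_top.2 ⟨enorm_ne_top, ?_⟩⟩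
        exact ENNReal.mul_ne_top (by norm_num) enorm_ne_top))
    have b2 := ENNReal.Tendsto.mul_const (a3.add a4) (b := sigmaNorm (1 / 2) (v t))
      (Or.inr (h.continuous.1 t).ne)
    have b3 := ENNReal.Tendsto.const_mul (a := 2) (b1.add b2) (Or.inr (by norm_num))
    rw [mul_zero, mul_zero, add_zero, zero_mul, add_zero, mul_zero] at b3
    exact tendsto_of_tendsto_of_tendsto_of_le_of_le tendsto_const_nhds b3 (fun _ => zero_le)
      fun s => sigmaDualNorm_rhs_sub_le (hS s) (hS t) lam eta
  refine ⟨h.continuous, fun t => ?_, fun t => ?_, hcont⟩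
  · rw [ENNReal.tendsto_nhds_zero]
    intro ε hε
    rcases eq_or_ne ε ∞ with rfl | hε'
    · exact Eventually.of_forall fun _ => le_top
    lift ε to NNReal using hε'
    obtain ⟨δ, hδ, hball⟩ := Metric.eventually_nhds_iff_ball.1
      (ENNReal.tendsto_nhds_zero.1 (hcont t) ε hε)
    filter_upwards [nhdsWithin_le_nhds (Metric.ball_mem_nhds (0 : ℝ) hδ), self_mem_nhdsWithin]
      with r hr hr0
    refine iSup₂_le fun φ hφ => ?_
    have hr0' : (r : ℂ) ≠ 0 := Complex.ofReal_ne_zero.2 hr0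
    set c := rhs lam eta (v t) φ / (2 * Complex.I) with hc
    have hd : ∀ s, HasDerivAt (fun s : ℝ => pairing (v s) φ - (s : ℂ) * c)
        (rhs lam eta (v s) φ / (2 * Complex.I) - c) s := fun s => by
      have h1 : HasDerivAt (fun s : ℝ => (s : ℂ) * c) c s := by
        simpa using ((hasDerivAt_id s).ofReal_comp).mul_const c
      exact (h.equation φ s).sub h1
    have hm := (convex_ball t δ).norm_image_sub_le_of_norm_hasDerivWithin_le (C := ε / 2)
      (fun s _ => (hd s).hasDerivWithinAt) (fun s hs => ?_) (Metric.mem_ball_self hδ)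
      (y := t + r) (by simpa [Metric.mem_ball, Real.dist_eq] using hr)
    · have e : 2 * Complex.I * ((pairing (v (t + r)) φ - pairing (v t) φ) / (r : ℂ)) -
          rhs lam eta (v t) φ = (2 * Complex.I / r) * (pairing (v (t + r)) φ -
              ((t + r : ℝ) : ℂ) * c -
            (pairing (v t) φ - (t : ℂ) * c)) := by
        rw [hc]
        push_cast
        field_simp
        ring
      beta_reduce
      rw [e, ← ofReal_norm, norm_mul, ENNReal.ofReal_le_iff_le_toReal ENNReal.coe_ne_top,
        ENNReal.coe_toReal]
      have hrn : 0 < |r| := abs_pos.2 hr0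
      rw [add_sub_cancel_left, Real.norm_eq_abs] at hm
      have e2 : ‖2 * Complex.I / (r : ℂ)‖ = 2 / |r| := by
        rw [norm_div, Complex.norm_real, Real.norm_eq_abs]; simp
      rw [e2]
      calc 2 / |r| * _ ≤ 2 / |r| * (ε / 2 * |r|) := by gcongr
        _ = _ := by field_simp
    · have h1 : ‖rhs lam eta (v s) φ - rhs lam eta (v t) φ‖ₑ ≤ ε :=
        (le_iSup₂ (f := fun (φ : 𝓢(Space d, ℂ)) (_ : sigmaNorm (3 / 2) (φ.toLp 2 volume) ≤ 1) =>
          ‖rhs lam eta (v s) φ - rhs lam eta (v t) φ‖ₑ) φ hφ).trans (hball s hs)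
      rw [← ofReal_norm, ENNReal.ofReal_le_iff_le_toReal ENNReal.coe_ne_top,
        ENNReal.coe_toReal] at h1
      rw [hc, ← sub_div, norm_div]
      have e2 : ‖2 * Complex.I‖ = 2 := by simp
      rw [e2]
      gcongr
  · refine (sigmaDualNorm_rhs_le (hS t) lam eta).trans_lt ?_
    refine ENNReal.mul_lt_top (by norm_num) (ENNReal.mul_lt_top ?_ (h.continuous.1 t))
    refine ENNReal.add_lt_top.2 ⟨ENNReal.one_lt_top, ENNReal.add_lt_top.2 ⟨enorm_lt_top, ?_⟩⟩
    exact ENNReal.mul_lt_top (by norm_num) enorm_lt_top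

/-! ### The solution -/

theorem continuous_gSol (κ : ℝ) (a b : Space d) : Continuous fun t => gSol κ t a b :=
  continuous_iff_continuousAt.2 fun t => (hasDerivAt_gSol κ t a b).continuousAt

theorem continuous_gSol' (κ : ℝ) (a b : Space d) : Continuous fun t => gSol' κ t a b :=
  continuous_iff_continuousAt.2 fun t => (hasDerivAt_gSol' κ t a b).continuousAt

theorem hasDerivAt_gaugePhase (lam eta M : ℝ) (a b : Space d) (t : ℝ) :
    HasDerivAt (gaugePhase lam eta M a b) (-(eta * M / 2) * ‖gSol lam t a b‖ ^ 2) t := by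
  have hc : Continuous fun s => ‖gSol lam s a b‖ ^ 2 := (continuous_gSol lam a b).norm.pow 2
  exact (hc.integral_hasStrictDerivAt 0 t).hasDerivAt.const_mul _

theorem galilean_symm_propagator (κ t : ℝ) (a b : Space d) (u : L2 d) :
    (galilean κ t a b).symm (propagator κ t u) = propagator κ t ((galilean κ 0 a b).symm u) := by
  rw [LinearIsometryEquiv.symm_apply_eq, galilean_eq_weyl, galilean_eq_weyl, weyl_propagator,
    gSol_zero, gSol'_zero, LinearIsometryEquiv.apply_symm_apply]

theorem meanPosition_zero : meanPosition (0 : L2 d) = 0 := by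
  rw [meanPosition, ← integral_zero (Space d) (Space d)]
  refine integral_congr_ae ?_
  filter_upwards [Lp.coeFn_zero ℂ 2 (volume : Measure (Space d))] with x hx
  rw [hx]
  simp

theorem meanMomentum_zero : meanMomentum (0 : L2 d) = 0 := by
  rw [meanMomentum_eq, map_zero, meanPosition_zero, smul_zero]

theorem mass_eq_zero_iff (u : L2 d) : mass u = 0 ↔ u = 0 := by
  simp [mass]

theorem mass_smul_inv_meanPosition (u : L2 d) :
    mass u • (mass u)⁻¹ • meanPosition u = meanPosition u := by
  by_cases h : mass u = 0
  · rw [(mass_eq_zero_iff u).1 h, meanPosition_zero, smul_zero, smul_zero]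
  · rw [smul_inv_smul₀ h]

theorem mass_smul_inv_meanMomentum (u : L2 d) :
    mass u • (mass u)⁻¹ • meanMomentum u = meanMomentum u := by
  by_cases h : mass u = 0
  · rw [(mass_eq_zero_iff u).1 h, meanMomentum_zero, smul_zero, smul_zero]
  · rw [smul_inv_smul₀ h]

theorem sigmaHalfSq_zero : sigmaHalfSq (0 : L2 d) = 0 := by
  have h : ∀ w : Space d → ℝ, ∫⁻ x : Space d, ENNReal.ofReal (w x * ‖(0 : L2 d) x‖ ^ 2) = 0 := by
    intro w
    rw [← lintegral_zero (μ := (volume : Measure (Space d)))]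
    refine lintegral_congr_ae ?_
    filter_upwards [Lp.coeFn_zero ℂ 2 (volume : Measure (Space d))] with x hx
    rw [hx]
    simp
  rw [sigmaHalfSq, map_zero, h, h]
  simp

/-- The velocity `a = P[u]/M[u]` of the centre of mass. -/
def velocity (u : L2 d) : Space d := (mass u)⁻¹ • meanMomentum u

/-- The centre of mass `b = X[u]/M[u]`. -/
def center (u : L2 d) : Space d := (mass u)⁻¹ • meanPosition u

/-- The frequency `κ = λ + η M[u]` of the effective harmonic oscillator. -/
def frequency (lam eta : ℝ) (u : L2 d) : ℝ := lam + eta * mass u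

/-- The solution of the Cauchy problem, given by its representation in the moving frame. -/
def solutionMap (lam eta : ℝ) (u : L2 d) (t : ℝ) : L2 d :=
  Complex.exp (-(Complex.I * (gaugePhase lam eta (mass u) (velocity u) (center u) t : ℂ))) •
    galilean lam t (velocity u) (center u) (propagator (frequency lam eta u) t
      ((galilean (frequency lam eta u) 0 (velocity u) (center u)).symm u))

/-- The scalar phase of the solution after the two Galilean transforms have been merged into one. -/
def solutionPhase (lam eta : ℝ) (u : L2 d) (t : ℝ) : ℝ :=
  -gaugePhase lam eta (mass u) (velocity u) (center u) t +
    (inner ℝ (gSol lam t (velocity u) (center u))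
        (gSol' (frequency lam eta u) t (velocity u) (center u)) -
      inner ℝ (gSol (frequency lam eta u) t (velocity u) (center u))
        (gSol' lam t (velocity u) (center u))) / 2

/-- The two Galilean transforms merge into one phase space translation along the displacement of the
trajectories of frequencies `λ` and `κ`. In this form the solution is defined by an operator that
depends continuously on the datum. -/
theorem solutionMap_eq_framed (lam eta : ℝ) (u : L2 d) (t : ℝ) :
    solutionMap lam eta u t = framed (solutionPhase lam eta u t)
      (gSol lam t (velocity u) (center u) -
        gSol (frequency lam eta u) t (velocity u) (center u))
      (gSol' lam t (velocity u) (center u) -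
        gSol' (frequency lam eta u) t (velocity u) (center u))
      (frequency lam eta u) t u := by
  rw [solutionMap, ← galilean_symm_propagator, galilean_eq_weyl, galilean_eq_weyl, weyl_symm,
    weyl_weyl, smul_smul, framed_apply, ← Complex.exp_add, ← sub_eq_add_neg, ← sub_eq_add_neg]
  congr 2
  simp only [solutionPhase, inner_neg_left, inner_neg_right]
  push_cast
  ring

theorem mass_framed (θ : ℝ) (q p : Space d) (κ t : ℝ) (u : L2 d) :
    mass (framed θ q p κ t u) = mass u := by
  rw [mass, mass, LinearIsometryEquiv.norm_map]

theorem mass_solutionMap (lam eta : ℝ) (u : L2 d) (t : ℝ) :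
    mass (solutionMap lam eta u t) = mass u := by
  rw [solutionMap_eq_framed, mass_framed]

theorem mass_smul_gSol (κ t : ℝ) (u : L2 d) :
    mass u • gSol κ t (velocity u) (center u) = gSol κ t (meanMomentum u) (meanPosition u) := by
  rw [← gSol_smul, velocity, center, mass_smul_inv_meanMomentum, mass_smul_inv_meanPosition]

theorem mass_smul_gSol' (κ t : ℝ) (u : L2 d) :
    mass u • gSol' κ t (velocity u) (center u) = gSol' κ t (meanMomentum u) (meanPosition u) := by
  rw [← gSol'_smul, velocity, center, mass_smul_inv_meanMomentum, mass_smul_inv_meanPosition]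

theorem meanPosition_solutionMap (lam eta : ℝ) {u : L2 d} (hu : sigmaHalfSq u < ∞) (t : ℝ) :
    meanPosition (solutionMap lam eta u t) = gSol lam t (meanMomentum u) (meanPosition u) := by
  rw [solutionMap_eq_framed, (moments_framed _ _ _ _ _ hu).1, smul_sub, mass_smul_gSol,
    mass_smul_gSol, sub_add_cancel]

theorem solutionMap_zero (lam eta : ℝ) (u : L2 d) : solutionMap lam eta u 0 = u := by
  have h0 : propagator (frequency lam eta u) 0
      ((galilean (frequency lam eta u) 0 (velocity u) (center u)).symm u) = _ :=
    (isSchrodingerGroup_propagator (frequency lam eta u)).zero _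
  have h1 : galilean (d := d) lam 0 (velocity u) (center u) =
      galilean (frequency lam eta u) 0 (velocity u) (center u) := by
    rw [galilean_eq_weyl, galilean_eq_weyl, gSol_zero, gSol_zero, gSol'_zero, gSol'_zero]
  rw [solutionMap, h0, h1, LinearIsometryEquiv.apply_symm_apply, gaugePhase,
    intervalIntegral.integral_same]
  simp

/-- The flow of the harmonic oscillator of frequency `λ + η M` in the frame moving along
`g_λ(t, a, b)`, with the gauge phase: its force is `η M g_λ(t, a, b)`. -/
theorem isFlowOn_moving_frame (lam eta M : ℝ) (a b : Space d) :
    IsFlowOn (fun _ => lam + eta * M) (fun t => eta • M • gSol lam t a b) Set.univ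
      fun t => ((propagator (lam + eta * M) t).trans (galilean lam t a b)).trans
        (scalarU (-gaugePhase lam eta M a b t)) := by
  have hT := (isFlowOn_propagator (d := d) (lam + eta * M)).weyl (q := fun t => gSol lam t a b)
    (p := fun t => gSol' lam t a b) (F := fun t => -lam • gSol lam t a b)
    (θ := fun t => -gaugePhase lam eta M a b t)
    (fun t _ => hasDerivAt_gSol lam t a b) (fun t _ => hasDerivAt_gSol' lam t a b) (fun t _ => by
      refine (hasDerivAt_gaugePhase lam eta M a b t).neg.congr_deriv ?_
      rw [inner_smul_right, real_inner_self_eq_norm_sq]; ring)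
  have e : (fun t => -lam • gSol lam t a b + (lam + eta * M) • gSol lam t a b) =
      fun t => eta • M • gSol lam t a b := by
    funext t; module
  rw [e] at hT
  exact hT

theorem solutionMap_eq_flow (lam eta : ℝ) (u : L2 d) (t : ℝ) :
    solutionMap lam eta u t = (((propagator (frequency lam eta u) t).trans
      (galilean lam t (velocity u) (center u))).trans
      (scalarU (-gaugePhase lam eta (mass u) (velocity u) (center u) t)))
        ((galilean (frequency lam eta u) 0 (velocity u) (center u)).symm u) := by
  rw [LinearIsometryEquiv.trans_apply, LinearIsometryEquiv.trans_apply, scalarU_apply, solutionMap]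
  congr 2
  push_cast
  ring

theorem continuous_solutionPhase (lam eta : ℝ) (u : L2 d) :
    Continuous (solutionPhase lam eta u) := by
  have h1 : Continuous (gaugePhase lam eta (mass u) (velocity u) (center u)) :=
    continuous_iff_continuousAt.2 fun t => (hasDerivAt_gaugePhase _ _ _ _ _ t).continuousAt
  have h2 := fun κ => continuous_gSol κ (velocity u) (center u)
  have h3 := fun κ => continuous_gSol' κ (velocity u) (center u)
  exact h1.neg.add ((((h2 _).inner (h3 _)).sub ((h2 _).inner (h3 _))).div_const _)

theorem continuousSigmaHalf_solutionMap (lam eta : ℝ) {u : L2 d} (hu : sigmaHalfSq u < ∞) :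
    ContinuousSigmaHalf (solutionMap lam eta u) := by
  constructor
  · intro t
    rw [memSigma_half_iff, solutionMap_eq_framed]
    exact sigmaHalfSq_framed_lt_top _ _ _ _ _ hu
  · intro t
    rw [tendsto_sigmaNorm_half_iff]
    simp only [solutionMap_eq_framed]
    have h2 := fun κ => (continuous_gSol κ (velocity u) (center u)).tendsto t
    have h3 := fun κ => (continuous_gSol' κ (velocity u) (center u)).tendsto t
    refine tendsto_framed ((continuous_solutionPhase lam eta u).tendsto t)
      ((h2 _).sub (h2 _)) ((h3 _).sub (h3 _)) tendsto_const_nhds tendsto_id hu ?_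
    simp [sigmaHalfSq_zero]

theorem isWeakSolution_solutionMap (lam eta : ℝ) {u : L2 d} (hu : sigmaHalfSq u < ∞) :
    IsWeakSolution lam eta (solutionMap lam eta u) := by
  rw [isWeakSolution_iff (continuousSigmaHalf_solutionMap lam eta hu)]
  simp only [mass_solutionMap, meanPosition_solutionMap lam eta hu, ← mass_smul_gSol]
  have hc : Continuous fun t => eta • mass u • gSol lam t (velocity u) (center u) :=
    ((continuous_gSol lam _ _).const_smul (mass u)).const_smul eta
  have h := (isFlowOn_moving_frame lam eta (mass u) (velocity u) (center u)).isWeakFlowOn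
    isOpen_univ continuousOn_const hc.continuousOn
    ((galilean (frequency lam eta u) 0 (velocity u) (center u)).symm u)
  have e : solutionMap lam eta u = _ := funext (solutionMap_eq_flow lam eta u)
  rw [e]
  exact h

/-! ### Unconditional uniqueness -/

/-- Near any time, a weak solution of the linear equation with continuous frequency and force is
obtained from its value at that time by a flow of the homogeneous equation, a phase space
translation along a trajectory starting at rest, and a scalar phase. -/
theorem IsWeakFlowOn.exists_local_representation {k : ℝ → ℝ} {f : ℝ → Space d} (hk : Continuous k)
    (hf : Continuous f) {w : ℝ → L2 d} (hw : IsWeakFlowOn k f Set.univ w) {t₀ τ₁ : ℝ}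
    (hτ₁ : 0 < τ₁) {T : ℝ → (L2 d ≃ₗᵢ[ℂ] L2 d)} (hT0 : T t₀ = LinearIsometryEquiv.refl ℂ (L2 d))
    (hT : IsFlowOn k (fun _ => 0) (Set.Ioo (t₀ - τ₁) (t₀ + τ₁)) T) :
    ∃ (q p : ℝ → Space d) (θ : ℝ → ℝ), q t₀ = 0 ∧ HasDerivAt q 0 t₀ ∧ p t₀ = 0 ∧
      HasDerivAt p (f t₀) t₀ ∧
      ∀ᶠ t in 𝓝 t₀, w t = scalarU (θ t) (NonlocalSchrodinger.weyl (q t) (p t) (T t (w t₀))) := by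
  obtain ⟨q, p, τ₂, hτ₂, hq0, hp0, hqp⟩ := exists_local_linear_ode hk hf t₀ (0 : Space d) 0
  set τ := min τ₁ τ₂ with hτ
  have hτ0 : 0 < τ := lt_min hτ₁ hτ₂
  have hI1 : Set.Ioo (t₀ - τ) (t₀ + τ) ⊆ Set.Ioo (t₀ - τ₁) (t₀ + τ₁) :=
    Set.Ioo_subset_Ioo (by linarith [min_le_left τ₁ τ₂]) (by linarith [min_le_left τ₁ τ₂])
  have hI2 : Set.Ioo (t₀ - τ) (t₀ + τ) ⊆ Set.Ioo (t₀ - τ₂) (t₀ + τ₂) :=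
    Set.Ioo_subset_Ioo (by linarith [min_le_right τ₁ τ₂]) (by linarith [min_le_right τ₁ τ₂])
  have ht₀ : t₀ ∈ Set.Ioo (t₀ - τ) (t₀ + τ) := ⟨by linarith, by linarith⟩
  have hcd : ContinuousOn (fun t => (inner ℝ (q t) (f t) : ℝ) / 2) (Set.Ioo (t₀ - τ) (t₀ + τ)) :=
    fun t ht =>
      (((hqp t (hI2 ht)).1.continuousAt.inner hf.continuousAt).div_const 2).continuousWithinAt
  have hθ : ∀ t ∈ Set.Ioo (t₀ - τ) (t₀ + τ), HasDerivAt
      (fun t => ∫ s in t₀..t, (inner ℝ (q s) (f s) : ℝ) / 2)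
      ((inner ℝ (q t) (-k t • q t + f t) + k t * ‖q t‖ ^ 2) / 2) t := fun t ht => by
    have hsub : Set.uIcc t₀ t ⊆ Set.Ioo (t₀ - τ) (t₀ + τ) :=
      Set.OrdConnected.uIcc_subset Set.ordConnected_Ioo ht₀ ht
    refine (intervalIntegral.integral_hasDerivAt_right (hcd.mono hsub).intervalIntegrable
      (hcd.stronglyMeasurableAtFilter isOpen_Ioo t ht)
      (hcd.continuousAt (isOpen_Ioo.mem_nhds ht))).congr_deriv ?_
    rw [inner_add_right, inner_smul_right, real_inner_self_eq_norm_sq]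
    ring
  have hT' := (hT.mono hI1).weyl (fun t ht => (hqp t (hI2 ht)).1) (fun t ht => (hqp t (hI2 ht)).2)
      hθ
  have e : (fun t => -k t • q t + f t + k t • q t) = f := by
    funext t; module
  rw [e] at hT'
  refine ⟨q, p, fun t => ∫ s in t₀..t, (inner ℝ (q s) (f s) : ℝ) / 2, hq0, ?_, hp0, ?_, ?_⟩
  · have := (hqp t₀ (hI2 ht₀)).1
    rwa [hp0] at this
  · have := (hqp t₀ (hI2 ht₀)).2
    rwa [hq0, smul_zero, zero_add] at this
  · filter_upwards [Ioo_mem_nhds ht₀.1 ht₀.2] with t ht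
    have h := hT'.eq_of_isWeakFlowOn isOpen_Ioo isPreconnected_Ioo (hw.mono (Set.subset_univ _))
      ht₀ ht
    rw [h]
    simp only [LinearIsometryEquiv.trans_apply]
    congr 3
    rw [LinearIsometryEquiv.symm_apply_eq]
    simp only [LinearIsometryEquiv.trans_apply, intervalIntegral.integral_same, hT0, hq0, hp0,
      weyl_zero, scalarU_apply, LinearIsometryEquiv.coe_refl, id]
    simp

theorem eq_of_forall_eventually_eq {α : Type*} {g : ℝ → α}
    (h : ∀ t, ∀ᶠ s in 𝓝 t, g s = g t) (s t : ℝ) : g s = g t :=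
  (IsLocallyConstant.iff_eventually_eq g).2 h |>.apply_eq_of_isPreconnected
    isPreconnected_univ (Set.mem_univ s) (Set.mem_univ t)

/-- Solutions of `X' = P`, `P' = -λ X` are given by the fundamental solutions. -/
theorem eq_gSol_of_hasDerivAt {lam : ℝ} {X P : ℝ → Space d} (hX : ∀ t, HasDerivAt X (P t) t)
    (hP : ∀ t, HasDerivAt P (-lam • X t) t) (t : ℝ) : X t = gSol lam t (P 0) (X 0) := by
  have hY : ∀ t, HasDerivAt (fun t => cosK lam t • X t - sinK lam t • P t) 0 t := fun t => by
    refine (((hasDerivAt_cosK lam t).smul (hX t)).sub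
      ((hasDerivAt_sinK lam t).smul (hP t))).congr_deriv ?_
    module
  have hZ : ∀ t, HasDerivAt (fun t => cosK lam t • P t + (lam * sinK lam t) • X t) 0 t :=
      fun t => by
    refine (((hasDerivAt_cosK lam t).smul (hP t)).add
      (((hasDerivAt_sinK lam t).const_mul lam).smul (hX t))).congr_deriv ?_
    module
  have h1 := is_const_of_deriv_eq_zero (fun t => (hY t).differentiableAt) (fun t => (hY t).deriv)
      t 0
  have h2 := is_const_of_deriv_eq_zero (fun t => (hZ t).differentiableAt) (fun t => (hZ t).deriv)
      t 0
  simp only [cosK_zero, sinK_zero, one_smul, zero_smul, sub_zero, mul_zero, add_zero] at h1 h2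
  rw [← h1, ← h2, (gSol_backward lam t (X t) (P t)).1]

theorem isFlowOn_propagator_sub (κ t₀ : ℝ) : IsFlowOn (d := d) (fun _ => κ) (fun _ => 0) Set.univ
    fun t => propagator κ (t - t₀) := by
  intro ψ
  obtain ⟨y, h1, h2⟩ := isFlowOn_propagator κ ψ
  refine ⟨fun t => y (t - t₀), fun t => h1 _, fun t _ => ?_⟩
  exact HasDerivAt.comp_sub_const t t₀ (h2 (t - t₀) (Set.mem_univ _))

section Uniqueness

variable {lam eta : ℝ} {w : ℝ → L2 d}

theorem IsWeakSolution.sigmaHalfSq_lt_top (hw : IsWeakSolution lam eta w) (t : ℝ) :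
    sigmaHalfSq (w t) < ∞ := (memSigma_half_iff _).1 (hw.continuous.1 t)

theorem IsWeakSolution.continuous_moments (hw : IsWeakSolution lam eta w) :
    Continuous (fun t => mass (w t)) ∧ Continuous (fun t => meanPosition (w t)) := by
  have h := fun t => tendsto_moments (hw.sigmaHalfSq_lt_top t)
    ((tendsto_sigmaNorm_half_iff _).1 (hw.continuous.2 t))
  exact ⟨continuous_iff_continuousAt.2 fun t => (h t).2.1,
    continuous_iff_continuousAt.2 fun t => (h t).2.2.1⟩

/-- The mass of a weak solution is conserved. -/
theorem IsWeakSolution.mass_eq (hw : IsWeakSolution lam eta w) (t : ℝ) :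
    mass (w t) = mass (w 0) := by
  obtain ⟨hM, hX⟩ := hw.continuous_moments
  have hk : Continuous fun t => lam + eta * mass (w t) := by fun_prop
  have hf : Continuous fun t => eta • meanPosition (w t) := hX.const_smul eta
  refine eq_of_forall_eventually_eq (g := fun t => mass (w t)) (fun t₀ => ?_) t 0
  obtain ⟨T, τ, hτ, hT0, hT⟩ := exists_local_flow (d := d) hk t₀
  obtain ⟨q, p, θ, -, -, -, -, h⟩ := ((isWeakSolution_iff hw.continuous).1
    hw).exists_local_representation hk hf hτ hT0 hT
  filter_upwards [h] with s hs
  simp only [mass]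
  rw [hs]
  simp only [LinearIsometryEquiv.norm_map]

theorem IsWeakSolution.isWeakFlowOn (hw : IsWeakSolution lam eta w) :
    IsWeakFlowOn (fun _ => frequency lam eta (w 0)) (fun t => eta • meanPosition (w t))
      Set.univ w := by
  have h := (isWeakSolution_iff hw.continuous).1 hw
  simp only [hw.mass_eq] at h
  exact h

/-- The centre of a weak solution satisfies Hamilton's equations of the oscillator of frequency
`λ`. -/
theorem IsWeakSolution.hasDerivAt_moments (hw : IsWeakSolution lam eta w) (t₀ : ℝ) :
    HasDerivAt (fun t => meanPosition (w t)) (meanMomentum (w t₀)) t₀ ∧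
      HasDerivAt (fun t => meanMomentum (w t)) (-lam • meanPosition (w t₀)) t₀ := by
  obtain ⟨hM, hX⟩ := hw.continuous_moments
  have hf : Continuous fun t => eta • meanPosition (w t) := hX.const_smul eta
  set κ := frequency lam eta (w 0) with hκ
  have hT0 : propagator (d := d) κ (t₀ - t₀) = LinearIsometryEquiv.refl ℂ (L2 d) :=
    LinearIsometryEquiv.ext fun u => by
      rw [sub_self]; exact (isSchrodingerGroup_propagator κ).zero u
  obtain ⟨q, p, θ, hq0, hq, hp0, hp, h⟩ := hw.isWeakFlowOn.exists_local_representation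
    continuous_const hf one_pos (T := fun t => propagator κ (t - t₀)) hT0
    ((isFlowOn_propagator_sub κ t₀).mono (Set.subset_univ _))
  have h' : ∀ᶠ t in 𝓝 t₀, w t = framed (θ t) (q t) (p t) κ (t - t₀) (w t₀) := h
  have hmom := fun t => moments_framed (θ t) (q t) (p t) κ (t - t₀) (hw.sigmaHalfSq_lt_top t₀)
  have hMc : mass (w t₀) = mass (w 0) := hw.mass_eq t₀
  constructor
  · have h1 := (hq.const_smul (mass (w t₀))).add (HasDerivAt.comp_sub_const t₀ t₀
      (hasDerivAt_gSol κ (t₀ - t₀) (meanMomentum (w t₀)) (meanPosition (w t₀))))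
    refine (h1.congr_of_eventuallyEq (h'.mono fun t ht => ?_)).congr_deriv ?_
    · rw [ht, (hmom t).1]
      rfl
    · rw [sub_self, gSol'_zero, smul_zero, zero_add]
  · have h1 := (hp.const_smul (mass (w t₀))).add (HasDerivAt.comp_sub_const t₀ t₀
      (hasDerivAt_gSol' κ (t₀ - t₀) (meanMomentum (w t₀)) (meanPosition (w t₀))))
    refine (h1.congr_of_eventuallyEq (h'.mono fun t ht => ?_)).congr_deriv ?_
    · rw [ht, (hmom t).2]
      rfl
    · rw [sub_self, gSol_zero, hκ, frequency, hMc]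
      module

/-- Unconditional uniqueness. -/
theorem IsWeakSolution.eq_solutionMap (hw : IsWeakSolution lam eta w) :
    w = solutionMap lam eta (w 0) := by
  have hS := hw.sigmaHalfSq_lt_top 0
  have hX : ∀ t, meanPosition (w t) =
      mass (w 0) • gSol lam t (velocity (w 0)) (center (w 0)) := fun t => by
    rw [mass_smul_gSol]
    exact eq_gSol_of_hasDerivAt (fun t => (hw.hasDerivAt_moments t).1)
      (fun t => (hw.hasDerivAt_moments t).2) t
  have h1 := hw.isWeakFlowOn
  have hv := isWeakSolution_solutionMap lam eta hS
  have h2 := hv.isWeakFlowOn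
  simp only [meanPosition_solutionMap lam eta hS, ← mass_smul_gSol, solutionMap_zero] at h2
  simp only [hX] at h1
  have hT := isFlowOn_moving_frame lam eta (mass (w 0)) (velocity (w 0)) (center (w 0))
  funext t
  rw [hT.eq_of_isWeakFlowOn isOpen_univ isPreconnected_univ h1 (Set.mem_univ 0) (Set.mem_univ t),
    hT.eq_of_isWeakFlowOn isOpen_univ isPreconnected_univ h2 (Set.mem_univ 0) (Set.mem_univ t),
    solutionMap_zero]

end Uniqueness

/-! ### Continuous dependence on the datum -/

theorem continuous_cosK (κ : ℝ) : Continuous (cosK κ) :=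
  continuous_iff_continuousAt.2 fun t => (hasDerivAt_cosK κ t).continuousAt

theorem continuous_sinK (κ : ℝ) : Continuous (sinK κ) :=
  continuous_iff_continuousAt.2 fun t => (hasDerivAt_sinK κ t).continuousAt

theorem integral_norm_gSol_sq (lam : ℝ) (a b : Space d) (t : ℝ) :
    ∫ s in (0 : ℝ)..t, ‖gSol lam s a b‖ ^ 2 =
      (∫ s in (0 : ℝ)..t, cosK lam s ^ 2) * ‖b‖ ^ 2 +
        (∫ s in (0 : ℝ)..t, cosK lam s * sinK lam s) * (2 * inner ℝ b a) +
        (∫ s in (0 : ℝ)..t, sinK lam s ^ 2) * ‖a‖ ^ 2 := by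
  have hc := continuous_cosK lam
  have hs := continuous_sinK lam
  have e : ∀ s, ‖gSol lam s a b‖ ^ 2 = cosK lam s ^ 2 * ‖b‖ ^ 2 +
      cosK lam s * sinK lam s * (2 * inner ℝ b a) + sinK lam s ^ 2 * ‖a‖ ^ 2 := by
    intro s
    rw [gSol_eq, norm_add_sq_real, norm_smul, norm_smul, inner_smul_left, inner_smul_right,
      RCLike.conj_to_real, mul_pow, mul_pow, Real.norm_eq_abs, Real.norm_eq_abs, sq_abs, sq_abs]
    ring
  simp only [e]
  rw [intervalIntegral.integral_add, intervalIntegral.integral_add,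
    intervalIntegral.integral_mul_const, intervalIntegral.integral_mul_const,
    intervalIntegral.integral_mul_const]
  all_goals exact Continuous.intervalIntegrable (by fun_prop) _ _

theorem tendsto_gaugePhase {ι : Type*} {l : Filter ι} {lam eta : ℝ} {M t : ι → ℝ}
    {a b : ι → Space d} {M₀ t₀ : ℝ} {a₀ b₀ : Space d} (hM : Tendsto M l (𝓝 M₀))
    (ha : Tendsto a l (𝓝 a₀)) (hb : Tendsto b l (𝓝 b₀)) (ht : Tendsto t l (𝓝 t₀)) :
    Tendsto (fun n => gaugePhase lam eta (M n) (a n) (b n) (t n)) l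
      (𝓝 (gaugePhase lam eta M₀ a₀ b₀ t₀)) := by
  have hi : ∀ {g : ℝ → ℝ}, Continuous g →
      Tendsto (fun n => ∫ s in (0 : ℝ)..t n, g s) l (𝓝 (∫ s in (0 : ℝ)..t₀, g s)) := fun hg =>
    ((hg.integral_hasStrictDerivAt 0 t₀).hasDerivAt.continuousAt.tendsto).comp ht
  have hc := continuous_cosK lam
  have hs := continuous_sinK lam
  simp only [gaugePhase, integral_norm_gSol_sq]
  refine (((hM.const_mul eta).div_const 2).neg).mul (((?_ : Tendsto _ l _).add ?_).add ?_)
  · exact (hi (hc.pow 2)).mul (hb.norm.pow 2)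
  · exact (hi (hc.mul hs)).mul ((hb.inner ha).const_mul 2)
  · exact (hi (hs.pow 2)).mul (ha.norm.pow 2)

theorem tendsto_gSol {ι : Type*} {l : Filter ι} {κ t : ι → ℝ} {a b : ι → Space d} {κ₀ t₀ : ℝ}
    {a₀ b₀ : Space d} (hκ : Tendsto κ l (𝓝 κ₀)) (ha : Tendsto a l (𝓝 a₀))
    (hb : Tendsto b l (𝓝 b₀)) (ht : Tendsto t l (𝓝 t₀)) :
    Tendsto (fun n => gSol (κ n) (t n) (a n) (b n)) l (𝓝 (gSol κ₀ t₀ a₀ b₀)) ∧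
      Tendsto (fun n => gSol' (κ n) (t n) (a n) (b n)) l (𝓝 (gSol' κ₀ t₀ a₀ b₀)) := by
  obtain ⟨hc, hs⟩ := tendsto_cosK_sinK hκ ht
  simp only [gSol_eq, gSol'_eq]
  exact ⟨(hc.smul hb).add (hs.smul ha), (hc.smul ha).sub ((hκ.mul hs).smul hb)⟩

theorem tendsto_solutionMap_of_ne_zero {ι : Type*} {l : Filter ι} [l.IsCountablyGenerated]
    {u : ι → L2 d} {u₀ : L2 d} {t : ι → ℝ} {t₀ : ℝ} (lam eta : ℝ) (h0 : u₀ ≠ 0)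
    (hu₀ : sigmaHalfSq u₀ < ∞) (hu : Tendsto (fun n => sigmaHalfSq (u n - u₀)) l (𝓝 0))
    (ht : Tendsto t l (𝓝 t₀)) :
    Tendsto (fun n => sigmaHalfSq (solutionMap lam eta (u n) (t n) - solutionMap lam eta u₀ t₀)) l
      (𝓝 0) := by
  obtain ⟨-, hM, hX, hP⟩ := tendsto_moments hu₀ hu
  have hM0 : mass u₀ ≠ 0 := fun h => h0 ((mass_eq_zero_iff u₀).1 h)
  have ha : Tendsto (fun n => velocity (u n)) l (𝓝 (velocity u₀)) := (hM.inv₀ hM0).smul hP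
  have hb : Tendsto (fun n => center (u n)) l (𝓝 (center u₀)) := (hM.inv₀ hM0).smul hX
  have hκ : Tendsto (fun n => frequency lam eta (u n)) l (𝓝 (frequency lam eta u₀)) :=
    (hM.const_mul eta).const_add lam
  obtain ⟨g1, g1'⟩ := tendsto_gSol (tendsto_const_nhds (x := lam)) ha hb ht
  obtain ⟨g2, g2'⟩ := tendsto_gSol hκ ha hb ht
  simp only [solutionMap_eq_framed]
  refine tendsto_framed ?_ (g1.sub g2) (g1'.sub g2') hκ ht hu₀ hu
  exact (tendsto_gaugePhase hM ha hb ht).neg.add (((g1.inner g2').sub (g2.inner g1')).div_const 2)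

/-- The displacement between the trajectories of the oscillators of frequencies `λ` and
`κ = λ + η M` is controlled by the moments `X` and `P`, and not only by the possibly unbounded
quotients `X / M` and `P / M`, because `κ - λ` is proportional to `M`. -/
theorem exists_bound_displacement (lam eta T : ℝ) : ∃ C, 0 ≤ C ∧ ∀ (u : L2 d) (t : ℝ),
    mass u ≤ 1 → |t| ≤ T →
    ‖gSol lam t (velocity u) (center u) - gSol (frequency lam eta u) t (velocity u) (center u)‖ ≤
      C * (‖meanMomentum u‖ + ‖meanPosition u‖) ∧
    ‖gSol' lam t (velocity u) (center u) - gSol' (frequency lam eta u) t (velocity u) (center u)‖ ≤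
      C * (‖meanMomentum u‖ + ‖meanPosition u‖) := by
  set R := |lam| + |eta| with hR
  obtain ⟨B, hB0, hB⟩ := exists_bound_cosK_sinK R T
  obtain ⟨L, hL0, hL⟩ := exists_lipschitz_cosK_sinK R T
  refine ⟨|eta| * (L + |lam| * L + B), by positivity, fun u t hM ht => ?_⟩
  have hM0 : 0 ≤ mass u := sq_nonneg _
  have h1 : |lam| ≤ R := le_add_of_nonneg_right (abs_nonneg _)
  have h2 : |frequency lam eta u| ≤ R := by
    refine (abs_add_le _ _).trans (add_le_add le_rfl ?_)
    rw [abs_mul, abs_of_nonneg hM0]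
    exact mul_le_of_le_one_right (abs_nonneg _) hM
  obtain ⟨hc, hs⟩ := hL lam (frequency lam eta u) t h1 h2 ht
  have hs' := (hB (frequency lam eta u) t h2 ht).2
  have e : |lam - frequency lam eta u| = |eta| * mass u := by
    rw [frequency, sub_add_cancel_left, abs_neg, abs_mul, abs_of_nonneg hM0]
  rw [e] at hc hs
  have ha : mass u * ‖velocity u‖ = ‖meanMomentum u‖ := by
    rw [← abs_of_nonneg hM0, ← Real.norm_eq_abs, ← norm_smul, velocity, mass_smul_inv_meanMomentum]
  have hb : mass u * ‖center u‖ = ‖meanPosition u‖ := by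
    rw [← abs_of_nonneg hM0, ← Real.norm_eq_abs, ← norm_smul, center, mass_smul_inv_meanPosition]
  have key : ∀ x y C : ℝ, |x| ≤ C * (|eta| * mass u) → |y| ≤ C * (|eta| * mass u) →
      0 ≤ C → C ≤ L + |lam| * L + B →
      |x| * ‖velocity u‖ + |y| * ‖center u‖ ≤ |eta| * (L + |lam| * L + B) *
        (‖meanMomentum u‖ + ‖meanPosition u‖) := by
    intro x y C hx hy hC hC'
    calc |x| * ‖velocity u‖ + |y| * ‖center u‖ ≤
          C * (|eta| * mass u) * ‖velocity u‖ + C * (|eta| * mass u) * ‖center u‖ := by gcongr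
      _ = |eta| * C * (mass u * ‖velocity u‖ + mass u * ‖center u‖) := by ring
      _ = |eta| * C * (‖meanMomentum u‖ + ‖meanPosition u‖) := by rw [ha, hb]
      _ ≤ _ := by gcongr
  have hl := abs_nonneg lam
  have hlL : 0 ≤ |lam| * L := by positivity
  constructor
  · have e1 : gSol lam t (velocity u) (center u) -
        gSol (frequency lam eta u) t (velocity u) (center u) =
        (sinK lam t - sinK (frequency lam eta u) t) • velocity u +
        (cosK lam t - cosK (frequency lam eta u) t) • center u := by
      rw [gSol_eq, gSol_eq]; module
    rw [e1]
    refine (norm_add_le _ _).trans ?_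
    rw [norm_smul, norm_smul, Real.norm_eq_abs, Real.norm_eq_abs]
    exact key _ _ L hs hc hL0 (by linarith)
  · have e1 : gSol' lam t (velocity u) (center u) -
        gSol' (frequency lam eta u) t (velocity u) (center u) =
        (cosK lam t - cosK (frequency lam eta u) t) • velocity u +
        (-(lam * (sinK lam t - sinK (frequency lam eta u) t) +
          (lam - frequency lam eta u) * sinK (frequency lam eta u) t)) • center u := by
      rw [gSol'_eq, gSol'_eq]; module
    rw [e1]
    refine (norm_add_le _ _).trans ?_
    rw [norm_smul, norm_smul, Real.norm_eq_abs, Real.norm_eq_abs]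
    refine key _ _ (L + |lam| * L + B) (hc.trans ?_) ?_ (by positivity) le_rfl
    · have hM1 : 0 ≤ |eta| * mass u := by positivity
      nlinarith
    · rw [abs_neg]
      refine (abs_add_le _ _).trans ?_
      rw [abs_mul, abs_mul, e]
      calc _ ≤ |lam| * (L * (|eta| * mass u)) + |eta| * mass u * B := by gcongr
        _ ≤ _ := by
          have hM1 : 0 ≤ |eta| * mass u * L := by positivity
          linarith

theorem solutionMap_of_zero (lam eta t : ℝ) : solutionMap lam eta (0 : L2 d) t = 0 := by
  rw [← mass_eq_zero_iff, mass_solutionMap, mass_eq_zero_iff]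

/-- Continuity at the zero datum. There the velocity `P/M` and the centre `X/M` may blow up, but the
displacement of the frame stays bounded. -/
theorem tendsto_solutionMap_of_eq_zero {ι : Type*} {l : Filter ι}
    {u : ι → L2 d} {t : ι → ℝ} {T : ℝ} (lam eta : ℝ)
    (hu : Tendsto (fun n => sigmaHalfSq (u n)) l (𝓝 0)) (ht : ∀ᶠ n in l, |t n| ≤ T) :
    Tendsto (fun n => sigmaHalfSq (solutionMap lam eta (u n) (t n))) l (𝓝 0) := by
  obtain ⟨-, hM, hX, hP⟩ := tendsto_moments (u := u) (v := 0) (l := l)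
    (by rw [sigmaHalfSq_zero]; exact ENNReal.zero_lt_top) (by simpa using hu)
  rw [(mass_eq_zero_iff _).2 rfl] at hM
  rw [meanPosition_zero] at hX
  rw [meanMomentum_zero] at hP
  obtain ⟨C, hC0, hC⟩ := exists_bound_displacement (d := d) lam eta T
  obtain ⟨R, hR, hRb⟩ := exists_translationBound_framed (d := d) (C * 2 + |lam| + |eta| + |T|)
  obtain ⟨D, hD, hDb⟩ := TranslationBound.sigmaHalfSq_le (d := d) hR
  have hlim := ENNReal.Tendsto.const_mul (a := D) hu (Or.inr hD)
  rw [mul_zero] at hlim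
  refine tendsto_of_tendsto_of_tendsto_of_le_of_le' tendsto_const_nhds hlim
    (Eventually.of_forall fun _ => zero_le) ?_
  have b1 := abs_nonneg lam
  have b2 := abs_nonneg eta
  have b3 := abs_nonneg T
  have hlt : ‖(0 : Space d)‖ < 1 := by simp
  filter_upwards [hM.eventually_lt_const zero_lt_one, hX.norm.eventually_lt_const hlt,
    hP.norm.eventually_lt_const hlt, ht] with n h1 h2 h3 h4
  obtain ⟨hq, hp⟩ := hC (u n) (t n) h1.le h4
  have h5 : C * (‖meanMomentum (u n)‖ + ‖meanPosition (u n)‖) ≤ C * 2 := by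
    gcongr; linarith
  rw [solutionMap_eq_framed]
  refine hDb _ (hRb _ _ _ _ _ (by linarith) (by linarith) ?_ ?_) _
  · have h6 : |frequency lam eta (u n)| ≤ |lam| + |eta| := by
      refine (abs_add_le _ _).trans (add_le_add le_rfl ?_)
      have hM0 : 0 ≤ mass (u n) := sq_nonneg _
      rw [abs_mul, abs_of_nonneg hM0]
      exact mul_le_of_le_one_right b2 h1.le
    have : 0 ≤ C * 2 := by positivity
    linarith
  · have : 0 ≤ C * 2 := by positivity
    have := le_abs_self T
    linarith

/-- Joint continuity of the solution in time and datum. -/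
theorem tendsto_solutionMap {ι : Type*} {l : Filter ι} [l.IsCountablyGenerated]
    {u : ι → L2 d} {u₀ : L2 d} {t : ι → ℝ} {t₀ : ℝ} (lam eta : ℝ)
    (hu₀ : sigmaHalfSq u₀ < ∞) (hu : Tendsto (fun n => sigmaHalfSq (u n - u₀)) l (𝓝 0))
    (ht : Tendsto t l (𝓝 t₀)) :
    Tendsto (fun n => sigmaHalfSq (solutionMap lam eta (u n) (t n) - solutionMap lam eta u₀ t₀)) l
      (𝓝 0) := by
  by_cases h0 : u₀ = 0
  · subst h0
    simp only [solutionMap_of_zero, sub_zero] at hu ⊢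
    exact tendsto_solutionMap_of_eq_zero lam eta hu
      ((ht.abs.eventually_lt_const (lt_add_one _)).mono fun _ h => h.le)
  · exact tendsto_solutionMap_of_ne_zero lam eta h0 hu₀ hu ht

theorem sigmaHalfSq_neg (u : L2 d) : sigmaHalfSq (-u) = sigmaHalfSq u := by
  have h : ∀ (w : Space d → ℝ) (v : L2 d), ∫⁻ x : Space d, ENNReal.ofReal (w x * ‖(-v) x‖ ^ 2) =
      ∫⁻ x : Space d, ENNReal.ofReal (w x * ‖v x‖ ^ 2) := by
    intro w v
    refine lintegral_congr_ae ?_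
    filter_upwards [Lp.coeFn_neg v] with x hx
    rw [hx, Pi.neg_apply, norm_neg]
  rw [sigmaHalfSq, map_neg, h, h, norm_neg, sigmaHalfSq]

/-- Continuity of the solution map from `Σ^{1/2}` to `L^∞_loc(ℝ; Σ^{1/2})`. -/
theorem continuous_dependence (lam eta : ℝ) {u₀ : L2 d} (hu₀ : MemSigma (1 / 2) u₀) (T : ℝ)
    {ε : ℝ≥0∞} (hε : 0 < ε) : ∃ δ : ℝ≥0∞, 0 < δ ∧ ∀ u : L2 d, MemSigma (1 / 2) u →
      sigmaNorm (1 / 2) (u - u₀) < δ → ∀ t : ℝ, |t| ≤ T →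
        sigmaNorm (1 / 2) (solutionMap lam eta u t - solutionMap lam eta u₀ t) < ε := by
  by_contra! hcon
  have h1 : ∀ n : ℕ, ∃ (u : L2 d) (t : ℝ), sigmaNorm (1 / 2) (u - u₀) < (n : ℝ≥0∞)⁻¹ ∧ |t| ≤ T ∧
      ε ≤ sigmaNorm (1 / 2) (solutionMap lam eta u t - solutionMap lam eta u₀ t) := fun n => by
    obtain ⟨u, -, h1, t, h2, h3⟩ := hcon (n : ℝ≥0∞)⁻¹ (by simp)
    exact ⟨u, t, h1, h2, h3⟩
  choose u t hu ht hne using h1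
  obtain ⟨t₀, -, φ, hφ, hφt⟩ := (isCompact_Icc (a := -T) (b := T)).tendsto_subseq
    fun n => abs_le.1 (ht n)
  have hu₀' := (memSigma_half_iff u₀).1 hu₀
  have hlim : Tendsto (fun n => sigmaNorm (1 / 2) (u (φ n) - u₀)) atTop (𝓝 0) :=
    tendsto_of_tendsto_of_tendsto_of_le_of_le tendsto_const_nhds
      (ENNReal.tendsto_inv_nat_nhds_zero.comp hφ.tendsto_atTop) (fun _ => zero_le)
      fun n => (hu (φ n)).le
  have h2 := tendsto_solutionMap lam eta hu₀' ((tendsto_sigmaNorm_half_iff _).1 hlim) hφt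
  have h3 := tendsto_solutionMap lam eta hu₀' (u := fun _ : ℕ => u₀)
    (by simp [sigmaHalfSq_zero]) hφt
  have h4 : Tendsto (fun n => sigmaHalfSq (solutionMap lam eta (u (φ n)) (t (φ n)) -
      solutionMap lam eta u₀ (t (φ n)))) atTop (𝓝 0) := by
    have h5 := (ENNReal.Tendsto.const_mul (a := 2) h2 (Or.inr (by norm_num))).add
      (ENNReal.Tendsto.const_mul (a := 2) h3 (Or.inr (by norm_num)))
    rw [mul_zero, add_zero] at h5
    refine tendsto_of_tendsto_of_tendsto_of_le_of_le tendsto_const_nhds h5 (fun _ => zero_le)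
      fun n => ?_
    have e : solutionMap lam eta (u (φ n)) (t (φ n)) - solutionMap lam eta u₀ (t (φ n)) =
        (solutionMap lam eta (u (φ n)) (t (φ n)) - solutionMap lam eta u₀ t₀) +
        -(solutionMap lam eta u₀ (t (φ n)) - solutionMap lam eta u₀ t₀) := by abel
    rw [e]
    refine (sigmaHalfSq_add_le _ _).trans ?_
    rw [sigmaHalfSq_neg]
    rfl
  have h6 := (tendsto_sigmaNorm_half_iff _).2 h4
  exact absurd (ge_of_tendsto' h6 fun n => hne (φ n)) (not_le.2 hε)

/-! ### Energy -/

theorem momentSq_le_sigmaNorm (u : L2 d) : momentSq u ≤ sigmaNorm 1 u ^ 2 :=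
  (lintegral_weight_le_sigmaNorm u (s := 1) (m := fun r => r ^ 2)
    (fun r _ => by rw [Real.rpow_one]; linarith)).1

theorem gradSq_le_sigmaNorm (u : L2 d) : gradSq u ≤ sigmaNorm 1 u ^ 2 :=
  (lintegral_weight_le_sigmaNorm u (s := 1) (m := fun r => r ^ 2)
    (fun r _ => by rw [Real.rpow_one]; linarith)).2

theorem sigmaHalfSq_lt_top_of_memSigma_one {u : L2 d} (hu : MemSigma 1 u) : sigmaHalfSq u < ∞ := by
  have h := lintegral_weight_le_sigmaNorm u (s := 1) (m := fun r => r)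
    (fun r _ => by rw [Real.rpow_one]; nlinarith [sq_nonneg (r - 1)])
  have hf : sigmaNorm 1 u ^ 2 < ∞ := ENNReal.pow_lt_top hu
  exact ENNReal.add_lt_top.2 ⟨ENNReal.add_lt_top.2 ⟨h.1.trans_lt hf, h.2.trans_lt hf⟩,
    ENNReal.ofReal_lt_top⟩

theorem gradSq_eq (u : L2 d) :
    gradSq u = ENNReal.ofReal ((2 * Real.pi) ^ 2) * momentSq (fourierU u) := by
  rw [momentSq, ← lintegral_const_mul' _ _ ENNReal.ofReal_ne_top]
  refine lintegral_congr fun ξ => ?_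
  rw [← ENNReal.ofReal_mul (by positivity), mul_pow, mul_assoc]
  rfl

theorem fourierU_weyl_zero_right (q : Space d) (u : L2 d) :
    fourierU (weyl q 0 u) = weyl 0 (-(2 * Real.pi) • q) (fourierU u) := by
  rw [weyl_zero_right, fourierU_translate, weyl_zero_left]
  congr 2
  funext ξ
  rw [shiftSymbol, inner_smul_right]

theorem norm_sq_coord (x : Space d) : ‖x‖ ^ 2 = ∑ j, x j ^ 2 := EuclideanSpace.real_norm_sq_eq x

theorem norm_coord_le (x : Space d) (j : Fin d) : |x j| ≤ ‖x‖ := by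
  rw [← Real.norm_eq_abs]; exact PiLp.norm_apply_le x j

/-- If `x u` is in `L²`, then the phases `exp(iε x·p) u` are differentiable at `ε = 0`; the vectors
`A j` are `x_j u`. -/
theorem exists_hasDerivAt_weyl_position {u : L2 d} (hu : momentSq u < ∞) :
    ∃ A : Fin d → L2 d, ∀ p : Space d,
      HasDerivAt (fun ε : ℝ => weyl 0 (ε • p) u) (Complex.I • ∑ j, (p j : ℂ) • A j) 0 := by
  have hm : ∀ c : ℝ, MemLp (fun x : Space d => c * ‖x‖ * ‖u x‖) 2 volume := by
    intro c
    have hmeas : AEStronglyMeasurable (fun x : Space d => ‖x‖ * ‖u x‖) volume :=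
      (measurable_norm.mul (Lp.stronglyMeasurable u).measurable.norm).aestronglyMeasurable
    have h1 : MemLp (fun x : Space d => ‖x‖ * ‖u x‖) 2 volume := by
      rw [memLp_two_iff_integrable_sq hmeas]
      refine ⟨hmeas.pow 2, ?_⟩
      rw [hasFiniteIntegral_iff_norm]
      refine lt_of_eq_of_lt (lintegral_congr fun x => ?_) hu
      rw [Real.norm_of_nonneg (by positivity), mul_pow]
    refine (h1.const_mul c).congr_norm ?_ (Eventually.of_forall fun x => ?_)
    · simpa only [mul_assoc] using hmeas.const_mul c
    · simp only [mul_assoc]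
  have hA : ∀ j : Fin d, MemLp (fun x : Space d => ((x j : ℝ) : ℂ) * u x) 2 volume := by
    intro j
    refine (hm 1).of_le ?_ (Eventually.of_forall fun x => ?_)
    · exact (Continuous.aestronglyMeasurable (by fun_prop)).mul (Lp.aestronglyMeasurable u)
    · rw [norm_mul, Complex.norm_real, Real.norm_eq_abs, one_mul, norm_mul, norm_norm, norm_norm]
      exact mul_le_mul_of_nonneg_right (norm_coord_le x j) (norm_nonneg _)
  refine ⟨fun j => (hA j).toLp _, fun p => ?_⟩
  have h := hasDerivAt_phase (θ := fun ε x => inner ℝ x (ε • p)) (fun ε => by fun_prop)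
    (θ' := fun x => inner ℝ x p) (t := 0) (fun x => by
      simp only [inner_smul_right]
      simpa using (hasDerivAt_id (0 : ℝ)).mul_const (inner ℝ x p : ℝ))
    (fun x => ‖p‖ * ‖x‖) (Eventually.of_forall fun s x => by
      simp only [inner_smul_right]
      rw [← sub_mul, abs_mul]
      gcongr
      rw [mul_comm]
      exact abs_real_inner_le_norm x p) (u := u)
    (w := Complex.I • ∑ j, (p j : ℂ) • (hA j).toLp _) (hm ‖p‖) ?_
  · simpa only [weyl_zero_left] using h
  · have hsum : (↑↑(∑ j, (p j : ℂ) • (hA j).toLp _ : L2 d) : Space d → ℂ) =ᵐ[volume]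
        fun x => ∑ j, (p j : ℂ) * (((x j : ℝ) : ℂ) * u x) := by
      refine (Lp.coeFn_finsetSum _ _).trans ?_
      have : ∀ j, ∀ᵐ x, ((p j : ℂ) • (hA j).toLp _ : L2 d) x =
          (p j : ℂ) * (((x j : ℝ) : ℂ) * u x) := fun j => by
        filter_upwards [Lp.coeFn_smul (p j : ℂ) ((hA j).toLp _), (hA j).coeFn_toLp] with x h1 h2
        rw [h1, Pi.smul_apply, h2, smul_eq_mul]
      filter_upwards [ae_all_iff.2 this] with x hx
      rw [Finset.sum_apply]
      exact Finset.sum_congr rfl fun j _ => hx j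
    filter_upwards [Lp.coeFn_smul Complex.I (∑ j, (p j : ℂ) • (hA j).toLp _ : L2 d), hsum]
      with x h1 h2
    rw [h1, Pi.smul_apply, h2, smul_eq_mul]
    have e : (inner ℝ x p : ℝ) = ∑ j, p j * x j := by
      rw [PiLp.inner_apply]
      exact Finset.sum_congr rfl fun j _ => by simp
    rw [e]
    simp only [zero_smul, inner_zero_right, Complex.ofReal_zero, zero_mul, Complex.exp_zero,
        mul_one]
    push_cast
    rw [mul_assoc, Finset.sum_mul]
    simp only [mul_assoc]

/-- Conversely, differentiability of the phases `exp(iε x·p) u` identifies `x·p u`. -/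
theorem lintegral_inner_sq_of_hasDerivAt {u g : L2 d} {p : Space d}
    (h : HasDerivAt (fun ε : ℝ => weyl 0 (ε • p) u) g 0) :
    ∫⁻ x : Space d, ENNReal.ofReal ((inner ℝ x p) ^ 2 * ‖u x‖ ^ 2) = ENNReal.ofReal (‖g‖ ^ 2) := by
  have hseq : Tendsto (fun n : ℕ => 1 / ((n : ℝ) + 1)) atTop (𝓝[≠] 0) :=
    tendsto_nhdsWithin_iff.2 ⟨tendsto_one_div_add_atTop_nhds_zero_nat,
      Eventually.of_forall fun n => by
        have : (0 : ℝ) < 1 / ((n : ℝ) + 1) := by positivity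
        exact this.ne'⟩
  have h1 := (hasDerivAt_iff_tendsto_slope.1 h).comp hseq
  have h2 := tendstoInMeasure_of_tendsto_Lp h1
  obtain ⟨ns, hns, hae⟩ := h2.exists_seq_tendsto_ae
  have hs : ∀ᵐ x : Space d, ∀ n : ℕ,
      (slope (fun ε : ℝ => weyl 0 (ε • p) u) 0 (1 / ((n : ℝ) + 1)) : L2 d) x =
      slope (fun ε : ℝ => Complex.exp (((ε * inner ℝ x p : ℝ) : ℂ) * Complex.I) * u x) 0
        (1 / ((n : ℝ) + 1)) := by
    rw [ae_all_iff]
    intro n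
    have hw0 : weyl 0 ((0 : ℝ) • p) u = u := by rw [zero_smul, weyl_zero]; rfl
    rw [slope_def_module, hw0, weyl_zero_left]
    filter_upwards [Lp.coeFn_smul (1 / ((n : ℝ) + 1) - 0)⁻¹ (phase (fun x => inner ℝ x
        ((1 / ((n : ℝ) + 1)) • p)) (by fun_prop) u - u),
      Lp.coeFn_sub (phase (fun x => inner ℝ x ((1 / ((n : ℝ) + 1)) • p)) (by fun_prop) u) u,
      phase_coe (fun x => inner ℝ x ((1 / ((n : ℝ) + 1)) • p)) (by fun_prop) u] with x a1 a2 a3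
    rw [a1, Pi.smul_apply, a2, Pi.sub_apply, a3, slope_def_module]
    simp [inner_smul_right]
  rw [norm_sq_eq_lintegral]
  refine lintegral_congr_ae ?_
  filter_upwards [hae, hs] with x h3 h4
  have h5 : HasDerivAt (fun ε : ℝ => Complex.exp (((ε * inner ℝ x p : ℝ) : ℂ) * Complex.I) * u x)
      (((inner ℝ x p : ℝ) : ℂ) * Complex.I * u x) 0 := by
    have := (((((hasDerivAt_id (0 : ℝ)).mul_const (inner ℝ x p : ℝ)).ofReal_comp).mul_const
      Complex.I).cexp).mul_const (u x)
    simpa using this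
  have h6 := ((hasDerivAt_iff_tendsto_slope.1 h5).comp hseq).comp hns.tendsto_atTop
  have h7 : g x = ((inner ℝ x p : ℝ) : ℂ) * Complex.I * u x := by
    refine tendsto_nhds_unique h3 (h6.congr fun n => ?_)
    simp only [Function.comp]
    exact (h4 (ns n)).symm
  rw [h7, norm_mul, norm_mul, Complex.norm_real, Complex.norm_I, mul_one, mul_pow,
    Real.norm_eq_abs, sq_abs]

theorem momentSq_eq_sum_of_hasDerivAt {u : L2 d} {g : Fin d → L2 d}
    (h : ∀ j, HasDerivAt (fun ε : ℝ => weyl 0 (ε • basisVec j) u) (g j) 0) :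
    momentSq u = ENNReal.ofReal (∑ j, ‖g j‖ ^ 2) := by
  have hu : Measurable fun x => ‖u x‖ ^ 2 := (Lp.stronglyMeasurable u).measurable.norm.pow_const 2
  rw [ENNReal.ofReal_sum_of_nonneg fun j _ => by positivity]
  simp only [← fun j => lintegral_inner_sq_of_hasDerivAt (h j)]
  rw [← lintegral_finsetSum]
  · refine lintegral_congr fun x => ?_
    rw [← ENNReal.ofReal_sum_of_nonneg fun j _ => by positivity, ← Finset.sum_mul, norm_sq_coord]
    simp only [inner_basisVec]
  · intro j _
    refine Measurable.ennreal_ofReal (Measurable.mul ?_ hu)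
    fun_prop

theorem gradSq_eq_sum_of_hasDerivAt {u : L2 d} {g : Fin d → L2 d}
    (h : ∀ j, HasDerivAt (fun ε : ℝ => weyl (ε • basisVec j) 0 u) (g j) 0) :
    gradSq u = ENNReal.ofReal (∑ j, ‖g j‖ ^ 2) := by
  have hpi := Real.pi_pos
  have h1 : ∀ j, HasDerivAt (fun ε : ℝ => weyl 0 (ε • basisVec j) (fourierU u))
      ((-(2 * Real.pi)⁻¹ : ℝ) • fourierU (g j)) 0 := by
    intro j
    have h2 : HasDerivAt (fun ε : ℝ => fourierU (weyl (ε • basisVec j) 0 u)) (fourierU (g j)) 0 :=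
      ((fourierU (d := d)).toContinuousLinearEquiv.toContinuousLinearMap.restrictScalars
        ℝ).hasFDerivAt.comp_hasDerivAt
        0 (h j)
    have h3 : HasDerivAt (fun ε : ℝ => -(2 * Real.pi)⁻¹ * ε) (-(2 * Real.pi)⁻¹) 0 := by
      simpa using (hasDerivAt_id (0 : ℝ)).const_mul (-(2 * Real.pi)⁻¹)
    have h4 := HasDerivAt.scomp (h := fun ε : ℝ => -(2 * Real.pi)⁻¹ * ε) 0
      (by rw [mul_zero]; exact h2) h3
    refine h4.congr_of_eventuallyEq (Eventually.of_forall fun ε => ?_)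
    simp only [Function.comp]
    rw [fourierU_weyl_zero_right, smul_smul, ← mul_assoc]
    congr 3
    field_simp
  rw [gradSq_eq, momentSq_eq_sum_of_hasDerivAt h1, ← ENNReal.ofReal_mul (by positivity),
    Finset.mul_sum]
  congr 1
  refine Finset.sum_congr rfl fun j _ => ?_
  rw [real_smul_L2, norm_smul, LinearIsometryEquiv.norm_map, Complex.norm_real, norm_neg, norm_inv,
    Real.norm_of_nonneg (by positivity), mul_pow]
  field_simp

/-- If `∇u ∈ L²` then the translates of `u` are differentiable; the vectors `B j` are `-i ∂_j u`. -/
theorem exists_hasDerivAt_weyl_momentum {u : L2 d} (hu : gradSq u < ∞) :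
    ∃ B : Fin d → L2 d, ∀ q : Space d,
      HasDerivAt (fun ε : ℝ => weyl (ε • q) 0 u) (-(Complex.I • ∑ j, (q j : ℂ) • B j)) 0 := by
  have hpi := Real.pi_pos
  have h1 : momentSq (fourierU u) < ∞ := by
    rw [gradSq_eq] at hu
    refine lt_top_iff_ne_top.2 fun h => ?_
    rw [h, ENNReal.mul_top (by simp)] at hu
    exact lt_irrefl _ hu
  obtain ⟨A, hA⟩ := exists_hasDerivAt_weyl_position h1
  refine ⟨fun j => ((2 * Real.pi : ℝ) : ℂ) • fourierU.symm (A j), fun q => ?_⟩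
  have h2 := ((fourierU (d := d)).symm.toContinuousLinearEquiv.toContinuousLinearMap.restrictScalars
    ℝ).hasFDerivAt.comp_hasDerivAt 0 (hA (-(2 * Real.pi) • q))
  refine (h2.congr_of_eventuallyEq (Eventually.of_forall fun ε => ?_)).congr_deriv ?_
  · change weyl (ε • q) 0 u = fourierU.symm (weyl 0 (ε • -(2 * Real.pi) • q) (fourierU u))
    rw [smul_comm, ← fourierU_weyl_zero_right, LinearIsometryEquiv.symm_apply_apply]
  · change fourierU.symm (Complex.I • ∑ j, ((-(2 * Real.pi) • q) j : ℂ) • A j) = _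
    rw [map_smul, map_sum, ← smul_neg, ← Finset.sum_neg_distrib]
    congr 1
    refine Finset.sum_congr rfl fun j _ => ?_
    rw [map_smul, PiLp.smul_apply, smul_smul, ← neg_smul, smul_eq_mul]
    congr 1
    push_cast
    ring

/-- For `u ∈ Σ` all the Weyl orbits through `u` are differentiable; the vectors `A j` and `B j` are
`x_j u` and `-i ∂_j u`. -/
theorem exists_hasDerivAt_weyl {u : L2 d} (hm : momentSq u < ∞) (hg : gradSq u < ∞) :
    ∃ A B : Fin d → L2 d, ∀ q p : Space d, HasDerivAt (fun ε : ℝ => weyl (ε • q) (ε • p) u)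
      (Complex.I • (∑ j, (p j : ℂ) • A j - ∑ j, (q j : ℂ) • B j)) 0 := by
  obtain ⟨A, hA⟩ := exists_hasDerivAt_weyl_position hm
  obtain ⟨B, hB⟩ := exists_hasDerivAt_weyl_momentum hg
  refine ⟨A, B, fun q p => ?_⟩
  have h0 : weyl ((0 : ℝ) • q) 0 u = u := by rw [zero_smul, weyl_zero]; rfl
  have h1 := hasDerivAt_isometry_apply (T := fun ε : ℝ => weyl 0 (ε • p)) (hB q)
    (by rw [h0]; exact hA p)
    (tendsto_weyl tendsto_const_nhds (Continuous.tendsto (by fun_prop) 0) _)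
  have h2 := (hasDerivAt_weyl_cocycle q p).smul h1
  refine (h2.congr_of_eventuallyEq (Eventually.of_forall fun ε => ?_)).congr_deriv ?_
  · exact weyl_eq_weyl_weyl _ _ _
  · have h3 : ∀ v : L2 d, weyl 0 ((0 : ℝ) • p) v = v := fun v => by
      rw [zero_smul, weyl_zero]; rfl
    rw [h3]
    simp only [zero_smul, add_zero, inner_zero_left, neg_zero, zero_div, Complex.ofReal_zero,
        zero_mul,
      Complex.exp_zero, one_smul]
    rw [smul_sub, sub_eq_add_neg, add_comm]

theorem sum_basisVec_smul (A : Fin d → L2 d) (c : ℝ) (j : Fin d) :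
    ∑ i, ((c • basisVec j) i : ℂ) • A i = (c : ℂ) • A j := by
  rw [Finset.sum_eq_single j]
  · simp [basisVec]
  · intro i _ hi
    simp [basisVec, hi]
  · simp

/-- The position and momentum components of a framed state: they are transported by the classical
flow and shifted by the frame. -/
theorem hasDerivAt_weyl_framed {u : L2 d} {A B : Fin d → L2 d}
    (h : ∀ q p : Space d, HasDerivAt (fun ε : ℝ => weyl (ε • q) (ε • p) u)
      (Complex.I • (∑ j, (p j : ℂ) • A j - ∑ j, (q j : ℂ) • B j)) 0)
    (θ : ℝ) (q₀ p₀ : Space d) (κ t : ℝ) (q p : Space d) :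
    HasDerivAt (fun ε : ℝ => weyl (ε • q) (ε • p) (framed θ q₀ p₀ κ t u))
      (framed θ q₀ p₀ κ t (Complex.I • (((inner ℝ q₀ p - inner ℝ q p₀ : ℝ) : ℂ) • u +
        (∑ j, ((cosK κ t • p + (κ * sinK κ t) • q) j : ℂ) • A j -
          ∑ j, ((cosK κ t • q - sinK κ t • p) j : ℂ) • B j)))) 0 := by
  set σ : ℝ := inner ℝ q₀ p - inner ℝ q p₀ with hσ
  have h1 : HasDerivAt (fun ε : ℝ => Complex.exp (((ε * σ : ℝ) : ℂ) * Complex.I))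
      ((σ : ℂ) * Complex.I) 0 := by
    have := ((((hasDerivAt_id (0 : ℝ)).mul_const σ).ofReal_comp).mul_const Complex.I).cexp
    simpa using this
  have h2 := h1.smul (h (cosK κ t • q - sinK κ t • p) (cosK κ t • p + (κ * sinK κ t) • q))
  have h3 := ((framed θ q₀ p₀ κ t).toContinuousLinearEquiv.toContinuousLinearMap.restrictScalars
    ℝ).hasFDerivAt.comp_hasDerivAt 0 h2
  refine (h3.congr_of_eventuallyEq (Eventually.of_forall fun ε => ?_)).congr_deriv ?_
  · simp only [weyl_framed]
    change framed θ q₀ p₀ κ t _ = framed θ q₀ p₀ κ t _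
    congr 3
    · rw [inner_smul_left, inner_smul_right, hσ]
      congr 3
      simp only [RCLike.conj_to_real]
      ring
    · congr 1 <;> module
  · change framed θ q₀ p₀ κ t _ = framed θ q₀ p₀ κ t _
    congr 1
    have h4 : weyl ((0 : ℝ) • (cosK κ t • q - sinK κ t • p))
        ((0 : ℝ) • (cosK κ t • p + (κ * sinK κ t) • q)) u = u := by
      rw [zero_smul, zero_smul, weyl_zero]; rfl
    rw [h4]
    simp only [zero_mul, Complex.ofReal_zero, Complex.exp_zero, one_smul]
    rw [add_comm, smul_add Complex.I, smul_smul Complex.I, mul_comm Complex.I]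

theorem momentSq_framed {u : L2 d} {A B : Fin d → L2 d}
    (h : ∀ q p : Space d, HasDerivAt (fun ε : ℝ => weyl (ε • q) (ε • p) u)
      (Complex.I • (∑ j, (p j : ℂ) • A j - ∑ j, (q j : ℂ) • B j)) 0)
    (θ : ℝ) (q₀ p₀ : Space d) (κ t : ℝ) :
    momentSq (framed θ q₀ p₀ κ t u) = ENNReal.ofReal (∑ j, ‖((q₀ j : ℝ) : ℂ) • u +
      ((cosK κ t : ℝ) : ℂ) • A j + ((sinK κ t : ℝ) : ℂ) • B j‖ ^ 2) := by
  rw [momentSq_eq_sum_of_hasDerivAt fun j => by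
    simpa only [smul_zero] using hasDerivAt_weyl_framed h θ q₀ p₀ κ t 0 (basisVec j)]
  congr 1
  refine Finset.sum_congr rfl fun j _ => ?_
  rw [LinearIsometryEquiv.norm_map, norm_smul, Complex.norm_I, one_mul, add_zero, zero_sub,
      inner_basisVec, inner_zero_left, sub_zero, sum_basisVec_smul, ← neg_smul,
    sum_basisVec_smul, Complex.ofReal_neg, neg_smul, sub_neg_eq_add, add_assoc]

theorem gradSq_framed {u : L2 d} {A B : Fin d → L2 d}
    (h : ∀ q p : Space d, HasDerivAt (fun ε : ℝ => weyl (ε • q) (ε • p) u)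
      (Complex.I • (∑ j, (p j : ℂ) • A j - ∑ j, (q j : ℂ) • B j)) 0)
    (θ : ℝ) (q₀ p₀ : Space d) (κ t : ℝ) :
    gradSq (framed θ q₀ p₀ κ t u) = ENNReal.ofReal (∑ j, ‖((p₀ j : ℝ) : ℂ) • u +
      ((-(κ * sinK κ t) : ℝ) : ℂ) • A j + ((cosK κ t : ℝ) : ℂ) • B j‖ ^ 2) := by
  rw [gradSq_eq_sum_of_hasDerivAt fun j => by
    simpa only [smul_zero] using hasDerivAt_weyl_framed h θ q₀ p₀ κ t (basisVec j) 0]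
  congr 1
  refine Finset.sum_congr rfl fun j _ => ?_
  rw [LinearIsometryEquiv.norm_map, norm_smul, Complex.norm_I, one_mul, zero_add, sub_zero,
      inner_zero_right, real_inner_comm p₀, inner_basisVec, zero_sub,
    sum_basisVec_smul, sum_basisVec_smul, ← norm_neg]
  congr 2
  push_cast
  module

/-- The first moments are the expectations of the position and momentum components. -/
theorem inner_eq_moments {u : L2 d} (hu : sigmaHalfSq u < ∞) {A B : Fin d → L2 d}
    (h : ∀ q p : Space d, HasDerivAt (fun ε : ℝ => weyl (ε • q) (ε • p) u)
      (Complex.I • (∑ j, (p j : ℂ) • A j - ∑ j, (q j : ℂ) • B j)) 0) (j : Fin d) :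
    (inner ℂ u (A j)).re = meanPosition u j ∧ (inner ℂ u (B j)).re = meanMomentum u j := by
  have key : ∀ q p : Space d, inner ℂ u (∑ j, (p j : ℂ) • A j - ∑ j, (q j : ℂ) • B j) =
      ((inner ℝ (meanPosition u) p - inner ℝ (meanMomentum u) q : ℝ) : ℂ) := by
    intro q p
    have h1 := ((innerSL ℂ u).restrictScalars ℝ).hasFDerivAt.comp_hasDerivAt 0 (h q p)
    have h2 := h1.unique (hasDerivAt_inner_weyl hu q p)
    change inner ℂ u _ = _ at h2
    rw [inner_smul_right] at h2
    exact mul_left_cancel₀ Complex.I_ne_zero h2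
  constructor
  · have h1 := key 0 ((1 : ℝ) • basisVec j)
    rw [sum_basisVec_smul] at h1
    simp only [PiLp.zero_apply, Complex.ofReal_zero, zero_smul, Finset.sum_const_zero, sub_zero,
      inner_zero_right, Complex.ofReal_one, one_smul, inner_basisVec] at h1
    rw [h1, Complex.ofReal_re]
  · have h1 := key ((-1 : ℝ) • basisVec j) 0
    rw [sum_basisVec_smul] at h1
    simp only [PiLp.zero_apply, Complex.ofReal_zero, zero_smul, Finset.sum_const_zero, zero_sub,
      inner_zero_right, Complex.ofReal_neg, Complex.ofReal_one, neg_smul, one_smul, neg_neg,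
      inner_neg_right, inner_basisVec] at h1
    rw [h1, Complex.ofReal_re]

/-- The interaction energy is a function of the mass, the centre and the second moment. -/
theorem toReal_interaction {u : L2 d} (hu : sigmaHalfSq u < ∞) (hm : momentSq u < ∞) :
    interaction u < ∞ ∧ (interaction u).toReal =
      2 * mass u * (momentSq u).toReal - 2 * ‖meanPosition u‖ ^ 2 := by
  have hpos := position_lt_top hu
  have hmeas : Measurable fun x => ‖u x‖ ^ 2 :=
    (Lp.stronglyMeasurable u).measurable.norm.pow_const 2
  have i0 := integrable_norm_sq u
  have i1 : ∀ p : Space d, Integrable fun x : Space d => inner ℝ x p * ‖u x‖ ^ 2 := fun p => by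
    refine ((integrable_position hpos).inner_const (𝕜 := ℝ) p).congr
      (Eventually.of_forall fun x => ?_)
    simp only [inner_smul_left, RCLike.conj_to_real]
    ring
  have i2 : Integrable fun x : Space d => ‖x‖ ^ 2 * ‖u x‖ ^ 2 := by
    refine ⟨((measurable_norm.pow_const 2).mul hmeas).aestronglyMeasurable, ?_⟩
    rw [hasFiniteIntegral_iff_ofReal (Eventually.of_forall fun x => by positivity)]
    exact hm
  have e0 : ∫ x : Space d, ‖u x‖ ^ 2 = mass u := integral_norm_sq u
  have e2 : ∫ x : Space d, ‖x‖ ^ 2 * ‖u x‖ ^ 2 = (momentSq u).toReal := by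
    rw [integral_eq_lintegral_of_nonneg_ae (Eventually.of_forall fun x => by positivity) i2.1]
    rfl
  set Q := (momentSq u).toReal
  set X := meanPosition u with hX
  have hI : ∀ (a b c : ℝ) (p : Space d), Integrable (fun x : Space d =>
      a * (‖x‖ ^ 2 * ‖u x‖ ^ 2) + b * (inner ℝ x p * ‖u x‖ ^ 2) + c * ‖u x‖ ^ 2) ∧
      ∫ x : Space d, (a * (‖x‖ ^ 2 * ‖u x‖ ^ 2) + b * (inner ℝ x p * ‖u x‖ ^ 2) + c * ‖u x‖ ^ 2) =
        a * Q + b * inner ℝ X p + c * mass u := by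
    intro a b c p
    have j1 : Integrable fun x : Space d =>
        a * (‖x‖ ^ 2 * ‖u x‖ ^ 2) + b * (inner ℝ x p * ‖u x‖ ^ 2) :=
      (i2.const_mul a).add ((i1 p).const_mul b)
    refine ⟨j1.add (i0.const_mul c), ?_⟩
    rw [integral_add j1 (i0.const_mul c), integral_add (i2.const_mul a) ((i1 p).const_mul b),
      integral_const_mul, integral_const_mul, integral_const_mul, e0, e2, hX,
          inner_meanPosition hpos]
  have e : ∀ x y : Space d, ‖x - y‖ ^ 2 * ‖u x‖ ^ 2 * ‖u y‖ ^ 2 = ‖u x‖ ^ 2 * (‖y‖ ^ 2 * ‖u y‖ ^ 2)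
      + -2 * ‖u x‖ ^ 2 * (inner ℝ y x * ‖u y‖ ^ 2) + ‖x‖ ^ 2 * ‖u x‖ ^ 2 * ‖u y‖ ^ 2 :=
          fun x y => by
    rw [norm_sub_sq_real, real_inner_comm]
    ring
  have hin : ∀ x : Space d, ∫ y : Space d, ‖x - y‖ ^ 2 * ‖u x‖ ^ 2 * ‖u y‖ ^ 2 =
      mass u * (‖x‖ ^ 2 * ‖u x‖ ^ 2) + -2 * (inner ℝ x X * ‖u x‖ ^ 2) + Q * ‖u x‖ ^ 2 := fun x => by
    simp only [e]
    rw [(hI _ _ _ x).2, real_inner_comm]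
    ring
  rw [interaction]
  have hlin : ∀ x : Space d,
      ∫⁻ y : Space d, ENNReal.ofReal (‖x - y‖ ^ 2 * ‖u x‖ ^ 2 * ‖u y‖ ^ 2) =
      ENNReal.ofReal (mass u * (‖x‖ ^ 2 * ‖u x‖ ^ 2) + -2 * (inner ℝ x X * ‖u x‖ ^ 2) +
        Q * ‖u x‖ ^ 2) := fun x => by
    rw [← hin, ofReal_integral_eq_lintegral_ofReal _ (Eventually.of_forall fun y => by positivity)]
    simp only [e]
    exact (hI _ _ _ x).1
  simp only [hlin]
  have hpos' : ∀ x : Space d, 0 ≤ mass u * (‖x‖ ^ 2 * ‖u x‖ ^ 2) + -2 * (inner ℝ x X * ‖u x‖ ^ 2) +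
      Q * ‖u x‖ ^ 2 := fun x => by
    rw [← hin]
    exact integral_nonneg fun y => by positivity
  rw [← ofReal_integral_eq_lintegral_ofReal (hI _ _ _ X).1 (Eventually.of_forall hpos'),
    ENNReal.toReal_ofReal (integral_nonneg hpos'), (hI _ _ _ X).2, real_inner_self_eq_norm_sq]
  refine ⟨ENNReal.ofReal_lt_top, ?_⟩
  ring

/-- The squared norm of a real linear combination of three vectors. -/
theorem norm_sq_combination (u v w : L2 d) (a b c : ℝ) :
    ‖(a : ℂ) • u + (b : ℂ) • v + (c : ℂ) • w‖ ^ 2 = a ^ 2 * ‖u‖ ^ 2 + b ^ 2 * ‖v‖ ^ 2 +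
      c ^ 2 * ‖w‖ ^ 2 + 2 * (a * b * (inner ℂ u v).re + a * c * (inner ℂ u w).re +
        b * c * (inner ℂ v w).re) := by
  have hr : ∀ x : L2 d, ∀ r : ℝ, ‖(r : ℂ) • x‖ ^ 2 = r ^ 2 * ‖x‖ ^ 2 := fun x r => by
    rw [norm_smul, mul_pow, Complex.norm_real, Real.norm_eq_abs, sq_abs]
  have hi : ∀ x y : L2 d, ∀ r s : ℝ, (inner ℂ ((r : ℂ) • x) ((s : ℂ) • y)).re =
      r * s * (inner ℂ x y).re := fun x y r s => by
    rw [inner_smul_left, inner_smul_right, Complex.conj_ofReal, Complex.re_ofReal_mul,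
      Complex.re_ofReal_mul, mul_assoc]
  rw [norm_add_sq (𝕜 := ℂ), norm_add_sq (𝕜 := ℂ), inner_add_left]
  simp only [RCLike.re_eq_complex_re, Complex.add_re, hr, hi]
  ring

/-- Conservation of the energy of the classical oscillator, in each coordinate. -/
theorem gSol_energy (κ t : ℝ) (a b : Space d) (j : Fin d) :
    gSol' κ t a b j ^ 2 + κ * gSol κ t a b j ^ 2 = a j ^ 2 + κ * b j ^ 2 := by
  rw [gSol_eq, gSol'_eq]
  simp only [PiLp.add_apply, PiLp.sub_apply, PiLp.smul_apply, smul_eq_mul]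
  linear_combination (a j ^ 2 + κ * b j ^ 2) * cosK_sq_add κ t

/-- Conservation of energy. The moving frame contributes the conserved energy of the centre of mass
in the potential `λ|x|²/2`, the motion relative to it that of a harmonic oscillator of frequency
`λ + ηM`. -/
theorem energy_solutionMap (lam eta : ℝ) {u : L2 d} (hu : MemSigma 1 u) (t : ℝ) :
    HasFiniteEnergy (solutionMap lam eta u t) ∧
      energy lam eta (solutionMap lam eta u t) = energy lam eta u := by
  have hf : sigmaNorm 1 u ^ 2 < ∞ := ENNReal.pow_lt_top hu
  have hs := sigmaHalfSq_lt_top_of_memSigma_one hu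
  obtain ⟨A, B, h⟩ := exists_hasDerivAt_weyl ((momentSq_le_sigmaNorm u).trans_lt hf)
    ((gradSq_le_sigmaNorm u).trans_lt hf)
  set κ := frequency lam eta u with hκ
  have main : ∀ t, HasFiniteEnergy (solutionMap lam eta u t) ∧
      energy lam eta (solutionMap lam eta u t) = 1 / 2 * ∑ j, (‖B j‖ ^ 2 + κ * ‖A j‖ ^ 2 +
        mass u * (lam - κ) * center u j ^ 2) := by
    intro t
    have hm := momentSq_framed h (solutionPhase lam eta u t)
      (gSol lam t (velocity u) (center u) - gSol κ t (velocity u) (center u))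
      (gSol' lam t (velocity u) (center u) - gSol' κ t (velocity u) (center u)) κ t
    have hg := gradSq_framed h (solutionPhase lam eta u t)
      (gSol lam t (velocity u) (center u) - gSol κ t (velocity u) (center u))
      (gSol' lam t (velocity u) (center u) - gSol' κ t (velocity u) (center u)) κ t
    rw [← solutionMap_eq_framed] at hm hg
    have hs' : sigmaHalfSq (solutionMap lam eta u t) < ∞ := by
      rw [solutionMap_eq_framed]
      exact sigmaHalfSq_framed_lt_top _ _ _ _ _ hs
    have hm' : momentSq (solutionMap lam eta u t) < ∞ := hm ▸ ENNReal.ofReal_lt_top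
    have hi := toReal_interaction hs' hm'
    refine ⟨⟨hg ▸ ENNReal.ofReal_lt_top, hm', hi.1⟩, ?_⟩
    rw [energy, hi.2, hm, hg,
      ENNReal.toReal_ofReal (by positivity), ENNReal.toReal_ofReal (by positivity),
      mass_solutionMap, meanPosition_solutionMap lam eta hs, ← mass_smul_gSol, norm_smul, mul_pow,
      Real.norm_eq_abs, sq_abs, EuclideanSpace.norm_sq_eq]
    -- In each coordinate the cross terms combine, by the definition of the centre, into the
    -- classical energies of the two trajectories, both of which are conserved.
    have hcomp : ∀ j, ‖(((gSol' lam t (velocity u) (center u) - gSol' κ t (velocity u)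
          (center u)) j : ℝ) : ℂ) • u + ((-(κ * sinK κ t) : ℝ) : ℂ) • A j +
          ((cosK κ t : ℝ) : ℂ) • B j‖ ^ 2 + κ * ‖(((gSol lam t (velocity u) (center u) -
          gSol κ t (velocity u) (center u)) j : ℝ) : ℂ) • u + ((cosK κ t : ℝ) : ℂ) • A j +
          ((sinK κ t : ℝ) : ℂ) • B j‖ ^ 2 - eta * mass u ^ 2 *
          ‖gSol lam t (velocity u) (center u) j‖ ^ 2 =
        ‖B j‖ ^ 2 + κ * ‖A j‖ ^ 2 + mass u * (lam - κ) * center u j ^ 2 := by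
      intro j
      have hX : mass u * gSol κ t (velocity u) (center u) j =
          cosK κ t * meanPosition u j + sinK κ t * meanMomentum u j := by
        have := congrArg (fun x : Space d => x j) (mass_smul_gSol κ t u)
        simpa [gSol_eq κ t (meanMomentum u)] using this
      have hP : mass u * gSol' κ t (velocity u) (center u) j =
          cosK κ t * meanMomentum u j - κ * sinK κ t * meanPosition u j := by
        have := congrArg (fun x : Space d => x j) (mass_smul_gSol' κ t u)
        simpa [gSol'_eq κ t (meanMomentum u)] using this
      rw [norm_sq_combination, norm_sq_combination, (inner_eq_moments hs h j).1,
        (inner_eq_moments hs h j).2, Real.norm_eq_abs, sq_abs]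
      have h1 := gSol_energy κ t (velocity u) (center u) j
      have h2 := gSol_energy lam t (velocity u) (center u) j
      have h3 := cosK_sq_add κ t
      have h4 : ‖u‖ ^ 2 = mass u := rfl
      have h5 : eta * mass u = κ - lam := by rw [hκ, frequency]; ring
      rw [h4]
      simp only [PiLp.sub_apply]
      generalize gSol lam t (velocity u) (center u) j = l at *
      generalize gSol' lam t (velocity u) (center u) j = l' at *
      generalize gSol κ t (velocity u) (center u) j = k at *
      generalize gSol' κ t (velocity u) (center u) j = k' at *
      linear_combination (‖B j‖ ^ 2 + κ * ‖A j‖ ^ 2) * h3 - 2 * (l' - k') * hP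
        - 2 * κ * (l - k) * hX + mass u * h2 - mass u * h1 - mass u * l ^ 2 * h5
    rw [← Finset.sum_congr rfl fun j _ => hcomp j, Finset.sum_sub_distrib, Finset.sum_add_distrib,
      ← Finset.mul_sum, ← Finset.mul_sum]
    have h5 : eta * mass u = κ - lam := by rw [hκ, frequency]; ring
    generalize (∑ j, ‖(((gSol lam t (velocity u) (center u) -
          gSol κ t (velocity u) (center u)) j : ℝ) : ℂ) • u + ((cosK κ t : ℝ) : ℂ) • A j +
          ((sinK κ t : ℝ) : ℂ) • B j‖ ^ 2) = Q
    linear_combination (1 / 2 * Q) * h5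
  refine ⟨(main t).1, ?_⟩
  rw [(main t).2, ← (main 0).2, solutionMap_zero]

end

end NonlocalSchrodinger

theorem theorem2 (d : ℕ) (hd : 1 ≤ d) (lam eta : ℝ) :
    -- the group `U_κ` exists and is unique, so that `propagator` is well defined
    (∀ κ : ℝ, ∃! U : ℝ → (L2 d ≃ₗᵢ[ℂ] L2 d), IsSchrodingerGroup κ U) ∧
    -- the solution map of the Cauchy problem
    ∃ S : L2 d → ℝ → L2 d,
      -- existence of a global solution, and unconditional uniqueness
      (∀ v₀ : L2 d, MemSigma (1 / 2) v₀ →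
        IsSolution lam eta (S v₀) ∧ S v₀ 0 = v₀ ∧
        ∀ w : ℝ → L2 d, IsWeakSolution lam eta w → w 0 = v₀ → w = S v₀) ∧
      -- continuous dependence: `S` is continuous from `Σ^{1/2}` to `L^∞_loc(ℝ; Σ^{1/2})`
      (∀ v₀ : L2 d, MemSigma (1 / 2) v₀ → ∀ T : ℝ, ∀ ε : ℝ≥0∞, 0 < ε →
        ∃ δ : ℝ≥0∞, 0 < δ ∧ ∀ w₀ : L2 d, MemSigma (1 / 2) w₀ →
          sigmaNorm (1 / 2) (w₀ - v₀) < δ →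
          ∀ t : ℝ, |t| ≤ T → sigmaNorm (1 / 2) (S w₀ t - S v₀ t) < ε) ∧
      -- conservation of mass
      (∀ v₀ : L2 d, MemSigma (1 / 2) v₀ → ∀ t : ℝ, mass (S v₀ t) = mass v₀) ∧
      -- finiteness and conservation of energy
      (∀ v₀ : L2 d, MemSigma 1 v₀ → ∀ t : ℝ,
        HasFiniteEnergy (S v₀ t) ∧ energy lam eta (S v₀ t) = energy lam eta v₀) ∧
      -- representation of the solution
      (∀ v₀ : L2 d, MemSigma (1 / 2) v₀ →
        ∀ (M κ : ℝ) (a b : Space d), M = mass v₀ → κ = lam + eta * M →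
          a = M⁻¹ • meanMomentum v₀ → b = M⁻¹ • meanPosition v₀ →
          ∀ t : ℝ,
            S v₀ t = Complex.exp (-(Complex.I * (gaugePhase lam eta M a b t : ℂ))) •
              galilean lam t a b (propagator κ t ((galilean κ 0 a b).symm v₀)) ∧
            S v₀ t = Complex.exp (-(Complex.I * (gaugePhase lam eta M a b t : ℂ))) •
              galilean lam t a b ((galilean κ t a b).symm (propagator κ t v₀))) := by
  refine ⟨existsUnique_isSchrodingerGroup, solutionMap lam eta, fun v₀ hv => ?_,
    fun v₀ hv T ε hε => continuous_dependence lam eta hv T hε,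
    fun v₀ _ t => mass_solutionMap lam eta v₀ t, fun v₀ hv t => energy_solutionMap lam eta hv t, ?_⟩
  · refine ⟨(isWeakSolution_solutionMap lam eta ((memSigma_half_iff v₀).1 hv)).isSolution,
      solutionMap_zero lam eta v₀, fun w hw hw0 => ?_⟩
    rw [hw.eq_solutionMap, hw0]
  · rintro v₀ - M κ a b rfl rfl rfl rfl t
    exact ⟨rfl, by rw [galilean_symm_propagator]; rfl⟩
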